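/- Let $M$ be a compact smooth manifold (without boundary) of real dimension $2n$. A generalized Kähler structure $(g,I,J)$ on $M$ is a Riemannian metric $g$ together with two integrable $g$-orthogonal complex structures $I,J$ such that $$d^c_I\omega_I = H = -\,d^c_J\omega_J,\qquad dH=0,$$ where $\omega_I(X,Y)=g(IX,Y)$ and $d^c_I\omega_I(X,Y,Z)=-d\omega_I(IX,IY,IZ)$, and similarly for $J$. It is nondegenerate if $\sigma=[I,J]g^{-1}$ is a nondegenerate pairing on each fibre of $T^*M$. The Lee form of $(g,I)$ is $\theta_I(X)=\tfrac12\sum_i d\omega_I(e_i,Ie_i,X)$ for a $g$-orthonormal frame $\{e_i\}$, similarly $\theta_J$, and $\mathscr H(X,Y)=\sum_{i,j}H(X,e_i,e_j)H(Y,e_i,e_j)$. In the nondegenerate case put $F_\pm=-2g(I\pm J)^{-1}$, that is, $F_\pm(X,Y)=-2g((I\pm J)^{-1}X,Y)$; the Ricci potential is $$\Phi=\log\frac{F_+^{\,n}}{F_-^{\,n}},$$ the logarithm of the ratio of the two top-degree forms. Let $0<T\le\infty$ and let $(g_t,I_t,J_t)$, $t\in[0,T)$, be a smooth solution on $M$ to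 generalized Kähler-Ricci flow, i.e. a smooth family of generalized Kähler structures, with torsion $H_t=d^c_{I_t}\omega_{I_t}$, such that $$\tfrac{\partial}{\partial t}g=-2\,\mathrm{Rc}^g+\tfrac12\mathscr H,\qquad \tfrac{\partial}{\partial t}H=\Delta_gH,\qquad \tfrac{\partial}{\partial t}I=\mathcal L_{\theta_I^\sharp}I,\qquad \tfrac{\partial}{\partial t}J=\mathcal L_{\theta_J^\sharp}J,$$ where $\Delta_g=-(dd^*+d^*d)$. Suppose that $(g_0,I_0,J_0)$ is nondegenerate. Then for every $t\in(0,T)$ the structure $(g_t,I_t,J_t)$ is nondegenerate, its Ricci potential $\Phi_t$ is differentiable, and $$\sup_{M}|\nabla\Phi_t|^2_{g_t}\ \le\ t^{-1}\,\sup_{M}|\Phi_0|^2,$$ both suprema being finite. -/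

import Mathlib

open scoped Manifold ContDiff

namespace GenKahler

noncomputable section

/-! ### Tensor calculus in coordinates

Tensor fields on open subsets of `ℝ^m` are given by their components with respect to the
coordinate frame `∂_1, …, ∂_m`. A metric `G` has components `G y i j = g(∂_i, ∂_j)`; an
endomorphism field `A` has components `A y k j`, the `k`-th component of `A ∂_j`. -/

/-- The coordinate space `ℝ^m`. -/
abbrev Coord (m : ℕ) : Type := EuclideanSpace ℝ (Fin m)

/-- The components of a `k`-form: `ψ y s` is the value on `∂_{s 0}, …, ∂_{s (k-1)}` at `y`. -/
abbrev FormField (m k : ℕ) : Type := Coord m → (Fin k → Fin m) → ℝ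

/-- The partial derivative `∂_i f`. -/
def pd {m : ℕ} (i : Fin m) (f : Coord m → ℝ) (y : Coord m) : ℝ :=
  fderiv ℝ f y (EuclideanSpace.single i 1)

/-- Christoffel symbols `Γ^k_{ij}` of the Levi-Civita connection. -/
def christoffel {m : ℕ} (G : Coord m → Matrix (Fin m) (Fin m) ℝ) (k i j : Fin m)
    (y : Coord m) : ℝ :=
  (1 / 2) * ∑ l, (G y)⁻¹ k l *
    (pd i (fun z => G z j l) y + pd j (fun z => G z i l) y - pd l (fun z => G z i j) y)

/-- The Ricci tensor `Rc_{jk}`. -/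
def ricci {m : ℕ} (G : Coord m → Matrix (Fin m) (Fin m) ℝ) (j k : Fin m) (y : Coord m) : ℝ :=
  ∑ i, (pd i (christoffel G i j k) y - pd j (christoffel G i i k) y +
    ∑ p, (christoffel G i i p y * christoffel G p j k y -
      christoffel G i j p y * christoffel G p i k y))

/-- The exterior derivative of a `k`-form. -/
def extD {m k : ℕ} (ψ : FormField m k) : FormField m (k + 1) := fun y s =>
  ∑ a : Fin (k + 1), (-1) ^ (a : ℕ) * pd (s a) (fun z => ψ z (fun r => s (a.succAbove r))) y

/-- The Levi-Civita covariant derivative `∇_a ψ` of a `k`-form. -/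
def covD {m k : ℕ} (G : Coord m → Matrix (Fin m) (Fin m) ℝ) (a : Fin m) (ψ : FormField m k) :
    FormField m k := fun y s =>
  pd a (fun z => ψ z s) y -
    ∑ r : Fin k, ∑ c, christoffel G c a (s r) y * ψ y (Function.update s r c)

/-- The codifferential `δ = d^*`, `(δψ)(…) = -∑ g^{ab} (∇_a ψ)(∂_b, …)`. -/
def codiff {m k : ℕ} (G : Coord m → Matrix (Fin m) (Fin m) ℝ) (ψ : FormField m (k + 1)) :
    FormField m k := fun y s =>
  -∑ a, ∑ b, (G y)⁻¹ a b * covD G a ψ y (Fin.cons b s : Fin (k + 1) → Fin m)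

/-- The Laplacian `Δ_g = -(d δ + δ d)` on forms of positive degree (with the analyst's sign). -/
def formLaplacian {m k : ℕ} (G : Coord m → Matrix (Fin m) (Fin m) ℝ)
    (ψ : FormField m (k + 1)) : FormField m (k + 1) := fun y s =>
  -(extD (codiff G ψ) y s + codiff G (extD ψ) y s)

/-- The Nijenhuis tensor `N(X,Y) = [AX,AY] - A[AX,Y] - A[X,AY] - [X,Y]` (for `A² = -1`);
this is the `k`-th component of `N(∂_i, ∂_j)`. -/
def nijenhuis {m : ℕ} (A : Coord m → Matrix (Fin m) (Fin m) ℝ) (k i j : Fin m)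
    (y : Coord m) : ℝ :=
  ∑ l, (A y l i * pd l (fun z => A z k j) y - A y l j * pd l (fun z => A z k i) y -
    A y k l * (pd i (fun z => A z l j) y - pd j (fun z => A z l i) y))

/-- The fundamental form `ω(X,Y) = g(AX,Y)`. -/
def fundForm {m : ℕ} (G A : Coord m → Matrix (Fin m) (Fin m) ℝ) : FormField m 2 := fun y s =>
  ∑ k, A y k (s 0) * G y k (s 1)

/-- `d^c ω (X,Y,Z) = -dω(AX,AY,AZ)` for the fundamental form `ω` of `(g, A)`. -/
def dcFundForm {m : ℕ} (G A : Coord m → Matrix (Fin m) (Fin m) ℝ) : FormField m 3 := fun y s =>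
  -∑ a, ∑ b, ∑ c, A y a (s 0) * A y b (s 1) * A y c (s 2) * extD (fundForm G A) y ![a, b, c]

/-- The Lee form `θ(X) = ½ ∑ dω(e_i, A e_i, X)`, with `(e_i)` an orthonormal frame. -/
def leeForm {m : ℕ} (G A : Coord m → Matrix (Fin m) (Fin m) ℝ) (k : Fin m) (y : Coord m) : ℝ :=
  (1 / 2) * ∑ a, ∑ b, ∑ c, (G y)⁻¹ a b * A y c b * extD (fundForm G A) y ![a, c, k]

/-- The Lee vector field `θ^♯`. -/
def leeField {m : ℕ} (G A : Coord m → Matrix (Fin m) (Fin m) ℝ) (k : Fin m) (y : Coord m) : ℝ :=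
  ∑ l, (G y)⁻¹ k l * leeForm G A l y

/-- The Lie derivative `(L_X A)(Y) = [X, AY] - A[X,Y]` of an endomorphism field:
the `k`-th component of `(L_X A)(∂_j)`. -/
def lieEnd {m : ℕ} (X : Fin m → Coord m → ℝ) (A : Coord m → Matrix (Fin m) (Fin m) ℝ)
    (k j : Fin m) (y : Coord m) : ℝ :=
  ∑ l, (X l y * pd l (fun z => A z k j) y - A y l j * pd l (X k) y + A y k l * pd j (X l) y)

/-- `𝓗(X,Y) = ∑ H(X,e_i,e_j) H(Y,e_i,e_j)`, with `(e_i)` an orthonormal frame. -/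
def torsionSq {m : ℕ} (G : Coord m → Matrix (Fin m) (Fin m) ℝ) (H : FormField m 3)
    (i j : Fin m) (y : Coord m) : ℝ :=
  ∑ a, ∑ b, ∑ c, ∑ d, (G y)⁻¹ a c * (G y)⁻¹ b d * H y ![i, a, b] * H y ![j, c, d]

/-! ### Tensor fields on a manifold -/

/-- Fields of bilinear forms on the tangent spaces of `M`. -/
abbrev BilinField (m : ℕ) (M : Type*) [TopologicalSpace M] [ChartedSpace (Coord m) M] :=
  (x : M) → TangentSpace (𝓡 m) x →L[ℝ] TangentSpace (𝓡 m) x →L[ℝ] ℝ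

/-- Fields of endomorphisms of the tangent spaces of `M`. -/
abbrev EndField (m : ℕ) (M : Type*) [TopologicalSpace M] [ChartedSpace (Coord m) M] :=
  (x : M) → TangentSpace (𝓡 m) x →L[ℝ] TangentSpace (𝓡 m) x

section Manifold

variable {m n : ℕ} {M : Type*} [TopologicalSpace M] [ChartedSpace (Coord m) M]

/-- The coordinate vector `∂_i` of the chart `e` at the point with coordinates `y`. -/
def coordVec (e : OpenPartialHomeomorph M (Coord m)) (y : Coord m) (i : Fin m) :
    TangentSpace (𝓡 m) (e.symm y) :=
  mfderiv (𝓡 m) (𝓡 m) e.symm y (EuclideanSpace.single i (1 : ℝ) : Coord m)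

/-- The components `g(∂_i, ∂_j)` in the chart `e`. -/
def bilinComp (e : OpenPartialHomeomorph M (Coord m)) (g : BilinField m M) (y : Coord m) :
    Matrix (Fin m) (Fin m) ℝ :=
  fun i j => g (e.symm y) (coordVec e y i) (coordVec e y j)

/-- The components in the chart `e` of an endomorphism field:
entry `(k, j)` is the `k`-th component of `A ∂_j`. -/
def endComp (e : OpenPartialHomeomorph M (Coord m)) (A : EndField m M) (y : Coord m) :
    Matrix (Fin m) (Fin m) ℝ :=
  fun k j =>
    let v : Coord m := mfderiv (𝓡 m) (𝓡 m) e (e.symm y) (A (e.symm y) (coordVec e y j))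
    v k

/-- `(g, I, J)` is a generalized Kähler structure on `M`: `g` is a smooth Riemannian metric, `I`
and `J` are smooth integrable `g`-orthogonal complex structures, and
`d^c_I ω_I = H = -d^c_J ω_J` with `dH = 0`. Differential conditions are imposed in every smooth
chart. -/
structure IsGeneralizedKahler (g : BilinField m M) (I J : EndField m M) : Prop where
  symm : ∀ x v w, g x v w = g x w v
  posDef : ∀ x v, v ≠ 0 → 0 < g x v v
  sq_I : ∀ x v, I x (I x v) = -v
  sq_J : ∀ x v, J x (J x v) = -v
  compat_I : ∀ x v w, g x (I x v) (I x w) = g x v w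
  compat_J : ∀ x v w, g x (J x v) (J x w) = g x v w
  smooth_g : ∀ e ∈ IsManifold.maximalAtlas (𝓡 m) ∞ M, ∀ i j,
    ContDiffOn ℝ ∞ (fun y => bilinComp e g y i j) e.target
  smooth_I : ∀ e ∈ IsManifold.maximalAtlas (𝓡 m) ∞ M, ∀ i j,
    ContDiffOn ℝ ∞ (fun y => endComp e I y i j) e.target
  smooth_J : ∀ e ∈ IsManifold.maximalAtlas (𝓡 m) ∞ M, ∀ i j,
    ContDiffOn ℝ ∞ (fun y => endComp e J y i j) e.target
  integrable_I : ∀ e ∈ IsManifold.maximalAtlas (𝓡 m) ∞ M, ∀ y ∈ e.target, ∀ k i j,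
    nijenhuis (endComp e I) k i j y = 0
  integrable_J : ∀ e ∈ IsManifold.maximalAtlas (𝓡 m) ∞ M, ∀ y ∈ e.target, ∀ k i j,
    nijenhuis (endComp e J) k i j y = 0
  torsion : ∀ e ∈ IsManifold.maximalAtlas (𝓡 m) ∞ M, ∀ y ∈ e.target, ∀ s,
    dcFundForm (bilinComp e g) (endComp e I) y s = -dcFundForm (bilinComp e g) (endComp e J) y s
  torsion_closed : ∀ e ∈ IsManifold.maximalAtlas (𝓡 m) ∞ M, ∀ y ∈ e.target, ∀ s,
    extD (dcFundForm (bilinComp e g) (endComp e I)) y s = 0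

/-- The musical isomorphism `T^*_x M → T_x M`, the inverse of `v ↦ g(v, ·)`. -/
def sharp (g : BilinField m M) (x : M) :
    (TangentSpace (𝓡 m) x →L[ℝ] ℝ) →L[ℝ] TangentSpace (𝓡 m) x :=
  ContinuousLinearMap.inverse (g x)

/-- The Poisson tensor `σ = [I, J] g⁻¹` as a pairing on `T^*_x M`. -/
def poisson (g : BilinField m M) (I J : EndField m M) (x : M)
    (α β : TangentSpace (𝓡 m) x →L[ℝ] ℝ) : ℝ :=
  β (I x (J x (sharp g x α)) - J x (I x (sharp g x α)))

/-- The structure is nondegenerate: `σ` is a nondegenerate pairing on each fibre of `T^*M`. -/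
def IsNondegenerate (g : BilinField m M) (I J : EndField m M) : Prop :=
  ∀ x (α : TangentSpace (𝓡 m) x →L[ℝ] ℝ), (∀ β, poisson g I J x α β = 0) → α = 0

/-- The squared norm `|∇f|²_g = g(∇f, ∇f)`, where `∇f = (df)^♯`. -/
def gradSq (g : BilinField m M) (f : M → ℝ) (x : M) : ℝ :=
  let df : TangentSpace (𝓡 m) x →L[ℝ] ℝ := mfderiv (𝓡 m) 𝓘(ℝ, ℝ) f x
  g x (sharp g x df) (sharp g x df)

/-- The value on `v_0, …, v_{2n-1}` of the `n`-th exterior power `F ∧ ⋯ ∧ F` of a 2-form `F`. -/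
def wedgePow {V : Type*} (n : ℕ) (F : V → V → ℝ) (v : Fin (2 * n) → V) : ℝ :=
  (1 / 2) ^ n * ∑ τ : Equiv.Perm (Fin (2 * n)), ((Equiv.Perm.sign τ : ℤ) : ℝ) *
    ∏ i : Fin n, F (v (τ ⟨2 * i, by omega⟩)) (v (τ ⟨2 * i + 1, by omega⟩))

/-- The 2-form `-2 g A⁻¹`, i.e. `(v, w) ↦ -2 g(A⁻¹ v, w)`, at `x`. -/
def twoFormOf (g : BilinField m M) (A : EndField m M) (x : M)
    (v w : TangentSpace (𝓡 m) x) : ℝ :=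
  -2 * g x (ContinuousLinearMap.inverse (A x) v) w

/-- The time interval `[0, T)`, with `T = ∞` allowed. -/
def timeSet (T : EReal) : Set ℝ := {t | 0 ≤ t ∧ (t : EReal) < T}

/-- `(g_t, I_t, J_t)`, `t ∈ [0, T)`, is a (smooth) solution to generalized Kähler-Ricci flow:
a smooth family of generalized Kähler structures with torsion `H = d^c_I ω_I` such that
`∂_t g = -2 Rc + ½ 𝓗`, `∂_t H = Δ_g H`, `∂_t I = L_{θ_I^♯} I`, `∂_t J = L_{θ_J^♯} J`.
At `t = 0` the time derivatives are one-sided. -/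
structure IsGKRFSolution (T : EReal) (g : ℝ → BilinField m M) (I J : ℝ → EndField m M) :
    Prop where
  isGK : ∀ t ∈ timeSet T, IsGeneralizedKahler (g t) (I t) (J t)
  smooth_g : ∀ e ∈ IsManifold.maximalAtlas (𝓡 m) ∞ M, ∀ i j,
    ContDiffOn ℝ ∞ (fun p : ℝ × Coord m => bilinComp e (g p.1) p.2 i j) (timeSet T ×ˢ e.target)
  smooth_I : ∀ e ∈ IsManifold.maximalAtlas (𝓡 m) ∞ M, ∀ i j,
    ContDiffOn ℝ ∞ (fun p : ℝ × Coord m => endComp e (I p.1) p.2 i j) (timeSet T ×ˢ e.target)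
  smooth_J : ∀ e ∈ IsManifold.maximalAtlas (𝓡 m) ∞ M, ∀ i j,
    ContDiffOn ℝ ∞ (fun p : ℝ × Coord m => endComp e (J p.1) p.2 i j) (timeSet T ×ˢ e.target)
  evol_g : ∀ e ∈ IsManifold.maximalAtlas (𝓡 m) ∞ M, ∀ y ∈ e.target, ∀ t ∈ timeSet T, ∀ i j,
    HasDerivWithinAt (fun s => bilinComp e (g s) y i j)
      (-2 * ricci (bilinComp e (g t)) i j y +
        (1 / 2) * torsionSq (bilinComp e (g t))
          (dcFundForm (bilinComp e (g t)) (endComp e (I t))) i j y)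
      (timeSet T) t
  evol_H : ∀ e ∈ IsManifold.maximalAtlas (𝓡 m) ∞ M, ∀ y ∈ e.target, ∀ t ∈ timeSet T, ∀ s,
    HasDerivWithinAt (fun r => dcFundForm (bilinComp e (g r)) (endComp e (I r)) y s)
      (formLaplacian (bilinComp e (g t)) (dcFundForm (bilinComp e (g t)) (endComp e (I t))) y s)
      (timeSet T) t
  evol_I : ∀ e ∈ IsManifold.maximalAtlas (𝓡 m) ∞ M, ∀ y ∈ e.target, ∀ t ∈ timeSet T, ∀ k j,
    HasDerivWithinAt (fun s => endComp e (I s) y k j)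
      (lieEnd (leeField (bilinComp e (g t)) (endComp e (I t))) (endComp e (I t)) k j y)
      (timeSet T) t
  evol_J : ∀ e ∈ IsManifold.maximalAtlas (𝓡 m) ∞ M, ∀ y ∈ e.target, ∀ t ∈ timeSet T, ∀ k j,
    HasDerivWithinAt (fun s => endComp e (J s) y k j)
      (lieEnd (leeField (bilinComp e (g t)) (endComp e (J t))) (endComp e (J t)) k j y)
      (timeSet T) t

end Manifold

/-- The Ricci potential `Φ = log (F_+^n / F_-^n)` on a manifold of dimension `2n`, where
`F_± = -2 g (I ± J)⁻¹`. The quotient of the top-degree forms `F_±^n` is computed on a basis of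
`T_x M`; it does not depend on the basis. -/
def ricciPotential {n : ℕ} {M : Type*} [TopologicalSpace M] [ChartedSpace (Coord (2 * n)) M]
    (g : BilinField (2 * n) M) (I J : EndField (2 * n) M) (x : M) : ℝ :=
  let b : Fin (2 * n) → TangentSpace (𝓡 (2 * n)) x :=
    fun i => (EuclideanSpace.single i (1 : ℝ) : Coord (2 * n))
  Real.log (wedgePow n (twoFormOf g (fun z => I z + J z) x) b /
    wedgePow n (twoFormOf g (fun z => I z - J z) x) b)

end

end GenKahler

/-!
The proof expresses the whole evolution of `I` and `J` through the torsion `H` and the inverse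
`S = [I, J]⁻¹` of the commutator, which is where nondegeneracy enters; the estimate is then a
Bernstein type maximum principle for a solution of the heat equation.

*Algebra.* On an integrable Hermitian manifold `(g, A)` put `g(H_X Y, Z) = dω(AX, AY, AZ)`, that is
`H = -d^cω`. The connection `∇ + ½ H` preserves the complex structure
(`HermitianJet.covariant_eq`), and `H` has type `(2,1) + (1,2)`.
For a generalized Kähler structure this holds for `(I, H)` and for `(J, -H)`, so `∇I`, `∇J` and the
Lee forms become commutators and traces in `H`, `I`, `J`. The ratio of the top powers of `F_±` is a
ratio of Pfaffians, whose squares are proportional to determinants; hence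
`Φ = ½ log |det (I - J)| - ½ log |det (I + J)|` (`ricciPotential_eq`). Since `S` anticommutes with
`I` and `J`, the type condition gives
* `dΦ = 2 tr (H S)` and `d log |det [I, J]| = -2 tr (H (IJ + JI) S)`,
* `θ_I = ½ dΦ ∘ JI + ¼ d log |det [I, J]|` and `θ_J = ½ dΦ ∘ IJ + ¼ d log |det [I, J]|`,
  and therefore `θ_I^♯ - θ_J^♯ = ½ [I, J] ∇Φ` (`LocalGK.leeField_sub`).

*Evolution of the potential.* Inserting `∂_t I = L_{θ_I^♯} I` and `∂_t J = L_{θ_J^♯} J` in the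
derivative of `Φ`, the covariant derivatives of the Lee fields combine into
`2 tr (S ∇(θ_I^♯ - θ_J^♯))`, whose leading part is `ΔΦ`, and all lower-order terms cancel:
`∂_t Φ = ΔΦ` (`LocalGK.heat_pairPhi`).

*Persistence of nondegeneracy.* The same computation for `log |det [I, J]|` gives, at its spatial
critical points, the Laplacian plus an error that is a smooth expression in `g`, `I`, `J` without
any inverse of `[I, J]` (`LocalGK.volError`, `LocalGK.evolution_pairVol`). At a critical point
`dΦ = 2 θ_I ∘ IJ`, which is why the gradient of `Φ` can be eliminated. By compactness the error is
bounded up to the first time at which `[I, J]` could degenerate; hence `log |det [I, J]|` is bounded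
below up to that time, and `[I, J]` does not degenerate (`IsGKRFSolution.commDet_ne_zero`).

*Gradient estimate.* Under `∂_t g = -2 Rc + ½ 𝓗` the Ricci terms in Bochner's formula
(`LocalMetric.bochner`) and in the derivative of the inverse metric cancel, and what remains,
`-2 |∇²Φ|² - ½ 𝓗(∇Φ, ∇Φ)`, is nonpositive. So `(t - c) |∇Φ|² + ½ Φ²` is a subsolution of the heat
equation (`LocalFlow.exists_hasDerivAt_bernstein`). The maximum principle
(`le_add_mul_of_deriv_at_max_le`) bounds it for `t ≥ c > 0` by its maximum at time `c`, which is
at most `½ sup |Φ_0|²` because `|Φ|` does not grow. With `c = t / 2` this is the asserted bound.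
-/

namespace GenKahler

open scoped Matrix

noncomputable section

/-! ### Linear algebra of a pair of complex structures with torsion -/

section Algebra

set_option linter.unusedSectionVars false

variable {ι : Type*} [Fintype ι] [DecidableEq ι]

/-- The endomorphism `H_v = ∑ v^a H_a`. -/
def contr (H : ι → Matrix ι ι ℝ) (v : ι → ℝ) : Matrix ι ι ℝ := ∑ a, v a • H a

lemma contr_add (H : ι → Matrix ι ι ℝ) (v w : ι → ℝ) :
    contr H (v + w) = contr H v + contr H w := by
  simp [contr, add_smul, Finset.sum_add_distrib]

lemma contr_smul (H : ι → Matrix ι ι ℝ) (c : ℝ) (v : ι → ℝ) :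
    contr H (c • v) = c • contr H v := by
  simp [contr, Finset.smul_sum, smul_smul]

lemma contr_single (H : ι → Matrix ι ι ℝ) (a : ι) : contr H (Pi.single a 1) = H a := by
  simp [contr, Pi.single_apply]

lemma contr_mulVec_apply (H : ι → Matrix ι ι ℝ) (v w : ι → ℝ) (k : ι) :
    (contr H v *ᵥ w) k = ∑ a, ∑ b, v a * w b * H a k b := by
  simp only [Matrix.mulVec, dotProduct, contr, Matrix.sum_apply, Matrix.smul_apply, smul_eq_mul,
    Finset.sum_mul]
  rw [Finset.sum_comm]
  exact Finset.sum_congr rfl fun a _ => Finset.sum_congr rfl fun b _ => by ring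

lemma sum_reverse (f : ι → ι → ι → ℝ) :
    ∑ a, ∑ b, ∑ c, f a b c = ∑ c, ∑ b, ∑ a, f a b c := by
  rw [Finset.sum_congr rfl fun a _ => Finset.sum_comm, Finset.sum_comm]
  exact Finset.sum_congr rfl fun c _ => Finset.sum_comm

lemma sum_rotate (f : ι → ι → ι → ℝ) :
    ∑ a, ∑ b, ∑ c, f a b c = ∑ b, ∑ c, ∑ a, f a b c := by
  rw [Finset.sum_comm]
  exact Finset.sum_congr rfl fun c _ => Finset.sum_comm

/-- Two complex structures `I`, `J` on a vector space together with a torsion tensor `H_v w`, skew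
in `v` and `w` and of type `(2,1) + (1,2)` with respect to both `I` and `J`. The type condition is
`H(v,w,z) = H(Av,Aw,z) + H(Av,w,Az) + H(v,Aw,Az)`, read as an identity of endomorphisms. -/
structure TorsionAlg (I J : Matrix ι ι ℝ) (H : ι → Matrix ι ι ℝ) : Prop where
  sqI : I * I = -1
  sqJ : J * J = -1
  typeI : ∀ v, contr H (I.mulVec v) * I - I * contr H (I.mulVec v) =
    contr H v + I * contr H v * I
  typeJ : ∀ v, contr H (J.mulVec v) * J - J * contr H (J.mulVec v) =
    contr H v + J * contr H v * J
  skew : ∀ v w, (contr H v).mulVec w = -(contr H w).mulVec v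

/-- The type condition moves a complex structure `I` from inside a trace to the argument of the
torsion, as long as the remaining factor `M` anticommutes with `I`. -/
lemma trace_contr_of_anticomm {I : Matrix ι ι ℝ} {H : ι → Matrix ι ι ℝ} (hI : I * I = -1)
    (hty : ∀ v, contr H (I.mulVec v) * I - I * contr H (I.mulVec v) =
      contr H v + I * contr H v * I)
    {M : Matrix ι ι ℝ} (hM : M * I = -(I * M)) (v : ι → ℝ) :
    (contr H v * (I * M)).trace = -(contr H (I.mulVec v) * M).trace := by
  have h := congrArg (fun X => (X * (I * M)).trace) (hty v)
  simp only [sub_mul, add_mul, Matrix.trace_sub, Matrix.trace_add] at h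
  have e1 : (contr H (I.mulVec v) * I * (I * M)).trace = -(contr H (I.mulVec v) * M).trace := by
    rw [show contr H (I.mulVec v) * I * (I * M) = contr H (I.mulVec v) * (I * I) * M by
      noncomm_ring, hI]; simp
  have e2 : (I * contr H (I.mulVec v) * (I * M)).trace = (contr H (I.mulVec v) * M).trace := by
    rw [mul_assoc, Matrix.trace_mul_comm, show contr H (I.mulVec v) * (I * M) * I =
      contr H (I.mulVec v) * (I * (M * I)) by noncomm_ring, hM,
      show I * -(I * M) = -(I * I) * M by noncomm_ring, hI]; simp
  have e3 : (I * contr H v * I * (I * M)).trace = (contr H v * (I * M)).trace := by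
    rw [show I * contr H v * I * (I * M) = I * (contr H v * ((I * I) * M)) by noncomm_ring, hI,
      Matrix.trace_mul_comm, show contr H v * (-1 * M) * I = -(contr H v * (M * I)) by
      noncomm_ring, hM]; simp
  rw [e1, e2, e3] at h
  linarith

variable {I J S : Matrix ι ι ℝ}

lemma inv_comm_anticomm_left (hI : I * I = -1) (hS : S * (I * J - J * I) = 1) :
    S * I = -(I * S) := by
  have hS' : (I * J - J * I) * S = 1 := mul_eq_one_comm.mp hS
  have hQ : (I * J - J * I) * I = -(I * (I * J - J * I)) := by
    linear_combination (norm := noncomm_ring) hI * J - J * hI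
  linear_combination (norm := noncomm_ring) S * hQ * S - S * I * hS' - hS * (I * S)

lemma inv_comm_anticomm_right (hJ : J * J = -1) (hS : S * (I * J - J * I) = 1) :
    S * J = -(J * S) := by
  have h := inv_comm_anticomm_left (I := J) (J := I) (S := -S) hJ
    (by linear_combination (norm := noncomm_ring) hS)
  linear_combination (norm := noncomm_ring) -h

/-- `I` is recovered from `S = [I,J]⁻¹`: it is a sum of products of `J`, resp. `I`, with
endomorphisms anticommuting with it, to which `trace_contr_of_anticomm` applies. -/
lemma left_eq_inv_comm (hI : I * I = -1) (hJ : J * J = -1) (hS : S * (I * J - J * I) = 1) :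
    I = -(2 : ℝ) • (J * S) - (I * J + J * I) * (I * S) := by
  have hS' : (I * J - J * I) * S = 1 := mul_eq_one_comm.mp hS
  have h1 := inv_comm_anticomm_left hI hS
  have h2 := inv_comm_anticomm_right hJ hS
  rw [neg_smul, two_smul]
  linear_combination (norm := noncomm_ring) -(I * hS') + hI * J * S + J * hI * S

lemma anticommutator_mul_left (hI : I * I = -1) :
    (I * J + J * I) * I = I * (I * J + J * I) := by
  linear_combination (norm := noncomm_ring) J * hI - hI * J

lemma anticommutator_mul_right (hJ : J * J = -1) :
    (I * J + J * I) * J = J * (I * J + J * I) := by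
  linear_combination (norm := noncomm_ring) I * hJ - hJ * I

/-- `{I,J}² - [I,J]² = 4` for two complex structures, multiplied by `S = [I,J]⁻¹`. -/
lemma anticommutator_sq_mul_inv_comm (hI : I * I = -1) (hJ : J * J = -1)
    (hS : S * (I * J - J * I) = 1) :
    (I * J + J * I) * ((I * J + J * I) * S) = (4 : ℝ) • S + (I * J - J * I) := by
  have hS' : (I * J - J * I) * S = 1 := mul_eq_one_comm.mp hS
  have h4 : (4 : ℝ) • S = S + S + S + S := by module
  rw [h4]
  linear_combination (norm := noncomm_ring) (I * J - J * I) * hS' + 2 * (I * hJ * I * S) +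
    2 * (J * hI * J * S) - 2 * hI * S - 2 * hJ * S

/-- The Lee form of `(g, I)`, expressed by the torsion and `S = [I,J]⁻¹`. -/
lemma half_trace_contr_left {H : ι → Matrix ι ι ℝ} (h : TorsionAlg I J H)
    (hS : S * (I * J - J * I) = 1) (v : ι → ℝ) :
    (1 / 2) * (I * contr H (I.mulVec v)).trace =
      (contr H ((J * I).mulVec v) * S).trace -
        (1 / 2) * (contr H v * ((I * J + J * I) * S)).trace := by
  have a1 := inv_comm_anticomm_left h.sqI hS
  have a2 := inv_comm_anticomm_right h.sqJ hS
  have k1 := trace_contr_of_anticomm h.sqJ h.typeJ a2 (I.mulVec v)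
  have a3 : ((I * J + J * I) * S) * I = -(I * ((I * J + J * I) * S)) := by
    rw [mul_assoc, a1, mul_neg, ← mul_assoc, anticommutator_mul_left h.sqI, mul_assoc]
  have k2 := trace_contr_of_anticomm h.sqI h.typeI a3 v
  have k3 := trace_contr_of_anticomm h.sqI h.typeI a3 (I.mulVec v)
  have e : (contr H (I.mulVec v) * I).trace = -2 * (contr H (I.mulVec v) * (J * S)).trace -
      (contr H (I.mulVec v) * (I * ((I * J + J * I) * S))).trace := by
    have h0 := congrArg (fun X => (contr H (I.mulVec v) * X).trace)
      (left_eq_inv_comm (S := S) h.sqI h.sqJ hS)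
    rw [h0, ← mul_assoc (I * J + J * I), anticommutator_mul_left h.sqI, mul_assoc I]
    simp [mul_sub]
  rw [Matrix.trace_mul_comm, e, k1, k3]
  simp only [Matrix.mulVec_mulVec, h.sqI]
  have e4 : contr H ((-1 : Matrix ι ι ℝ).mulVec v) = -contr H v := by
    rw [Matrix.neg_mulVec, Matrix.one_mulVec, ← neg_one_smul ℝ, contr_smul, neg_one_smul]
  rw [e4]
  simp
  ring

lemma TorsionAlg.swap {H : ι → Matrix ι ι ℝ} (h : TorsionAlg I J H) : TorsionAlg J I H :=
  ⟨h.sqJ, h.sqI, h.typeJ, h.typeI, h.skew⟩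

/-- The Lee form of `(g, J)`, expressed by the torsion and `S = [I,J]⁻¹`. -/
lemma half_trace_contr_right {H : ι → Matrix ι ι ℝ} (h : TorsionAlg I J H)
    (hS : S * (I * J - J * I) = 1) (v : ι → ℝ) :
    -(1 / 2) * (J * contr H (J.mulVec v)).trace =
      (contr H ((I * J).mulVec v) * S).trace -
        (1 / 2) * (contr H v * ((I * J + J * I) * S)).trace := by
  have k := half_trace_contr_left (S := -S) h.swap
    (by linear_combination (norm := noncomm_ring) hS) v
  rw [add_comm (J * I)] at k
  simp only [mul_neg, Matrix.trace_neg] at k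
  linarith

/-- The trace of `S I` against the Lie derivative `D_X I - (∇X) I + I ∇X`, where
`D_X I = -½ [H_X, I]` and `C = H_X`, `U = ∇X`. -/
lemma trace_inv_comm_lie_left (hI : I * I = -1) (a1 : S * I = -(I * S)) (C U : Matrix ι ι ℝ)
    {L : Matrix ι ι ℝ} (hL : L = -(1 / 2 : ℝ) • (C * I - I * C) - U * I + I * U) :
    (S * I * L).trace = -(C * S).trace - 2 * (S * U).trace := by
  have e0 : I * S * I = S := by
    linear_combination (norm := noncomm_ring) I * a1 - hI * S
  have t1 : (S * I * (C * I)).trace = (C * S).trace := by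
    rw [← mul_assoc, Matrix.trace_mul_comm, ← mul_assoc, ← mul_assoc, e0, Matrix.trace_mul_comm]
  have t2 : (S * I * (I * C)).trace = -(C * S).trace := by
    rw [← mul_assoc, mul_assoc S, hI, Matrix.trace_mul_comm]; simp
  have t3 : (S * I * (U * I)).trace = (S * U).trace := by
    rw [← mul_assoc, Matrix.trace_mul_comm, ← mul_assoc, ← mul_assoc, e0]
  have t4 : (S * I * (I * U)).trace = -(S * U).trace := by
    rw [← mul_assoc, mul_assoc S, hI]; simp
  rw [hL]
  simp only [mul_add, mul_sub, Matrix.trace_add, Matrix.trace_sub, Matrix.mul_smul,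
    Matrix.trace_smul, t1, t2, t3, t4, smul_eq_mul]
  ring

/-- The trace of `S J` against the Lie derivative `D_X I - (∇X) I + I ∇X`. -/
lemma trace_inv_comm_lie_mixed (a1 : S * I = -(I * S)) (a2 : S * J = -(J * S))
    (C U : Matrix ι ι ℝ)
    {L : Matrix ι ι ℝ} (hL : L = -(1 / 2 : ℝ) • (C * I - I * C) - U * I + I * U) :
    (S * J * L).trace = (1 / 2) * (C * ((I * J + J * I) * S)).trace +
      ((I * J + J * I) * S * U).trace := by
  have e0 : I * (S * J) = -(I * (J * S)) := by rw [a2, mul_neg]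
  have e1 : S * (J * I) = J * (I * S) := by
    linear_combination (norm := noncomm_ring) a2 * I - J * a1
  have key : ∀ D : Matrix ι ι ℝ, (S * J * (D * I - I * D)).trace =
      -((I * J + J * I) * S * D).trace := by
    intro D
    have t1 : (S * J * (D * I)).trace = -(I * J * S * D).trace := by
      rw [← mul_assoc, Matrix.trace_mul_comm, ← mul_assoc, e0]; simp [mul_assoc]
    rw [mul_sub, Matrix.trace_sub, t1, show S * J * (I * D) = S * (J * I) * D by noncomm_ring, e1]
    simp only [add_mul, Matrix.trace_add, mul_assoc]
    ring
  have hc : (S * J * C * I).trace - (S * J * (I * C)).trace =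
      -((I * J + J * I) * S * C).trace := by
    rw [← key C, mul_sub, Matrix.trace_sub, mul_assoc (S * J)]
  rw [hL, show -(1 / 2 : ℝ) • (C * I - I * C) - U * I + I * U =
    -(1 / 2 : ℝ) • (C * I - I * C) - (U * I - I * U) by abel]
  rw [mul_sub, Matrix.trace_sub, key U, Matrix.mul_smul, Matrix.trace_smul, key C,
    Matrix.trace_mul_comm C]
  simp only [smul_eq_mul]
  ring

/-- The trace of `Y ↦ M (D_Y Q) Z` for `Q = [I,J]`, where `D_Y I = -½ [H_Y, I]`,
`D_Y J = ½ [H_Y, J]` and `M` anticommutes with `I` and `J`. -/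
lemma trace_mul_covariant_comm {H : ι → Matrix ι ι ℝ} (h : TorsionAlg I J H)
    {M : Matrix ι ι ℝ} (m1 : M * I = -(I * M)) (m2 : M * J = -(J * M))
    {DI DJ : ι → Matrix ι ι ℝ}
    (hDI : ∀ a, DI a = -(1 / 2 : ℝ) • (H a * I - I * H a))
    (hDJ : ∀ a, DJ a = (1 / 2 : ℝ) • (H a * J - J * H a)) (Z : ι → ℝ) :
    ∑ a, (M * (DI a * J + I * DJ a - DJ a * I - J * DI a)).mulVec Z a =
      -(1 / 2) * (contr H ((I * J + J * I).mulVec Z) * M).trace +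
        (1 / 2) * (contr H Z * ((I * J + J * I) * M)).trace := by
  have hQ : ∀ a, DI a * J + I * DJ a - DJ a * I - J * DI a =
      -(1 / 2 : ℝ) • (H a * (I * J + J * I) + (I * J + J * I) * H a) +
        (I * H a * J + J * H a * I) := by
    intro a
    rw [hDI, hDJ]
    simp only [mul_add, add_mul, mul_sub, sub_mul, smul_sub, smul_add, Matrix.smul_mul,
      Matrix.mul_smul, mul_assoc]
    module
  have hsk : ∀ (w : ι → ℝ) a, (H a).mulVec w = -(contr H w).mulVec (Pi.single a 1) := by
    intro w a
    rw [← h.skew, contr_single]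
  have htr : ∀ (A : Matrix ι ι ℝ) w, ∑ a, (A * H a).mulVec w a = -(A * contr H w).trace := by
    intro A w
    simp only [← Matrix.mulVec_mulVec, hsk, Matrix.mulVec_neg, Pi.neg_apply,
      Finset.sum_neg_distrib, Matrix.trace]
    congr 1
    refine Finset.sum_congr rfl fun a _ => ?_
    rw [Matrix.mulVec_mulVec]
    simp
  have e : ∀ a, (M * (DI a * J + I * DJ a - DJ a * I - J * DI a)).mulVec Z a =
      -(1 / 2) * (M * H a).mulVec ((I * J + J * I).mulVec Z) a +
      -(1 / 2) * (M * (I * J + J * I) * H a).mulVec Z a +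
      (M * I * H a).mulVec (J.mulVec Z) a + (M * J * H a).mulVec (I.mulVec Z) a := by
    intro a
    rw [hQ]
    simp only [Matrix.mulVec_mulVec, mul_add, add_mul, Matrix.mul_smul, Matrix.add_mulVec,
      Matrix.smul_mulVec, Matrix.mulVec_add, Pi.add_apply, Pi.smul_apply, smul_eq_mul, mul_assoc]
    ring
  simp only [e, Finset.sum_add_distrib, ← Finset.mul_sum, htr]
  have k1 := trace_contr_of_anticomm h.sqI h.typeI m1 (J.mulVec Z)
  have k2 := trace_contr_of_anticomm h.sqJ h.typeJ m2 (I.mulVec Z)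
  have c1 : M * (I * J + J * I) = (I * J + J * I) * M := by
    linear_combination (norm := noncomm_ring) m1 * J - I * m2 + m2 * I - J * m1
  rw [m1, m2, c1]
  simp only [neg_mul, Matrix.trace_neg, Matrix.trace_mul_comm _ (contr H _), k1, k2]
  simp only [Matrix.mulVec_mulVec, Matrix.add_mulVec, contr_add, add_mul, mul_add,
    Matrix.trace_add]
  ring

end Algebra

/-! ### First-order jets of integrable Hermitian structures -/

section Jets

set_option linter.unusedSectionVars false

variable {ι : Type*} [Fintype ι] [DecidableEq ι]

lemma contr_neg (H : ι → Matrix ι ι ℝ) (v : ι → ℝ) : contr H (-v) = -contr H v := by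
  simp [contr]

/-- The first-order data at a point of a Hermitian structure `(G, A)` with integrable `A`:
`D a` is the covariant derivative `∇_a A` for the Levi-Civita connection of `G`. The fields
`anticomm` and `skew` differentiate `A² = -1` and the skewness of `ω = g(A·,·)`, and `integrable` is
the vanishing of the Nijenhuis tensor, written with the torsion-free connection. -/
structure HermitianJet (G A : Matrix ι ι ℝ) (D : ι → Matrix ι ι ℝ) : Prop where
  sq : A * A = -1
  compat : Aᵀ * G = -(G * A)
  anticomm : ∀ a, D a * A = -(A * D a)
  skew : ∀ a, (G * D a)ᵀ = -(G * D a)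
  integrable : ∀ v w, contr D (A *ᵥ v) *ᵥ w - contr D (A *ᵥ w) *ᵥ v =
    A *ᵥ (contr D v *ᵥ w) - A *ᵥ (contr D w *ᵥ v)

/-- The covariant derivative `(∇_X ω)(Y, Z) = g((∇_X A) Y, Z)` of the fundamental form. -/
def covOmega (G : Matrix ι ι ℝ) (D : ι → Matrix ι ι ℝ) (X Y Z : ι → ℝ) : ℝ :=
  Z ⬝ᵥ (G *ᵥ (contr D X *ᵥ Y))

/-- The exterior derivative of the fundamental form. -/
def dOmega (G : Matrix ι ι ℝ) (D : ι → Matrix ι ι ℝ) (X Y Z : ι → ℝ) : ℝ :=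
  covOmega G D X Y Z + covOmega G D Y Z X + covOmega G D Z X Y

/-- A trilinear function is determined by its values on the standard basis. -/
lemma trilinear_expand {f : (ι → ℝ) → (ι → ℝ) → (ι → ℝ) → ℝ}
    (h1 : ∀ Y Z, IsLinearMap ℝ fun X => f X Y Z) (h2 : ∀ X Z, IsLinearMap ℝ fun Y => f X Y Z)
    (h3 : ∀ X Y, IsLinearMap ℝ fun Z => f X Y Z) (X Y Z : ι → ℝ) :
    f X Y Z = ∑ a, ∑ b, ∑ c, X a * Y b * Z c *
      f (Pi.single a 1) (Pi.single b 1) (Pi.single c 1) := by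
  have key : ∀ g : (ι → ℝ) → ℝ, IsLinearMap ℝ g → ∀ v, g v = ∑ a, v a * g (Pi.single a 1) := by
    intro g hg v
    have e := LinearMap.pi_apply_eq_sum_univ hg.mk' v
    simp only [IsLinearMap.mk'_apply, smul_eq_mul] at e
    rw [e]
    refine Finset.sum_congr rfl fun a _ => ?_
    congr 2
    funext j
    simp [Pi.single_apply, eq_comm]
  rw [key _ (h1 Y Z)]
  refine Finset.sum_congr rfl fun a _ => ?_
  rw [key _ (h2 _ Z), Finset.mul_sum]
  refine Finset.sum_congr rfl fun b _ => ?_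
  rw [key _ (h3 _ _), Finset.mul_sum, Finset.mul_sum]
  exact Finset.sum_congr rfl fun c _ => by ring

lemma dOmega_linear_left (G : Matrix ι ι ℝ) (D : ι → Matrix ι ι ℝ) (Y Z : ι → ℝ) :
    IsLinearMap ℝ fun X => dOmega G D X Y Z := by
  constructor <;> intros <;>
  simp only [dOmega, covOmega, contr_add, contr_smul, Matrix.add_mulVec, Matrix.mulVec_add,
    dotProduct_add, add_dotProduct, Matrix.smul_mulVec, Matrix.mulVec_smul, dotProduct_smul,
    smul_dotProduct, smul_eq_mul] <;> ring

lemma dOmega_cycle (G : Matrix ι ι ℝ) (D : ι → Matrix ι ι ℝ) (X Y Z : ι → ℝ) :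
    dOmega G D Y Z X = dOmega G D X Y Z := by
  unfold dOmega; ring

lemma dOmega_linear_mid (G : Matrix ι ι ℝ) (D : ι → Matrix ι ι ℝ) (X Z : ι → ℝ) :
    IsLinearMap ℝ fun Y => dOmega G D X Y Z := by
  simpa only [← dOmega_cycle G D X] using dOmega_linear_left G D Z X

lemma dOmega_linear_right (G : Matrix ι ι ℝ) (D : ι → Matrix ι ι ℝ) (X Y : ι → ℝ) :
    IsLinearMap ℝ fun Z => dOmega G D X Y Z := by
  simpa only [← dOmega_cycle G D X, ← dOmega_cycle G D Y] using dOmega_linear_left G D X Y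

lemma isLinearMap_comp_mulVec {f : (ι → ℝ) → ℝ} (hf : IsLinearMap ℝ f) (A : Matrix ι ι ℝ) :
    IsLinearMap ℝ fun X => f (A *ᵥ X) :=
  ⟨fun v w => by rw [Matrix.mulVec_add, hf.map_add], fun c v => by
    rw [Matrix.mulVec_smul, hf.map_smul]⟩

lemma dotProduct_mulVec_transpose (M : Matrix ι ι ℝ) (v w : ι → ℝ) :
    v ⬝ᵥ (M *ᵥ w) = w ⬝ᵥ (Mᵀ *ᵥ v) := by
  rw [Matrix.dotProduct_mulVec, dotProduct_comm, Matrix.mulVec_transpose]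

namespace HermitianJet

variable {G A : Matrix ι ι ℝ} {D : ι → Matrix ι ι ℝ} (h : HermitianJet G A D)
include h

lemma anticomm_contr (v : ι → ℝ) : contr D v * A = -(A * contr D v) := by
  simp [contr, Finset.sum_mul, Finset.mul_sum, h.anticomm]

lemma skew_contr (v : ι → ℝ) : (G * contr D v)ᵀ = -(G * contr D v) := by
  simp only [contr, Finset.mul_sum, Matrix.transpose_sum, Matrix.mul_smul, Matrix.transpose_smul,
    h.skew, smul_neg, Finset.sum_neg_distrib]

lemma compat_apply (v w : ι → ℝ) : (A *ᵥ v) ⬝ᵥ (G *ᵥ w) = -(v ⬝ᵥ (G *ᵥ (A *ᵥ w))) := by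
  rw [dotProduct_comm, dotProduct_mulVec_transpose, Matrix.mulVec_mulVec, h.compat]
  simp [Matrix.neg_mulVec]

lemma covOmega_swap (X Y Z : ι → ℝ) : covOmega G D X Z Y = -covOmega G D X Y Z := by
  unfold covOmega
  rw [Matrix.mulVec_mulVec, dotProduct_mulVec_transpose, h.skew_contr, Matrix.neg_mulVec,
    Matrix.mulVec_mulVec, dotProduct_neg]

lemma covOmega_apply_mid (X Y Z : ι → ℝ) :
    covOmega G D X (A *ᵥ Y) Z = covOmega G D X Y (A *ᵥ Z) := by
  unfold covOmega
  rw [h.compat_apply, Matrix.mulVec_mulVec Y, h.anticomm_contr, Matrix.neg_mulVec,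
    ← Matrix.mulVec_mulVec, Matrix.mulVec_neg, dotProduct_neg]

lemma sq_apply (v : ι → ℝ) : A *ᵥ (A *ᵥ v) = -v := by
  rw [Matrix.mulVec_mulVec, h.sq]; simp [Matrix.neg_mulVec]

lemma covOmega_neg_left (X Y Z : ι → ℝ) : covOmega G D (-X) Y Z = -covOmega G D X Y Z := by
  simp [covOmega, contr_neg, Matrix.neg_mulVec, Matrix.mulVec_neg]

lemma covOmega_neg_mid (X Y Z : ι → ℝ) : covOmega G D X (-Y) Z = -covOmega G D X Y Z := by
  simp [covOmega, Matrix.mulVec_neg]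

lemma covOmega_neg_right (X Y Z : ι → ℝ) : covOmega G D X Y (-Z) = -covOmega G D X Y Z := by
  simp [covOmega]

/-- The tensor `∇_{AX}ω(Y,Z) + ∇_Xω(Y,AZ)` is symmetric in `X, Y` by integrability and
skew in `Y, Z`, hence zero. -/
lemma covOmega_apply_left (X Y Z : ι → ℝ) :
    covOmega G D (A *ᵥ X) Y Z = -covOmega G D X Y (A *ᵥ Z) := by
  have sy : ∀ X Y Z, covOmega G D (A *ᵥ X) Y Z + covOmega G D X Y (A *ᵥ Z) =
      covOmega G D (A *ᵥ Y) X Z + covOmega G D Y X (A *ᵥ Z) := by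
    intro X Y Z
    have k := congrArg (fun u => Z ⬝ᵥ (G *ᵥ u)) (h.integrable X Y)
    simp only [Matrix.mulVec_sub, dotProduct_sub] at k
    have e1 := h.compat_apply Z (contr D X *ᵥ Y)
    have e2 := h.compat_apply Z (contr D Y *ᵥ X)
    unfold covOmega
    linarith
  have sk : ∀ X Y Z, covOmega G D (A *ᵥ X) Y Z + covOmega G D X Y (A *ᵥ Z) =
      -(covOmega G D (A *ᵥ X) Z Y + covOmega G D X Z (A *ᵥ Y)) := by
    intro X Y Z
    rw [h.covOmega_swap _ Y Z, ← h.covOmega_apply_mid X Z Y, h.covOmega_swap X Y (A *ᵥ Z)]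
    ring_nf
  have a1 := sy X Y Z
  have a2 := sk Y X Z
  have a3 := sy Y Z X
  have a4 := sk Z Y X
  have a5 := sy Z X Y
  have a6 := sk X Z Y
  linarith

/-- For an integrable `A`, the exterior derivative `dω` determines `∇ω`. -/
lemma covOmega_eq_dOmega (X Y Z : ι → ℝ) :
    2 * covOmega G D X Y Z = dOmega G D (A *ᵥ X) Y (A *ᵥ Z) + dOmega G D (A *ᵥ X) (A *ᵥ Y) Z := by
  unfold dOmega
  simp only [h.covOmega_apply_left, h.covOmega_apply_mid, h.sq_apply, h.covOmega_neg_right]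
  ring

/-- `dω` has type `(2,1) + (1,2)`. -/
lemma dOmega_type (X Y Z : ι → ℝ) : dOmega G D X Y Z = dOmega G D (A *ᵥ X) (A *ᵥ Y) Z +
    dOmega G D (A *ᵥ X) Y (A *ᵥ Z) + dOmega G D X (A *ᵥ Y) (A *ᵥ Z) := by
  unfold dOmega
  simp only [h.covOmega_apply_left, h.covOmega_apply_mid, h.sq_apply, h.covOmega_neg_right]
  ring

lemma dOmega_swap (X Y Z : ι → ℝ) : dOmega G D Y X Z = -dOmega G D X Y Z := by
  unfold dOmega
  rw [h.covOmega_swap Y Z X, h.covOmega_swap X Y Z, h.covOmega_swap Z X Y]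
  ring

lemma dOmega_neg_left (X Y Z : ι → ℝ) : dOmega G D (-X) Y Z = -dOmega G D X Y Z := by
  simp only [dOmega, h.covOmega_neg_left, h.covOmega_neg_mid, h.covOmega_neg_right]; ring

lemma dOmega_neg_mid (X Y Z : ι → ℝ) : dOmega G D X (-Y) Z = -dOmega G D X Y Z := by
  simp only [dOmega, h.covOmega_neg_left, h.covOmega_neg_mid, h.covOmega_neg_right]; ring

lemma dOmega_neg_right (X Y Z : ι → ℝ) : dOmega G D X Y (-Z) = -dOmega G D X Y Z := by
  simp only [dOmega, h.covOmega_neg_left, h.covOmega_neg_mid, h.covOmega_neg_right]; ring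

end HermitianJet

/-- Vectors are determined by their pairings for an invertible Gram matrix. -/
lemma eq_of_forall_dotProduct {G : Matrix ι ι ℝ} (hG : IsUnit G.det) {v w : ι → ℝ}
    (h : ∀ z, z ⬝ᵥ (G *ᵥ v) = z ⬝ᵥ (G *ᵥ w)) : v = w := by
  have h1 : G *ᵥ v = G *ᵥ w := dotProduct_eq _ _ fun z => by
    rw [dotProduct_comm, h, dotProduct_comm]
  have := congrArg (G⁻¹ *ᵥ ·) h1
  simpa [Matrix.mulVec_mulVec, Matrix.nonsing_inv_mul _ hG] using this

/-- `H` is the torsion of the Hermitian jet: `g(H_X Y, Z) = dω(AX, AY, AZ)`. -/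
def IsTorsion (G A : Matrix ι ι ℝ) (D H : ι → Matrix ι ι ℝ) : Prop :=
  ∀ X Y Z, Z ⬝ᵥ (G *ᵥ (contr H X *ᵥ Y)) = dOmega G D (A *ᵥ X) (A *ᵥ Y) (A *ᵥ Z)

namespace HermitianJet

variable {G A : Matrix ι ι ℝ} {D H : ι → Matrix ι ι ℝ}

/-- The connection `∇ + ½ H` preserves `A`. -/
lemma covariant_eq (h : HermitianJet G A D) (hG : IsUnit G.det) (hH : IsTorsion G A D H) (a : ι) :
    D a = -(1 / 2 : ℝ) • (H a * A - A * H a) := by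
  apply Matrix.mulVec_injective
  funext Y
  apply eq_of_forall_dotProduct hG
  intro Z
  have k1 := hH (Pi.single a 1) (A *ᵥ Y) Z
  have k2 := hH (Pi.single a 1) Y (A *ᵥ Z)
  have k3 := h.covOmega_eq_dOmega (Pi.single a 1) Y Z
  simp only [covOmega, contr_single] at k1 k2 k3
  rw [h.sq_apply, h.dOmega_neg_mid] at k1
  rw [h.sq_apply, h.dOmega_neg_right, h.compat_apply] at k2
  simp only [Matrix.smul_mulVec, Matrix.sub_mulVec, Matrix.mulVec_smul, Matrix.mulVec_sub,
    dotProduct_smul, dotProduct_sub, smul_eq_mul, ← Matrix.mulVec_mulVec]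
  linarith

/-- The torsion has type `(2,1) + (1,2)`. -/
lemma torsion_type (h : HermitianJet G A D) (hG : IsUnit G.det) (hH : IsTorsion G A D H)
    (v : ι → ℝ) :
    contr H (A *ᵥ v) * A - A * contr H (A *ᵥ v) = contr H v + A * contr H v * A := by
  apply Matrix.mulVec_injective
  funext Y
  apply eq_of_forall_dotProduct hG
  intro Z
  have k1 := hH (A *ᵥ v) (A *ᵥ Y) Z
  have k2 := hH (A *ᵥ v) Y (A *ᵥ Z)
  have k3 := hH v Y Z
  have k4 := hH v (A *ᵥ Y) (A *ᵥ Z)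
  have k5 := h.dOmega_type (A *ᵥ v) (A *ᵥ Y) (A *ᵥ Z)
  simp only [h.sq_apply, h.dOmega_neg_left, h.dOmega_neg_mid, h.dOmega_neg_right,
    h.compat_apply] at k1 k2 k3 k4 k5
  simp only [Matrix.sub_mulVec, Matrix.add_mulVec, Matrix.mulVec_sub, Matrix.mulVec_add,
    dotProduct_add, dotProduct_sub, ← Matrix.mulVec_mulVec]
  linarith

lemma torsion_skew (h : HermitianJet G A D) (hG : IsUnit G.det) (hH : IsTorsion G A D H)
    (v w : ι → ℝ) : contr H v *ᵥ w = -(contr H w *ᵥ v) := by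
  apply eq_of_forall_dotProduct hG
  intro Z
  rw [hH, Matrix.mulVec_neg, dotProduct_neg, hH, h.dOmega_swap]

end HermitianJet
end Jets

/-! ### Smooth matrix-valued functions -/

section Smooth

set_option linter.unusedSectionVars false

variable {E : Type*} [NormedAddCommGroup E] [NormedSpace ℝ E] {ι : Type*} [Fintype ι]
  [DecidableEq ι]

/-- Entrywise smoothness of a matrix-valued function on a set. -/
def SmoothMat (F : E → Matrix ι ι ℝ) (V : Set E) : Prop :=
  ∀ i j, ContDiffOn ℝ ∞ (fun z => F z i j) V

variable {F F' : E → Matrix ι ι ℝ} {V : Set E}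

lemma SmoothMat.mul (h : SmoothMat F V) (h' : SmoothMat F' V) :
    SmoothMat (fun z => F z * F' z) V := by
  intro i j
  simp only [Matrix.mul_apply]
  exact ContDiffOn.sum fun k _ => (h i k).mul (h' k j)

lemma SmoothMat.add (h : SmoothMat F V) (h' : SmoothMat F' V) :
    SmoothMat (fun z => F z + F' z) V := fun i j => (h i j).add (h' i j)

lemma SmoothMat.sub (h : SmoothMat F V) (h' : SmoothMat F' V) :
    SmoothMat (fun z => F z - F' z) V := fun i j => (h i j).sub (h' i j)

lemma SmoothMat.neg (h : SmoothMat F V) : SmoothMat (fun z => -F z) V := fun i j => (h i j).neg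

lemma SmoothMat.transpose (h : SmoothMat F V) : SmoothMat (fun z => (F z)ᵀ) V := fun i j => h j i

lemma SmoothMat.trace (h : SmoothMat F V) : ContDiffOn ℝ ∞ (fun z => (F z).trace) V :=
  ContDiffOn.sum fun i _ => h i i

lemma SmoothMat.det (h : SmoothMat F V) : ContDiffOn ℝ ∞ (fun z => (F z).det) V := by
  simp only [Matrix.det_apply]
  refine ContDiffOn.sum fun σ _ => ?_
  simp only [Units.smul_def, zsmul_eq_mul]
  exact contDiffOn_const.mul (contDiffOn_prod fun i _ => h _ _)

lemma SmoothMat.inv (h : SmoothMat F V) (hu : ∀ z ∈ V, IsUnit (F z).det) :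
    SmoothMat (fun z => (F z)⁻¹) V := by
  intro i j
  simp only [Matrix.inv_def, Matrix.smul_apply, Ring.inverse_eq_inv', smul_eq_mul,
    Matrix.adjugate_apply]
  refine (h.det.inv fun z hz => (hu z hz).ne_zero).mul ?_
  apply SmoothMat.det
  intro a b
  by_cases hab : a = j
  · subst hab; simpa using contDiffOn_const
  · simpa [Matrix.updateRow_ne hab] using h a b

end Smooth

/-! ### Derivatives of matrix-valued functions of one variable -/

section LogDet

variable {ι : Type*} [Fintype ι] [DecidableEq ι]

/-- Jacobi's formula. -/
lemma hasDerivWithinAt_det {F : ℝ → Matrix ι ι ℝ} {F' : Matrix ι ι ℝ} {s : Set ℝ} {t : ℝ}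
    (h : ∀ i j, HasDerivWithinAt (fun r => F r i j) (F' i j) s t) :
    HasDerivWithinAt (fun r => (F r).det) ((F t).adjugate * F').trace s t := by
  have e : ((F t).adjugate * F').trace = ∑ σ : Equiv.Perm ι, (Equiv.Perm.sign σ : ℝ) *
      ∑ i, (∏ j ∈ Finset.univ.erase i, F t (σ j) j) * F' (σ i) i := by
    have : ∀ i, ((F t).adjugate * F') i i = ((F t).updateCol i (fun k => F' k i)).det := by
      intro i
      rw [← Matrix.cramer_apply, Matrix.cramer_eq_adjugate_mulVec]
      rfl
    simp only [Matrix.trace, Matrix.diag_apply, this, Matrix.det_apply, Units.smul_def,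
      zsmul_eq_mul, Finset.mul_sum]
    rw [Finset.sum_comm]
    refine Finset.sum_congr rfl fun σ _ => Finset.sum_congr rfl fun i _ => ?_
    rw [← Finset.prod_erase_mul _ _ (Finset.mem_univ i)]
    congr 1
    rw [Matrix.updateCol_self]
    congr 1
    refine Finset.prod_congr rfl fun j hj => ?_
    rw [Matrix.updateCol_ne (Finset.ne_of_mem_erase hj)]
  rw [e]
  simp only [Matrix.det_apply, Units.smul_def, zsmul_eq_mul]
  refine HasDerivWithinAt.fun_sum fun σ _ => HasDerivWithinAt.const_mul _ ?_
  simpa only [smul_eq_mul] using HasDerivWithinAt.fun_finsetProd (fun i _ => h (σ i) i)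

lemma hasDerivWithinAt_log_det {F : ℝ → Matrix ι ι ℝ} {F' : Matrix ι ι ℝ} {s : Set ℝ} {t : ℝ}
    (h : ∀ i j, HasDerivWithinAt (fun r => F r i j) (F' i j) s t) (h0 : (F t).det ≠ 0) :
    HasDerivWithinAt (fun r => Real.log (F r).det) ((F t)⁻¹ * F').trace s t := by
  convert (hasDerivWithinAt_det h).log h0 using 1
  rw [Matrix.inv_def, Ring.inverse_eq_inv', Matrix.smul_mul, Matrix.trace_smul, smul_eq_mul,
    div_eq_inv_mul]

end LogDet

/-! ### Partial derivatives in coordinates -/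

section Coordinates

variable {m : ℕ}

lemma pd_congr {f g : Coord m → ℝ} {y : Coord m} (h : f =ᶠ[nhds y] g) (i : Fin m) :
    pd i f y = pd i g y := by
  rw [pd, pd, h.fderiv_eq]

lemma pd_congr_on {f g : Coord m → ℝ} {V : Set (Coord m)} (hV : IsOpen V)
    (h : ∀ z ∈ V, f z = g z) {y : Coord m} (hy : y ∈ V) (i : Fin m) : pd i f y = pd i g y :=
  pd_congr (Filter.eventuallyEq_of_mem (hV.mem_nhds hy) h) i

lemma pd_add {f g : Coord m → ℝ} {y : Coord m} (hf : DifferentiableAt ℝ f y)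
    (hg : DifferentiableAt ℝ g y) (i : Fin m) :
    pd i (fun z => f z + g z) y = pd i f y + pd i g y := by
  simp [pd, fderiv_fun_add hf hg]

lemma pd_sub {f g : Coord m → ℝ} {y : Coord m} (hf : DifferentiableAt ℝ f y)
    (hg : DifferentiableAt ℝ g y) (i : Fin m) :
    pd i (fun z => f z - g z) y = pd i f y - pd i g y := by
  simp [pd, fderiv_fun_sub hf hg]

lemma pd_mul {f g : Coord m → ℝ} {y : Coord m} (hf : DifferentiableAt ℝ f y)
    (hg : DifferentiableAt ℝ g y) (i : Fin m) :
    pd i (fun z => f z * g z) y = pd i f y * g y + f y * pd i g y := by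
  simp [pd, fderiv_fun_mul hf hg]; ring

lemma pd_const (c : ℝ) (y : Coord m) (i : Fin m) : pd i (fun _ => c) y = 0 := by
  simp [pd]

lemma pd_const_mul {f : Coord m → ℝ} {y : Coord m} (hf : DifferentiableAt ℝ f y) (c : ℝ)
    (i : Fin m) : pd i (fun z => c * f z) y = c * pd i f y := by
  simp [pd, fderiv_const_mul hf]

lemma pd_sum {κ : Type*} {s : Finset κ} {f : κ → Coord m → ℝ} {y : Coord m}
    (hf : ∀ k ∈ s, DifferentiableAt ℝ (f k) y) (i : Fin m) :
    pd i (fun z => ∑ k ∈ s, f k z) y = ∑ k ∈ s, pd i (f k) y := by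
  simp [pd, fderiv_fun_sum hf]

lemma pd_smooth {f : Coord m → ℝ} {V : Set (Coord m)} (hV : IsOpen V)
    (hf : ContDiffOn ℝ ∞ f V) (i : Fin m) : ContDiffOn ℝ ∞ (pd i f) V :=
  (hf.fderiv_of_isOpen hV (by simp)).clm_apply contDiffOn_const

lemma differentiableAt_of_smooth {f : Coord m → ℝ} {V : Set (Coord m)} (hV : IsOpen V)
    (hf : ContDiffOn ℝ ∞ f V) {y : Coord m} (hy : y ∈ V) : DifferentiableAt ℝ f y :=
  (hf.contDiffAt (hV.mem_nhds hy)).differentiableAt (by simp)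

lemma pd_comm {f : Coord m → ℝ} {V : Set (Coord m)} (hV : IsOpen V)
    (hf : ContDiffOn ℝ ∞ f V) {y : Coord m} (hy : y ∈ V) (i j : Fin m) :
    pd i (pd j f) y = pd j (pd i f) y := by
  have hd : DifferentiableAt ℝ (fderiv ℝ f) y :=
    ((hf.fderiv_of_isOpen hV (m := ∞) (by simp)).contDiffAt (hV.mem_nhds hy)).differentiableAt
      (by simp)
  have hs := (hf.contDiffAt (hV.mem_nhds hy)).isSymmSndFDerivAt
    (by simp only [minSmoothness_of_isRCLikeNormedField]
        exact WithTop.coe_le_coe.2 (le_top : (2 : ℕ∞) ≤ ⊤))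
  have e : ∀ i j : Fin m, pd i (pd j f) y =
      fderiv ℝ (fderiv ℝ f) y (EuclideanSpace.single i 1) (EuclideanSpace.single j 1) := by
    intro i j
    unfold pd
    rw [fderiv_clm_apply hd (differentiableAt_const _)]
    simp
  rw [e, e, hs.eq]

/-- A partial derivative as a derivative along a coordinate line. -/
lemma hasDerivAt_line {f : Coord m → ℝ} {y : Coord m} (hf : DifferentiableAt ℝ f y) (i : Fin m) :
    HasDerivAt (fun s : ℝ => f (y + s • EuclideanSpace.single i (1 : ℝ))) (pd i f y) 0 := by
  have hl : HasDerivAt (fun s : ℝ => y + s • EuclideanSpace.single i (1 : ℝ))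
      (EuclideanSpace.single i (1 : ℝ)) 0 := by
    simpa using ((hasDerivAt_id (0 : ℝ)).smul_const (EuclideanSpace.single i (1 : ℝ))).const_add y
  have h0 : y + (0 : ℝ) • EuclideanSpace.single i (1 : ℝ) = y := by simp
  have hf' : HasFDerivAt f (fderiv ℝ f y) (y + (0 : ℝ) • EuclideanSpace.single i (1 : ℝ)) := by
    rw [h0]; exact hf.hasFDerivAt
  exact hf'.comp_hasDerivAt (0 : ℝ) hl

/-- Entrywise partial derivative of a matrix-valued function. -/
def pdM (l : Fin m) (F : Coord m → Matrix (Fin m) (Fin m) ℝ) (y : Coord m) :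
    Matrix (Fin m) (Fin m) ℝ := Matrix.of fun i j => pd l (fun z => F z i j) y

section

variable {F F' : Coord m → Matrix (Fin m) (Fin m) ℝ} {V : Set (Coord m)} {y : Coord m}

lemma SmoothMat.diff (h : SmoothMat F V) (hV : IsOpen V) (hy : y ∈ V) (i j : Fin m) :
    DifferentiableAt ℝ (fun z => F z i j) y := differentiableAt_of_smooth hV (h i j) hy

lemma pdM_congr_on (hV : IsOpen V) (h : ∀ z ∈ V, F z = F' z) (hy : y ∈ V) (l : Fin m) :
    pdM l F y = pdM l F' y := by
  ext i j
  exact pd_congr_on hV (fun z hz => by rw [h z hz]) hy l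

lemma pdM_mul (h : SmoothMat F V) (h' : SmoothMat F' V) (hV : IsOpen V) (hy : y ∈ V)
    (l : Fin m) : pdM l (fun z => F z * F' z) y = pdM l F y * F' y + F y * pdM l F' y := by
  ext i j
  simp only [pdM, Matrix.of_apply, Matrix.add_apply, Matrix.mul_apply]
  rw [pd_sum fun k _ => (h.diff hV hy i k).fun_mul (h'.diff hV hy k j), ← Finset.sum_add_distrib]
  exact Finset.sum_congr rfl fun k _ => pd_mul (h.diff hV hy i k) (h'.diff hV hy k j) l

lemma pdM_add (h : SmoothMat F V) (h' : SmoothMat F' V) (hV : IsOpen V) (hy : y ∈ V)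
    (l : Fin m) : pdM l (fun z => F z + F' z) y = pdM l F y + pdM l F' y := by
  ext i j
  exact pd_add (h.diff hV hy i j) (h'.diff hV hy i j) l

lemma pdM_sub (h : SmoothMat F V) (h' : SmoothMat F' V) (hV : IsOpen V) (hy : y ∈ V)
    (l : Fin m) : pdM l (fun z => F z - F' z) y = pdM l F y - pdM l F' y := by
  ext i j
  exact pd_sub (h.diff hV hy i j) (h'.diff hV hy i j) l

lemma pdM_const (M : Matrix (Fin m) (Fin m) ℝ) (l : Fin m) : pdM l (fun _ => M) y = 0 := by
  ext i j
  simp [pdM, pd_const]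

lemma pdM_transpose (l : Fin m) : pdM l (fun z => (F z)ᵀ) y = (pdM l F y)ᵀ := rfl

lemma pdM_inv (h : SmoothMat F V) (hu : ∀ z ∈ V, IsUnit (F z).det) (hV : IsOpen V) (hy : y ∈ V)
    (l : Fin m) : pdM l (fun z => (F z)⁻¹) y = -((F y)⁻¹ * pdM l F y * (F y)⁻¹) := by
  have k := pdM_mul (h.inv hu) h hV hy l
  rw [pdM_congr_on hV (F' := fun _ => 1) (fun z hz => Matrix.nonsing_inv_mul _ (hu z hz)) hy,
    pdM_const] at k
  have k2 := Matrix.mul_nonsing_inv _ (hu y hy)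
  linear_combination (norm := noncomm_ring) -k * (F y)⁻¹ -
    pdM l (fun z => (F z)⁻¹) y * k2

end

/-- Entrywise partial derivative of a vector-valued function. -/
def pdV (l : Fin m) (F : Coord m → Fin m → ℝ) (y : Coord m) : Fin m → ℝ :=
  fun i => pd l (fun z => F z i) y

lemma pdV_mulVec {F : Coord m → Matrix (Fin m) (Fin m) ℝ} {v : Coord m → Fin m → ℝ}
    {V : Set (Coord m)} {y : Coord m} (h : SmoothMat F V)
    (hv : ∀ i, ContDiffOn ℝ ∞ (fun z => v z i) V) (hV : IsOpen V) (hy : y ∈ V) (l : Fin m) :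
    pdV l (fun z => F z *ᵥ v z) y = pdM l F y *ᵥ v y + F y *ᵥ pdV l v y := by
  funext i
  simp only [pdV, pdM, Matrix.mulVec, dotProduct, Pi.add_apply, Matrix.of_apply]
  have hd := fun k => differentiableAt_of_smooth hV (hv k) hy
  rw [pd_sum fun k _ => (h.diff hV hy i k).fun_mul (hd k), ← Finset.sum_add_distrib]
  exact Finset.sum_congr rfl fun k _ => pd_mul (h.diff hV hy i k) (hd k) l

lemma smooth_mulVec {E : Type*} [NormedAddCommGroup E] [NormedSpace ℝ E]
    {F : E → Matrix (Fin m) (Fin m) ℝ} {v : E → Fin m → ℝ}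
    {V : Set E} (h : SmoothMat F V)
    (hv : ∀ i, ContDiffOn ℝ ∞ (fun z => v z i) V) (i : Fin m) :
    ContDiffOn ℝ ∞ (fun z => (F z *ᵥ v z) i) V := by
  simp only [Matrix.mulVec, dotProduct]
  exact ContDiffOn.sum fun k _ => (h i k).mul (hv k)

end Coordinates

/-! ### Hermitian structures in coordinates -/

section LocalHermitian

variable {m : ℕ}

/-- The matrix `(Γ_a)^k_j` of the Levi-Civita connection. -/
def chrM (G : Coord m → Matrix (Fin m) (Fin m) ℝ) (a : Fin m) (y : Coord m) :
    Matrix (Fin m) (Fin m) ℝ := Matrix.of fun k j => christoffel G k a j y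

/-- The Levi-Civita covariant derivative `∇_a A` of an endomorphism field. -/
def covEnd (G A : Coord m → Matrix (Fin m) (Fin m) ℝ) (y : Coord m) (a : Fin m) :
    Matrix (Fin m) (Fin m) ℝ := pdM a A y + chrM G a y * A y - A y * chrM G a y

/-- The torsion endomorphisms `H_a` of `(G, A)`, given by `g(H_X Y, Z) = dω(AX, AY, AZ)`. -/
def torsionEnd (G A : Coord m → Matrix (Fin m) (Fin m) ℝ) (y : Coord m) (a : Fin m) :
    Matrix (Fin m) (Fin m) ℝ :=
  -((G y)⁻¹ * Matrix.of fun c b => dcFundForm G A y ![a, b, c])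

/-- A smooth nondegenerate symmetric bilinear form in coordinates on the open set `V`. Its
definiteness is only needed for the maximum principle and the sign of the Bochner terms, and is
assumed there separately. -/
structure LocalMetric (V : Set (Coord m)) (G : Coord m → Matrix (Fin m) (Fin m) ℝ) : Prop where
  isOpen : IsOpen V
  smooth : SmoothMat G V
  symm : ∀ y ∈ V, (G y)ᵀ = G y
  unit : ∀ y ∈ V, IsUnit (G y).det

/-- A smooth integrable Hermitian structure in coordinates on the open set `V`. -/
structure LocalHermitian (V : Set (Coord m)) (G A : Coord m → Matrix (Fin m) (Fin m) ℝ) : Prop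
    extends LocalMetric V G where
  smooth_end : SmoothMat A V
  sq : ∀ y ∈ V, A y * A y = -1
  orth : ∀ y ∈ V, (A y)ᵀ * G y * A y = G y
  nij : ∀ y ∈ V, ∀ k i j, nijenhuis A k i j y = 0

variable {V : Set (Coord m)} {G A : Coord m → Matrix (Fin m) (Fin m) ℝ} {y : Coord m}

namespace LocalMetric

lemma pd_symm (h : LocalMetric V G) (hy : y ∈ V) (l i j : Fin m) :
    pd l (fun z => G z i j) y = pd l (fun z => G z j i) y :=
  pd_congr_on h.isOpen (fun z hz => congrFun (congrFun (h.symm z hz) j) i) hy l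

lemma inv_symm (h : LocalMetric V G) (hy : y ∈ V) : ((G y)⁻¹)ᵀ = (G y)⁻¹ := by
  rw [Matrix.transpose_nonsing_inv, h.symm y hy]

lemma mul_inv (h : LocalMetric V G) (hy : y ∈ V) : G y * (G y)⁻¹ = 1 :=
  Matrix.mul_nonsing_inv _ (h.unit y hy)

lemma inv_mul (h : LocalMetric V G) (hy : y ∈ V) : (G y)⁻¹ * G y = 1 :=
  Matrix.nonsing_inv_mul _ (h.unit y hy)

lemma christoffel_symm (h : LocalMetric V G) (hy : y ∈ V) (k i j : Fin m) :
    christoffel G k i j y = christoffel G k j i y := by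
  unfold christoffel
  congr 1
  refine Finset.sum_congr rfl fun l _ => ?_
  rw [h.pd_symm hy l i j]
  ring

lemma metric_mul_chrM (h : LocalMetric V G) (hy : y ∈ V) (a i j : Fin m) :
    (G y * chrM G a y) i j = (1 / 2) * (pd a (fun z => G z j i) y + pd j (fun z => G z a i) y -
      pd i (fun z => G z a j) y) := by
  have e : chrM G a y = (G y)⁻¹ * Matrix.of fun l j => (1 / 2) *
      (pd a (fun z => G z j l) y + pd j (fun z => G z a l) y - pd l (fun z => G z a j) y) := by
    ext k j
    simp only [chrM, Matrix.of_apply, christoffel, Matrix.mul_apply, Finset.mul_sum]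
    exact Finset.sum_congr rfl fun l _ => by ring
  rw [e, ← mul_assoc, h.mul_inv hy, one_mul]
  rfl

/-- The Levi-Civita connection is metric. -/
lemma pdM_metric (h : LocalMetric V G) (hy : y ∈ V) (a : Fin m) :
    pdM a G y = (chrM G a y)ᵀ * G y + G y * chrM G a y := by
  have e : (chrM G a y)ᵀ * G y = (G y * chrM G a y)ᵀ := by
    rw [Matrix.transpose_mul, h.symm y hy]
  ext i j
  rw [e, Matrix.add_apply, Matrix.transpose_apply, h.metric_mul_chrM hy, h.metric_mul_chrM hy,
    h.pd_symm hy a j i]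
  simp only [pdM, Matrix.of_apply]
  ring

lemma pdM_inv_metric (h : LocalMetric V G) (hy : y ∈ V) (a : Fin m) :
    pdM a (fun z => (G z)⁻¹) y = -(chrM G a y * (G y)⁻¹ + (G y)⁻¹ * (chrM G a y)ᵀ) := by
  rw [pdM_inv h.smooth h.unit h.isOpen hy, h.pdM_metric hy]
  have k1 := h.mul_inv hy
  have k2 := h.inv_mul hy
  linear_combination (norm := noncomm_ring) -((G y)⁻¹ * (chrM G a y)ᵀ * k1) -
    k2 * chrM G a y * (G y)⁻¹

/-- The Levi-Civita connection is torsion free. -/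
lemma contr_chrM_symm (h : LocalMetric V G) (hy : y ∈ V) (v w : Fin m → ℝ) :
    contr (fun a => chrM G a y) v *ᵥ w = contr (fun a => chrM G a y) w *ᵥ v := by
  funext k
  simp only [contr_mulVec_apply, chrM, Matrix.of_apply]
  rw [Finset.sum_comm]
  refine Finset.sum_congr rfl fun a _ => Finset.sum_congr rfl fun b _ => ?_
  rw [h.christoffel_symm hy]
  ring

end LocalMetric

namespace LocalHermitian

lemma compat (h : LocalHermitian V G A) (hy : y ∈ V) : (A y)ᵀ * G y = -(G y * A y) := by
  have k1 := h.orth y hy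
  have k2 := h.sq y hy
  linear_combination (norm := noncomm_ring) -(k1 * A y) + (A y)ᵀ * G y * k2

lemma contr_covEnd (v : Fin m → ℝ) : contr (covEnd G A y) v =
    contr (fun a => pdM a A y) v + contr (fun a => chrM G a y) v * A y -
      A y * contr (fun a => chrM G a y) v := by
  simp only [contr, covEnd, smul_add, smul_sub, Finset.sum_add_distrib, Finset.sum_sub_distrib,
    Finset.sum_mul, Finset.mul_sum, Matrix.smul_mul, Matrix.mul_smul]

/-- The Levi-Civita covariant derivative of an integrable Hermitian structure satisfies the
algebraic identities of a jet. -/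
lemma hermitianJet (h : LocalHermitian V G A) (hy : y ∈ V) :
    HermitianJet (G y) (A y) (covEnd G A y) where
  sq := h.sq y hy
  compat := h.compat hy
  anticomm := by
    intro a
    have k := pdM_mul h.smooth_end h.smooth_end h.isOpen hy a
    rw [pdM_congr_on h.isOpen (F' := fun _ => -1) h.sq hy, pdM_const] at k
    have k2 := h.sq y hy
    unfold covEnd
    linear_combination (norm := noncomm_ring) -k + chrM G a y * k2 - k2 * chrM G a y
  skew := by
    intro a
    have k1 := pdM_mul h.smooth h.smooth_end h.isOpen hy a
    have k2 := pdM_mul h.smooth_end.transpose h.smooth h.isOpen hy a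
    rw [pdM_transpose] at k2
    have k3 : pdM a (fun z => (A z)ᵀ * G z) y = -pdM a (fun z => G z * A z) y := by
      rw [pdM_congr_on h.isOpen (F' := fun z => -(G z * A z)) (fun z hz => h.compat hz) hy]
      ext i j
      simp [pdM, pd, fderiv_fun_neg]
    have k4 := h.pdM_metric hy a
    have k5 := h.compat hy
    rw [k1, k2, k4] at k3
    have e : (G y * covEnd G A y a)ᵀ = (pdM a A y)ᵀ * G y + (A y)ᵀ * (chrM G a y)ᵀ * G y -
        (chrM G a y)ᵀ * (A y)ᵀ * G y := by
      rw [Matrix.transpose_mul, h.symm y hy]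
      simp only [covEnd, Matrix.transpose_add, Matrix.transpose_sub, Matrix.transpose_mul]
      noncomm_ring
    rw [e]
    unfold covEnd
    linear_combination (norm := noncomm_ring) k3 - (chrM G a y)ᵀ * k5 - k5 * chrM G a y
  integrable := by
    intro v w
    have k0 : contr (fun a => pdM a A y) (A y *ᵥ v) *ᵥ w -
        contr (fun a => pdM a A y) (A y *ᵥ w) *ᵥ v =
          A y *ᵥ (contr (fun a => pdM a A y) v *ᵥ w) -
          A y *ᵥ (contr (fun a => pdM a A y) w *ᵥ v) := by
      funext k
      have k0 : ∑ i, ∑ j, v i * w j * nijenhuis A k i j y = 0 := by simp [h.nij y hy]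
      have t1 : (contr (fun a => pdM a A y) (A y *ᵥ v) *ᵥ w) k =
          ∑ i, ∑ j, ∑ l, v i * w j * (A y l i * pd l (fun z => A z k j) y) := by
        rw [contr_mulVec_apply, ← sum_reverse]
        refine Finset.sum_congr rfl fun l _ => Finset.sum_congr rfl fun j _ => ?_
        simp only [Matrix.mulVec, dotProduct, Finset.sum_mul, pdM, Matrix.of_apply]
        exact Finset.sum_congr rfl fun i _ => by ring
      have t2 : (contr (fun a => pdM a A y) (A y *ᵥ w) *ᵥ v) k =
          ∑ i, ∑ j, ∑ l, v i * w j * (A y l j * pd l (fun z => A z k i) y) := by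
        rw [contr_mulVec_apply, ← sum_rotate]
        refine Finset.sum_congr rfl fun l _ => Finset.sum_congr rfl fun j _ => ?_
        simp only [Matrix.mulVec, dotProduct, Finset.sum_mul, pdM, Matrix.of_apply]
        exact Finset.sum_congr rfl fun i _ => by ring
      have t3 : (A y *ᵥ (contr (fun a => pdM a A y) v *ᵥ w)) k =
          ∑ i, ∑ j, ∑ l, v i * w j * (A y k l * pd i (fun z => A z l j) y) := by
        rw [← sum_rotate]
        rw [Matrix.mulVec, dotProduct]
        simp only [contr_mulVec_apply, Finset.mul_sum, pdM, Matrix.of_apply]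
        exact Finset.sum_congr rfl fun l _ => Finset.sum_congr rfl fun i _ =>
          Finset.sum_congr rfl fun j _ => by ring
      have t4 : (A y *ᵥ (contr (fun a => pdM a A y) w *ᵥ v)) k =
          ∑ i, ∑ j, ∑ l, v i * w j * (A y k l * pd j (fun z => A z l i) y) := by
        rw [← sum_reverse]
        rw [Matrix.mulVec, dotProduct]
        simp only [contr_mulVec_apply, Finset.mul_sum, pdM, Matrix.of_apply]
        exact Finset.sum_congr rfl fun l _ => Finset.sum_congr rfl fun i _ =>
          Finset.sum_congr rfl fun j _ => by ring
      simp only [nijenhuis, Finset.mul_sum, mul_sub, Finset.sum_sub_distrib] at k0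
      simp only [Pi.sub_apply]
      rw [t1, t2, t3, t4]
      linarith
    have c1 := h.contr_chrM_symm hy (A y *ᵥ v) (A y *ᵥ w)
    have c2 := h.contr_chrM_symm hy (A y *ᵥ v) w
    have c3 := h.contr_chrM_symm hy (A y *ᵥ w) v
    have c4 := h.contr_chrM_symm hy v w
    simp only [contr_covEnd, Matrix.add_mulVec, Matrix.sub_mulVec, Matrix.mulVec_add,
      Matrix.mulVec_sub, ← Matrix.mulVec_mulVec]
    rw [c1, c2, c3, c4]
    linear_combination (norm := module) k0

/-- The exterior derivative of the fundamental form, in terms of the covariant derivative. -/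
lemma extD_fundForm (h : LocalHermitian V G A) (hy : y ∈ V) (a b c : Fin m) :
    extD (fundForm G A) y ![a, b, c] = dOmega (G y) (covEnd G A y) (Pi.single a 1)
      (Pi.single b 1) (Pi.single c 1) := by
  have hω : SmoothMat (fun z => (A z)ᵀ * G z) V := h.smooth_end.transpose.mul h.smooth
  have e0 : extD (fundForm G A) y ![a, b, c] =
      pdM a (fun z => (A z)ᵀ * G z) y b c - pdM b (fun z => (A z)ᵀ * G z) y a c +
        pdM c (fun z => (A z)ᵀ * G z) y a b := by
    simp [extD, Fin.sum_univ_three, fundForm, pdM, Matrix.mul_apply, Fin.succAbove]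
    ring
  have e1 : ∀ a b c, covOmega (G y) (covEnd G A y) (Pi.single a 1) (Pi.single b 1)
      (Pi.single c 1) = ((covEnd G A y a)ᵀ * G y) b c := by
    intro a b c
    have : (covEnd G A y a)ᵀ * G y = (G y * covEnd G A y a)ᵀ := by
      rw [Matrix.transpose_mul, h.symm y hy]
    rw [this, covOmega, contr_single, Matrix.mulVec_mulVec, Matrix.mulVec_single_one,
      single_one_dotProduct]
    rfl
  have e2 : ∀ a, pdM a (fun z => (A z)ᵀ * G z) y = (covEnd G A y a)ᵀ * G y +
      (chrM G a y)ᵀ * ((A y)ᵀ * G y) + ((A y)ᵀ * G y) * chrM G a y := by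
    intro a
    rw [pdM_mul h.smooth_end.transpose h.smooth h.isOpen hy, pdM_transpose, h.pdM_metric hy]
    simp only [covEnd, Matrix.transpose_add, Matrix.transpose_sub, Matrix.transpose_mul]
    noncomm_ring
  rw [e0, e2, e2, e2]
  unfold dOmega
  have sk : ((A y)ᵀ * G y)ᵀ = -((A y)ᵀ * G y) := by
    rw [Matrix.transpose_mul, h.symm y hy, Matrix.transpose_transpose, h.compat hy, neg_neg]
  have e3 : ∀ a b c, (((A y)ᵀ * G y) * chrM G a y) b c =
      -((chrM G a y)ᵀ * ((A y)ᵀ * G y)) c b := by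
    intro a b c
    rw [← Matrix.transpose_apply (_ * ((A y)ᵀ * G y)), Matrix.transpose_mul, sk,
      Matrix.transpose_transpose, neg_mul, Matrix.neg_apply, neg_neg]
  have e4 : ∀ a b c, ((chrM G a y)ᵀ * ((A y)ᵀ * G y)) b c =
      ((chrM G b y)ᵀ * ((A y)ᵀ * G y)) a c := by
    intro a b c
    rw [Matrix.mul_apply, Matrix.mul_apply]
    simp only [Matrix.transpose_apply, chrM, Matrix.of_apply, h.christoffel_symm hy _ a b]
  have e5 := (h.hermitianJet hy).covOmega_swap (Pi.single b 1) (Pi.single a 1) (Pi.single c 1)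
  simp only [e1] at e5
  simp only [Matrix.add_apply, e3, e1]
  linarith [e4 a b c, e4 a c b, e4 b c a]

lemma metric_mul_torsionEnd (h : LocalHermitian V G A) (hy : y ∈ V) (X Y Z : Fin m → ℝ) :
    Z ⬝ᵥ (G y *ᵥ (contr (torsionEnd G A y) X *ᵥ Y)) =
      ∑ a, ∑ b, ∑ c, X a * Y b * Z c * -dcFundForm G A y ![a, b, c] := by
  have e : G y * contr (torsionEnd G A y) X =
      contr (fun a => -Matrix.of fun c b => dcFundForm G A y ![a, b, c]) X := by
    simp only [contr, Finset.mul_sum, Matrix.mul_smul, torsionEnd, mul_neg, ← mul_assoc,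
      h.mul_inv hy, one_mul]
  rw [Matrix.mulVec_mulVec, e, dotProduct]
  simp only [contr_mulVec_apply, Finset.mul_sum, Matrix.neg_apply, Matrix.of_apply]
  rw [sum_rotate]
  exact Finset.sum_congr rfl fun a _ => Finset.sum_congr rfl fun b _ =>
    Finset.sum_congr rfl fun c _ => by ring

lemma isTorsion (h : LocalHermitian V G A) (hy : y ∈ V) :
    IsTorsion (G y) (A y) (covEnd G A y) (torsionEnd G A y) := by
  intro X Y Z
  set d := dOmega (G y) (covEnd G A y) with hd
  have e := trilinear_expand (f := fun X Y Z => d (A y *ᵥ X) (A y *ᵥ Y) (A y *ᵥ Z))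
    (fun Y Z => isLinearMap_comp_mulVec (dOmega_linear_left _ _ _ _) _)
    (fun X Z => isLinearMap_comp_mulVec (dOmega_linear_mid _ _ _ _) _)
    (fun X Y => isLinearMap_comp_mulVec (dOmega_linear_right _ _ _ _) _) X Y Z
  rw [h.metric_mul_torsionEnd hy, e]
  refine Finset.sum_congr rfl fun a _ => Finset.sum_congr rfl fun b _ =>
    Finset.sum_congr rfl fun c _ => ?_
  congr 1
  rw [hd, trilinear_expand (dOmega_linear_left _ _) (dOmega_linear_mid _ _)
    (dOmega_linear_right _ _)]
  simp [dcFundForm, h.extD_fundForm hy]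

/-- The Lee form in terms of the torsion. -/
lemma leeForm_eq (h : LocalHermitian V G A) (hy : y ∈ V) (k : Fin m) :
    leeForm G A k y =
      (1 / 2) * (A y * contr (torsionEnd G A y) (A y *ᵥ Pi.single k 1)).trace := by
  set C := contr (torsionEnd G A y) (A y *ᵥ Pi.single k 1) with hC
  have j := h.hermitianJet hy
  have e : ∀ a c, extD (fundForm G A) y ![a, c, k] = (G y * A y * C * A y) c a := by
    intro a c
    have k1 := h.isTorsion hy (A y *ᵥ Pi.single k 1) (A y *ᵥ Pi.single a 1)
      (A y *ᵥ Pi.single c 1)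
    simp only [j.sq_apply, j.dOmega_neg_left, j.dOmega_neg_mid, j.dOmega_neg_right] at k1
    rw [← hC, j.compat_apply] at k1
    rw [h.extD_fundForm hy, dOmega_cycle _ _ (Pi.single k 1)]
    have k2 : (Pi.single c 1 : Fin m → ℝ) ⬝ᵥ G y *ᵥ A y *ᵥ C *ᵥ A y *ᵥ Pi.single a 1 =
        (G y * A y * C * A y) c a := by
      simp only [Matrix.mulVec_mulVec, Matrix.mulVec_single_one, single_one_dotProduct]
      simp only [← mul_assoc]
      rfl
    linarith
  have e2 : leeForm G A k y =
      (1 / 2) * ((G y)⁻¹ * (A y)ᵀ * (G y * A y * C * A y)).trace := by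
    unfold leeForm
    congr 1
    simp only [e, Matrix.trace, Matrix.diag_apply, Matrix.mul_apply (M := (G y)⁻¹ * (A y)ᵀ),
      Matrix.mul_apply (M := (G y)⁻¹) (N := (A y)ᵀ), Matrix.transpose_apply, Finset.sum_mul]
    exact Finset.sum_congr rfl fun a _ => Finset.sum_comm
  rw [e2]
  congr 1
  rw [show (G y)⁻¹ * (A y)ᵀ * (G y * A y * C * A y) =
    (G y)⁻¹ * ((A y)ᵀ * G y * A y) * C * A y by noncomm_ring, h.orth y hy, h.inv_mul hy, one_mul,
    Matrix.trace_mul_comm]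

end LocalHermitian
end LocalHermitian

/-! ### The logarithmic potentials of a pair of complex structures -/

section PairPotentials

variable {ι : Type*} [Fintype ι] [DecidableEq ι]

/-- `½ log |det (I - J)| - ½ log |det (I + J)|`, the Ricci potential in matrix form; `Real.log x`
stands for `log |x|`. -/
def pairPhi (I J : Matrix ι ι ℝ) : ℝ :=
  (1 / 2) * Real.log (I - J).det - (1 / 2) * Real.log (I + J).det

/-- `log |det (I - J)| + log |det (I + J)| = log |det [I, J]|`; no absolute values are needed, as
`Real.log x` stands for `log |x|`. -/
def pairVol (I J : Matrix ι ι ℝ) : ℝ := Real.log (I - J).det + Real.log (I + J).det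

lemma sub_mul_add_of_sq {I J : Matrix ι ι ℝ} (hI : I * I = -1) (hJ : J * J = -1) :
    (I - J) * (I + J) = I * J - J * I := by
  linear_combination (norm := noncomm_ring) hI - hJ

lemma det_sub_ne_zero {I J : Matrix ι ι ℝ} (hI : I * I = -1) (hJ : J * J = -1)
    (h : (I * J - J * I).det ≠ 0) : (I - J).det ≠ 0 := by
  rw [← sub_mul_add_of_sq hI hJ, Matrix.det_mul] at h
  exact left_ne_zero_of_mul h

lemma det_add_ne_zero {I J : Matrix ι ι ℝ} (hI : I * I = -1) (hJ : J * J = -1)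
    (h : (I * J - J * I).det ≠ 0) : (I + J).det ≠ 0 := by
  rw [← sub_mul_add_of_sq hI hJ, Matrix.det_mul] at h
  exact right_ne_zero_of_mul h

lemma pairVol_eq {I J : Matrix ι ι ℝ} (hI : I * I = -1) (hJ : J * J = -1)
    (h : (I * J - J * I).det ≠ 0) : pairVol I J = Real.log (I * J - J * I).det := by
  rw [pairVol, ← Real.log_mul (det_sub_ne_zero hI hJ h) (det_add_ne_zero hI hJ h),
    ← Matrix.det_mul, sub_mul_add_of_sq hI hJ]

variable {I J : ℝ → Matrix ι ι ℝ} {I' J' : Matrix ι ι ℝ} {s : Set ℝ} {t : ℝ}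

lemma inv_add_of_comm {I J S : Matrix ι ι ℝ} (hI : I * I = -1) (hJ : J * J = -1)
    (hS : S * (I * J - J * I) = 1) : (I + J)⁻¹ = S * (I - J) :=
  Matrix.inv_eq_left_inv (by rw [mul_assoc, sub_mul_add_of_sq hI hJ, hS])

lemma inv_sub_of_comm {I J S : Matrix ι ι ℝ} (hI : I * I = -1) (hJ : J * J = -1)
    (hS : S * (I * J - J * I) = 1) : (I - J)⁻¹ = -(S * (I + J)) :=
  Matrix.inv_eq_left_inv (by
    linear_combination (norm := noncomm_ring) hS - S * hI + S * hJ)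

lemma hasDerivWithinAt_pairPhi (hi : ∀ i j, HasDerivWithinAt (fun r => I r i j) (I' i j) s t)
    (hj : ∀ i j, HasDerivWithinAt (fun r => J r i j) (J' i j) s t)
    (hI : I t * I t = -1) (hJ : J t * J t = -1) (h : (I t * J t - J t * I t).det ≠ 0) :
    HasDerivWithinAt (fun r => pairPhi (I r) (J r))
      (-((I t * J t - J t * I t)⁻¹ * I t * I').trace +
        ((I t * J t - J t * I t)⁻¹ * J t * J').trace) s t := by
  have hS := Matrix.nonsing_inv_mul _ (isUnit_iff_ne_zero.2 h)
  have k1 := hasDerivWithinAt_log_det (F := fun r => I r - J r) (F' := I' - J')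
    (fun i j => (hi i j).sub (hj i j)) (det_sub_ne_zero hI hJ h)
  have k2 := hasDerivWithinAt_log_det (F := fun r => I r + J r) (F' := I' + J')
    (fun i j => (hi i j).add (hj i j)) (det_add_ne_zero hI hJ h)
  rw [inv_sub_of_comm hI hJ hS] at k1
  rw [inv_add_of_comm hI hJ hS] at k2
  refine ((k1.const_mul (1 / 2)).sub (k2.const_mul (1 / 2))).congr_deriv ?_
  simp only [mul_add, mul_sub, add_mul, sub_mul, neg_mul, Matrix.trace_add, Matrix.trace_sub,
    Matrix.trace_neg]
  ring

lemma hasDerivWithinAt_pairVol (hi : ∀ i j, HasDerivWithinAt (fun r => I r i j) (I' i j) s t)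
    (hj : ∀ i j, HasDerivWithinAt (fun r => J r i j) (J' i j) s t)
    (hI : I t * I t = -1) (hJ : J t * J t = -1) (h : (I t * J t - J t * I t).det ≠ 0) :
    HasDerivWithinAt (fun r => pairVol (I r) (J r))
      (-2 * ((I t * J t - J t * I t)⁻¹ * J t * I').trace +
        2 * ((I t * J t - J t * I t)⁻¹ * I t * J').trace) s t := by
  have hS := Matrix.nonsing_inv_mul _ (isUnit_iff_ne_zero.2 h)
  have k1 := hasDerivWithinAt_log_det (F := fun r => I r - J r) (F' := I' - J')
    (fun i j => (hi i j).sub (hj i j)) (det_sub_ne_zero hI hJ h)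
  have k2 := hasDerivWithinAt_log_det (F := fun r => I r + J r) (F' := I' + J')
    (fun i j => (hi i j).add (hj i j)) (det_add_ne_zero hI hJ h)
  rw [inv_sub_of_comm hI hJ hS] at k1
  rw [inv_add_of_comm hI hJ hS] at k2
  refine (k1.add k2).congr_deriv ?_
  simp only [mul_add, mul_sub, add_mul, sub_mul, neg_mul, Matrix.trace_add, Matrix.trace_sub,
    Matrix.trace_neg]
  ring

/-- The derivative of `pairPhi` along variations of the shape of Lie derivatives. -/
lemma trace_pairPhi {I J S C C' U U' L L' : Matrix ι ι ℝ} (hI : I * I = -1) (hJ : J * J = -1)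
    (hS : S * (I * J - J * I) = 1)
    (hL : L = -(1 / 2 : ℝ) • (C * I - I * C) - U * I + I * U)
    (hL' : L' = (1 / 2 : ℝ) • (C' * J - J * C') - U' * J + J * U') :
    -(S * I * L).trace + (S * J * L').trace =
      (C * S).trace + (C' * S).trace + 2 * (S * U).trace - 2 * (S * U').trace := by
  rw [trace_inv_comm_lie_left hI (inv_comm_anticomm_left hI hS) C U hL,
    trace_inv_comm_lie_left (C := -C') (U := U') hJ (inv_comm_anticomm_right hJ hS) (by
      rw [hL']; simp only [neg_mul, mul_neg]; module)]
  simp only [neg_mul, Matrix.trace_neg]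
  ring

/-- The derivative of `pairVol` along variations of the shape of Lie derivatives. -/
lemma trace_pairVol {I J S C C' U U' L L' : Matrix ι ι ℝ} (hI : I * I = -1) (hJ : J * J = -1)
    (hS : S * (I * J - J * I) = 1)
    (hL : L = -(1 / 2 : ℝ) • (C * I - I * C) - U * I + I * U)
    (hL' : L' = (1 / 2 : ℝ) • (C' * J - J * C') - U' * J + J * U') :
    -2 * (S * J * L).trace + 2 * (S * I * L').trace =
      -(C * ((I * J + J * I) * S)).trace - (C' * ((I * J + J * I) * S)).trace -
        2 * ((I * J + J * I) * S * U).trace + 2 * ((I * J + J * I) * S * U').trace := by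
  have a1 := inv_comm_anticomm_left hI hS
  have a2 := inv_comm_anticomm_right hJ hS
  rw [trace_inv_comm_lie_mixed a1 a2 C U hL,
    trace_inv_comm_lie_mixed (C := -C') (U := U') a2 a1 (by
      rw [hL']; simp only [neg_mul, mul_neg]; module)]
  simp only [neg_mul, Matrix.trace_neg, add_comm (J * I)]
  ring

end PairPotentials

/-! ### Generalized Kähler structures in coordinates -/

section LocalGK

variable {m : ℕ}

/-- A nondegenerate generalized Kähler structure in coordinates on the open set `V`. -/
structure LocalGK (V : Set (Coord m)) (G I J : Coord m → Matrix (Fin m) (Fin m) ℝ) : Prop where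
  left : LocalHermitian V G I
  right : LocalHermitian V G J
  torsion : ∀ y ∈ V, ∀ s, dcFundForm G I y s = -dcFundForm G J y s
  nondeg : ∀ y ∈ V, (I y * J y - J y * I y).det ≠ 0

/-- The gradient covector of a function. -/
def dcov (f : Coord m → ℝ) (y : Coord m) : Fin m → ℝ := fun a => pd a f y

/-- The Hessian `∇_l ∇_k f`. -/
def covHess (G : Coord m → Matrix (Fin m) (Fin m) ℝ) (f : Coord m → ℝ) (y : Coord m) :
    Matrix (Fin m) (Fin m) ℝ :=
  Matrix.of fun l k => pd l (pd k f) y - ∑ c, christoffel G c l k y * pd c f y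

/-- The Laplace-Beltrami operator. -/
def lapl (G : Coord m → Matrix (Fin m) (Fin m) ℝ) (f : Coord m → ℝ) (y : Coord m) : ℝ :=
  ((G y)⁻¹ * covHess G f y).trace

/-- The matrix `(∇X)^k_l` of the covariant derivative of a vector field. -/
def covVec (G : Coord m → Matrix (Fin m) (Fin m) ℝ) (X : Fin m → Coord m → ℝ) (y : Coord m) :
    Matrix (Fin m) (Fin m) ℝ :=
  (Matrix.of fun k l => pd l (X k) y) + contr (fun a => chrM G a y) (fun a => X a y)

/-- The Lie derivative `L_X A = ∇_X A - (∇X) A + A ∇X`. -/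
lemma lieEnd_eq (G A : Coord m → Matrix (Fin m) (Fin m) ℝ) (X : Fin m → Coord m → ℝ)
    (y : Coord m) : (Matrix.of fun k j => lieEnd X A k j y) =
      contr (covEnd G A y) (fun a => X a y) - covVec G X y * A y + A y * covVec G X y := by
  rw [LocalHermitian.contr_covEnd, covVec, add_mul, mul_add]
  have : (Matrix.of fun k j => lieEnd X A k j y) = contr (fun a => pdM a A y) (fun a => X a y) -
      (Matrix.of fun k l => pd l (X k) y) * A y + A y * (Matrix.of fun k l => pd l (X k) y) := by
    ext k j
    simp only [lieEnd, Matrix.of_apply, Matrix.add_apply, Matrix.sub_apply, contr,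
      Matrix.sum_apply, Matrix.smul_apply, pdM, smul_eq_mul, Matrix.mul_apply,
      Finset.sum_add_distrib, Finset.sum_sub_distrib]
    congr 2
    exact Finset.sum_congr rfl fun l _ => mul_comm _ _
  rw [this]
  abel

namespace LocalGK

variable {V : Set (Coord m)} {G I J : Coord m → Matrix (Fin m) (Fin m) ℝ} {y : Coord m}

lemma isOpen (h : LocalGK V G I J) : IsOpen V := h.left.isOpen

lemma torsionEnd_right (h : LocalGK V G I J) (hy : y ∈ V) :
    torsionEnd G J y = fun a => -torsionEnd G I y a := by
  funext a
  have e : (Matrix.of fun c b => dcFundForm G I y ![a, b, c]) =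
      -Matrix.of fun c b => dcFundForm G J y ![a, b, c] := by
    ext c b
    simp [h.torsion y hy]
  rw [torsionEnd, torsionEnd, e, mul_neg, neg_neg]

lemma contr_torsionEnd_right (h : LocalGK V G I J) (hy : y ∈ V) (v : Fin m → ℝ) :
    contr (torsionEnd G J y) v = -contr (torsionEnd G I y) v := by
  rw [h.torsionEnd_right hy]
  simp [contr]

/-- The connection `∇ + ½ H` preserves `I`. -/
lemma covEnd_left (h : LocalGK V G I J) (hy : y ∈ V) (a : Fin m) :
    covEnd G I y a = -(1 / 2 : ℝ) • (torsionEnd G I y a * I y - I y * torsionEnd G I y a) :=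
  (h.left.hermitianJet hy).covariant_eq (h.left.unit y hy) (h.left.isTorsion hy) a

/-- The connection `∇ - ½ H` preserves `J`. -/
lemma covEnd_right (h : LocalGK V G I J) (hy : y ∈ V) (a : Fin m) :
    covEnd G J y a = (1 / 2 : ℝ) • (torsionEnd G I y a * J y - J y * torsionEnd G I y a) := by
  rw [(h.right.hermitianJet hy).covariant_eq (h.left.unit y hy) (h.right.isTorsion hy) a,
    h.torsionEnd_right hy]
  simp only [neg_mul, mul_neg]
  module

lemma contr_covEnd_left (h : LocalGK V G I J) (hy : y ∈ V) (v : Fin m → ℝ) :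
    contr (covEnd G I y) v = -(1 / 2 : ℝ) • (contr (torsionEnd G I y) v * I y -
      I y * contr (torsionEnd G I y) v) := by
  simp only [contr, h.covEnd_left hy, Finset.sum_mul, Finset.mul_sum, ← Finset.sum_sub_distrib,
    Finset.smul_sum, Matrix.smul_mul, Matrix.mul_smul]
  exact Finset.sum_congr rfl fun a _ => by module

lemma contr_covEnd_right (h : LocalGK V G I J) (hy : y ∈ V) (v : Fin m → ℝ) :
    contr (covEnd G J y) v = (1 / 2 : ℝ) • (contr (torsionEnd G I y) v * J y -
      J y * contr (torsionEnd G I y) v) := by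
  simp only [contr, h.covEnd_right hy, Finset.sum_mul, Finset.mul_sum, ← Finset.sum_sub_distrib,
    Finset.smul_sum, Matrix.smul_mul, Matrix.mul_smul]
  exact Finset.sum_congr rfl fun a _ => by module

lemma torsionAlg (h : LocalGK V G I J) (hy : y ∈ V) :
    TorsionAlg (I y) (J y) (torsionEnd G I y) where
  sqI := h.left.sq y hy
  sqJ := h.right.sq y hy
  typeI := (h.left.hermitianJet hy).torsion_type (h.left.unit y hy) (h.left.isTorsion hy)
  typeJ v := by
    have k := (h.right.hermitianJet hy).torsion_type (h.left.unit y hy) (h.right.isTorsion hy) v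
    simp only [h.contr_torsionEnd_right hy] at k
    linear_combination (norm := noncomm_ring) -k
  skew := (h.left.hermitianJet hy).torsion_skew (h.left.unit y hy) (h.left.isTorsion hy)

lemma inv_comm_mul (h : LocalGK V G I J) (hy : y ∈ V) :
    (I y * J y - J y * I y)⁻¹ * (I y * J y - J y * I y) = 1 :=
  Matrix.nonsing_inv_mul _ (isUnit_iff_ne_zero.2 (h.nondeg y hy))

lemma smooth_pairPhi (h : LocalGK V G I J) : ContDiffOn ℝ ∞ (fun z => pairPhi (I z) (J z)) V := by
  have hI := h.left.smooth_end
  have hJ := h.right.smooth_end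
  exact (contDiffOn_const.mul ((hI.sub hJ).det.log fun z hz =>
    det_sub_ne_zero (h.left.sq z hz) (h.right.sq z hz) (h.nondeg z hz))).sub
    (contDiffOn_const.mul ((hI.add hJ).det.log fun z hz =>
    det_add_ne_zero (h.left.sq z hz) (h.right.sq z hz) (h.nondeg z hz)))

lemma smooth_pairVol (h : LocalGK V G I J) : ContDiffOn ℝ ∞ (fun z => pairVol (I z) (J z)) V := by
  have hI := h.left.smooth_end
  have hJ := h.right.smooth_end
  exact ((hI.sub hJ).det.log fun z hz =>
    det_sub_ne_zero (h.left.sq z hz) (h.right.sq z hz) (h.nondeg z hz)).add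
    ((hI.add hJ).det.log fun z hz =>
    det_add_ne_zero (h.left.sq z hz) (h.right.sq z hz) (h.nondeg z hz))

lemma pdM_left (h : LocalGK V G I J) (hy : y ∈ V) (a : Fin m) : pdM a I y =
    -(1 / 2 : ℝ) • (torsionEnd G I y a * I y - I y * torsionEnd G I y a) -
      chrM G a y * I y + I y * chrM G a y := by
  rw [← h.covEnd_left hy, covEnd]
  abel

lemma pdM_right (h : LocalGK V G I J) (hy : y ∈ V) (a : Fin m) : pdM a J y =
    (1 / 2 : ℝ) • (torsionEnd G I y a * J y - J y * torsionEnd G I y a) -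
      chrM G a y * J y + J y * chrM G a y := by
  rw [← h.covEnd_right hy, covEnd]
  abel

/-- The differential of the Ricci potential. -/
lemma pd_pairPhi (h : LocalGK V G I J) (hy : y ∈ V) (a : Fin m) :
    pd a (fun z => pairPhi (I z) (J z)) y =
      2 * (torsionEnd G I y a * (I y * J y - J y * I y)⁻¹).trace := by
  have k1 := hasDerivAt_line (differentiableAt_of_smooth h.isOpen h.smooth_pairPhi hy) a
  have k2 := hasDerivWithinAt_pairPhi (s := Set.univ) (t := 0)
    (I := fun s : ℝ => I (y + s • EuclideanSpace.single a (1 : ℝ)))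
    (J := fun s : ℝ => J (y + s • EuclideanSpace.single a (1 : ℝ)))
    (I' := pdM a I y) (J' := pdM a J y)
    (fun i j => (hasDerivAt_line (h.left.smooth_end.diff h.isOpen hy i j) a).hasDerivWithinAt)
    (fun i j => (hasDerivAt_line (h.right.smooth_end.diff h.isOpen hy i j) a).hasDerivWithinAt)
    (by simpa using h.left.sq y hy) (by simpa using h.right.sq y hy)
    (by simpa using h.nondeg y hy)
  rw [hasDerivWithinAt_univ] at k2
  rw [k1.unique k2]
  simp only [zero_smul, add_zero]
  rw [trace_pairPhi (h.left.sq y hy) (h.right.sq y hy) (h.inv_comm_mul hy) (h.pdM_left hy a)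
    (h.pdM_right hy a)]
  ring

/-- The differential of `log |det [I, J]|`. -/
lemma pd_pairVol (h : LocalGK V G I J) (hy : y ∈ V) (a : Fin m) :
    pd a (fun z => pairVol (I z) (J z)) y =
      -2 * (torsionEnd G I y a * ((I y * J y + J y * I y) *
        (I y * J y - J y * I y)⁻¹)).trace := by
  have k1 := hasDerivAt_line (differentiableAt_of_smooth h.isOpen h.smooth_pairVol hy) a
  have k2 := hasDerivWithinAt_pairVol (s := Set.univ) (t := 0)
    (I := fun s : ℝ => I (y + s • EuclideanSpace.single a (1 : ℝ)))
    (J := fun s : ℝ => J (y + s • EuclideanSpace.single a (1 : ℝ)))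
    (I' := pdM a I y) (J' := pdM a J y)
    (fun i j => (hasDerivAt_line (h.left.smooth_end.diff h.isOpen hy i j) a).hasDerivWithinAt)
    (fun i j => (hasDerivAt_line (h.right.smooth_end.diff h.isOpen hy i j) a).hasDerivWithinAt)
    (by simpa using h.left.sq y hy) (by simpa using h.right.sq y hy)
    (by simpa using h.nondeg y hy)
  rw [hasDerivWithinAt_univ] at k2
  rw [k1.unique k2]
  simp only [zero_smul, add_zero]
  rw [trace_pairVol (h.left.sq y hy) (h.right.sq y hy) (h.inv_comm_mul hy) (h.pdM_left hy a)
    (h.pdM_right hy a)]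
  ring

lemma trace_contr (H : Fin m → Matrix (Fin m) (Fin m) ℝ) (v : Fin m → ℝ)
    (M : Matrix (Fin m) (Fin m) ℝ) : (contr H v * M).trace = v ⬝ᵥ fun a => (H a * M).trace := by
  simp [contr, Finset.sum_mul, Matrix.trace_sum, dotProduct]

lemma trace_contr_inv (h : LocalGK V G I J) (hy : y ∈ V) (v : Fin m → ℝ) :
    (contr (torsionEnd G I y) v * (I y * J y - J y * I y)⁻¹).trace =
      (1 / 2) * (v ⬝ᵥ dcov (fun z => pairPhi (I z) (J z)) y) := by
  rw [trace_contr]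
  simp only [dotProduct, dcov, h.pd_pairPhi hy, Finset.mul_sum]
  exact Finset.sum_congr rfl fun a _ => by ring

lemma trace_contr_anticomm_inv (h : LocalGK V G I J) (hy : y ∈ V) (v : Fin m → ℝ) :
    (contr (torsionEnd G I y) v * ((I y * J y + J y * I y) * (I y * J y - J y * I y)⁻¹)).trace =
      -(1 / 2) * (v ⬝ᵥ dcov (fun z => pairVol (I z) (J z)) y) := by
  rw [trace_contr]
  simp only [dotProduct, dcov, h.pd_pairVol hy, Finset.mul_sum]
  exact Finset.sum_congr rfl fun a _ => by ring

/-- `θ_I = ½ dΦ ∘ JI + ¼ d log |det [I, J]|`. -/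
lemma leeForm_left (h : LocalGK V G I J) (hy : y ∈ V) :
    (fun k => leeForm G I k y) = (1 / 2 : ℝ) • ((J y * I y)ᵀ *ᵥ
      dcov (fun z => pairPhi (I z) (J z)) y) + (1 / 4 : ℝ) •
      dcov (fun z => pairVol (I z) (J z)) y := by
  funext k
  rw [h.left.leeForm_eq hy, half_trace_contr_left (h.torsionAlg hy) (h.inv_comm_mul hy),
    h.trace_contr_inv hy, h.trace_contr_anticomm_inv hy, Matrix.mulVec_single_one,
    single_one_dotProduct]
  simp only [Pi.add_apply, Pi.smul_apply, smul_eq_mul, Matrix.mulVec]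
  rw [show (J y * I y)ᵀ k = (J y * I y).col k from rfl]
  ring

/-- `θ_J = ½ dΦ ∘ IJ + ¼ d log |det [I, J]|`. -/
lemma leeForm_right (h : LocalGK V G I J) (hy : y ∈ V) :
    (fun k => leeForm G J k y) = (1 / 2 : ℝ) • ((I y * J y)ᵀ *ᵥ
      dcov (fun z => pairPhi (I z) (J z)) y) + (1 / 4 : ℝ) •
      dcov (fun z => pairVol (I z) (J z)) y := by
  funext k
  have k0 := half_trace_contr_right (h.torsionAlg hy) (h.inv_comm_mul hy) (Pi.single k 1)
  rw [h.right.leeForm_eq hy, h.contr_torsionEnd_right hy, mul_neg, Matrix.trace_neg, mul_neg,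
    ← neg_mul, k0, h.trace_contr_inv hy, h.trace_contr_anticomm_inv hy, Matrix.mulVec_single_one,
    single_one_dotProduct]
  simp only [Pi.add_apply, Pi.smul_apply, smul_eq_mul, Matrix.mulVec]
  rw [show (I y * J y)ᵀ k = (I y * J y).col k from rfl]
  ring

end LocalGK
end LocalGK

/-! ### The evolution of the potentials under the flow of the complex structures -/

section Evolution

variable {m : ℕ} {V : Set (Coord m)} {G I J : Coord m → Matrix (Fin m) (Fin m) ℝ} {y : Coord m}

lemma LocalHermitian.end_mul_inv {A : Coord m → Matrix (Fin m) (Fin m) ℝ}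
    (h : LocalHermitian V G A) (hy : y ∈ V) :
    A y * (G y)⁻¹ = -((G y)⁻¹ * (A y)ᵀ) := by
  have k := h.compat hy
  have k1 := h.mul_inv hy
  have k2 := h.inv_mul hy
  linear_combination (norm := noncomm_ring) (G y)⁻¹ * k * (G y)⁻¹ - (G y)⁻¹ * (A y)ᵀ * k1 -
    k2 * A y * (G y)⁻¹

lemma LocalMetric.smooth_inv (h : LocalMetric V G) : SmoothMat (fun z => (G z)⁻¹) V :=
  h.smooth.inv h.unit

lemma smooth_dcov {f : Coord m → ℝ} (hV : IsOpen V) (hf : ContDiffOn ℝ ∞ f V) (a : Fin m) :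
    ContDiffOn ℝ ∞ (fun z => dcov f z a) V := pd_smooth hV hf a

lemma LocalMetric.covHess_symm (h : LocalMetric V G) {f : Coord m → ℝ}
    (hf : ContDiffOn ℝ ∞ f V) (hy : y ∈ V) : (covHess G f y)ᵀ = covHess G f y := by
  ext l k
  simp only [Matrix.transpose_apply, covHess, Matrix.of_apply]
  rw [pd_comm h.isOpen hf hy]
  simp only [h.christoffel_symm hy _ k l]

/-- The rows of the Hessian. -/
lemma covHess_row (G : Coord m → Matrix (Fin m) (Fin m) ℝ) (f : Coord m → ℝ) (y : Coord m)
    (l : Fin m) : covHess G f y l = pdV l (dcov f) y - (chrM G l y)ᵀ *ᵥ dcov f y := by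
  funext k
  simp only [covHess, Matrix.of_apply, Pi.sub_apply, pdV, dcov, Matrix.mulVec, dotProduct,
    Matrix.transpose_apply, chrM]

namespace LocalGK

/-- `θ_I^♯ - θ_J^♯ = ½ [I, J] ∇Φ`. -/
lemma leeField_sub (h : LocalGK V G I J) (hy : y ∈ V) :
    (fun k => leeField G I k y - leeField G J k y) = (1 / 2 : ℝ) • ((I y * J y - J y * I y) *ᵥ
      ((G y)⁻¹ *ᵥ dcov (fun z => pairPhi (I z) (J z)) y)) := by
  have e : ∀ A : Coord m → Matrix (Fin m) (Fin m) ℝ,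
      (fun k => leeField G A k y) = (G y)⁻¹ *ᵥ fun l => leeForm G A l y := fun A => rfl
  have e2 : (fun k => leeField G I k y - leeField G J k y) =
      (fun k => leeField G I k y) - fun k => leeField G J k y := rfl
  have k1 := h.left.end_mul_inv hy
  have k2 := h.right.end_mul_inv hy
  have k3 : (I y * J y - J y * I y) * (G y)⁻¹ =
      (G y)⁻¹ * (J y * I y)ᵀ - (G y)⁻¹ * (I y * J y)ᵀ := by
    rw [Matrix.transpose_mul, Matrix.transpose_mul]
    linear_combination (norm := noncomm_ring) I y * k2 - J y * k1 - k1 * (J y)ᵀ + k2 * (I y)ᵀ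
  rw [e2, e, e, h.leeForm_left hy, h.leeForm_right hy, Matrix.mulVec_mulVec, k3]
  simp only [Matrix.mulVec_add, Matrix.sub_mulVec, Matrix.mulVec_smul,
    Matrix.mulVec_mulVec]
  module

/-- `θ_I^♯ + θ_J^♯ = ½ (IJ + JI) ∇Φ + ½ ∇ log |det [I, J]|`. -/
lemma leeField_add (h : LocalGK V G I J) (hy : y ∈ V) :
    (fun k => leeField G I k y) + (fun k => leeField G J k y) =
      (1 / 2 : ℝ) • ((I y * J y + J y * I y) *ᵥ
        ((G y)⁻¹ *ᵥ dcov (fun z => pairPhi (I z) (J z)) y)) +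
      (1 / 2 : ℝ) • ((G y)⁻¹ *ᵥ dcov (fun z => pairVol (I z) (J z)) y) := by
  have e : ∀ A : Coord m → Matrix (Fin m) (Fin m) ℝ,
      (fun k => leeField G A k y) = (G y)⁻¹ *ᵥ fun l => leeForm G A l y := fun A => rfl
  have k1 := h.left.end_mul_inv hy
  have k2 := h.right.end_mul_inv hy
  have k3 : (I y * J y + J y * I y) * (G y)⁻¹ =
      (G y)⁻¹ * (J y * I y)ᵀ + (G y)⁻¹ * (I y * J y)ᵀ := by
    rw [Matrix.transpose_mul, Matrix.transpose_mul]
    linear_combination (norm := noncomm_ring) I y * k2 + J y * k1 - k1 * (J y)ᵀ - k2 * (I y)ᵀ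
  rw [e, e, h.leeForm_left hy, h.leeForm_right hy, Matrix.mulVec_mulVec, k3]
  simp only [Matrix.mulVec_add, Matrix.add_mulVec, Matrix.mulVec_smul,
    Matrix.mulVec_mulVec]
  module

lemma smooth_leeForm {A : Coord m → Matrix (Fin m) (Fin m) ℝ} (h : LocalHermitian V G A)
    (k : Fin m) : ContDiffOn ℝ ∞ (leeForm G A k) V := by
  have hω : ∀ s, ContDiffOn ℝ ∞ (fun z => fundForm G A z s) V := fun s =>
    ContDiffOn.sum fun c _ => (h.smooth_end _ _).mul (h.smooth _ _)
  have hd : ∀ s, ContDiffOn ℝ ∞ (fun z => extD (fundForm G A) z s) V := fun s =>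
    ContDiffOn.sum fun a _ => contDiffOn_const.mul (pd_smooth h.isOpen (hω _) _)
  exact contDiffOn_const.mul (ContDiffOn.sum fun a _ => ContDiffOn.sum fun b _ =>
      ContDiffOn.sum fun c _ => ((h.smooth_inv a b).mul (h.smooth_end c b)).mul (hd _))

lemma smooth_leeField {A : Coord m → Matrix (Fin m) (Fin m) ℝ} (h : LocalHermitian V G A)
    (k : Fin m) : ContDiffOn ℝ ∞ (leeField G A k) V :=
  ContDiffOn.sum fun l _ => (h.smooth_inv k l).mul (smooth_leeForm h l)

/-- The trace of `M ∇W` for the vector field `W = θ_I^♯ - θ_J^♯`. -/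
lemma trace_mul_covVec (h : LocalGK V G I J) (hy : y ∈ V) (M : Matrix (Fin m) (Fin m) ℝ) :
    (M * covVec G (leeField G I) y).trace - (M * covVec G (leeField G J) y).trace =
      (1 / 2) * ∑ a, ((M * (covEnd G I y a * J y + I y * covEnd G J y a - covEnd G J y a * I y -
        J y * covEnd G I y a)) *ᵥ
          ((G y)⁻¹ *ᵥ dcov (fun z => pairPhi (I z) (J z)) y)) a +
      (1 / 2) * (M * (I y * J y - J y * I y) * (G y)⁻¹ *
        covHess G (fun z => pairPhi (I z) (J z)) y).trace := by
  set p := dcov (fun z => pairPhi (I z) (J z)) with hp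
  have hps : ∀ i, ContDiffOn ℝ ∞ (fun z => p z i) V := smooth_dcov h.isOpen h.smooth_pairPhi
  set Q : Coord m → Matrix (Fin m) (Fin m) ℝ := fun z => I z * J z - J z * I z with hQ
  have sI := h.left.smooth_end
  have sJ := h.right.smooth_end
  have hQs : SmoothMat Q V := (sI.mul sJ).sub (sJ.mul sI)
  have hGs := h.left.smooth_inv
  set W : Coord m → Fin m → ℝ := fun z => (1 / 2 : ℝ) • (Q z *ᵥ ((G z)⁻¹ *ᵥ p z)) with hW
  have hdW : ∀ l, pdV l (fun z k => leeField G I k z - leeField G J k z) y =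
      (1 / 2 : ℝ) • (pdM l Q y *ᵥ ((G y)⁻¹ *ᵥ p y) +
        Q y *ᵥ (-(chrM G l y * (G y)⁻¹ + (G y)⁻¹ * (chrM G l y)ᵀ) *ᵥ p y +
          (G y)⁻¹ *ᵥ pdV l p y)) := by
    intro l
    rw [← h.left.pdM_inv_metric hy, ← pdV_mulVec hGs hps h.isOpen hy,
      ← pdV_mulVec hQs (smooth_mulVec hGs hps) h.isOpen hy]
    funext k
    have e : ∀ z ∈ V, leeField G I k z - leeField G J k z =
        (1 / 2) * (Q z *ᵥ ((G z)⁻¹ *ᵥ p z)) k := fun z hz => congrFun (h.leeField_sub hz) k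
    simp only [pdV, Pi.smul_apply, smul_eq_mul]
    rw [pd_congr_on h.isOpen e hy, pd_const_mul]
    exact differentiableAt_of_smooth h.isOpen
      (smooth_mulVec hQs (smooth_mulVec hGs hps) k) hy
  have hdQ : ∀ l, pdM l Q y = covEnd G I y l * J y + I y * covEnd G J y l - covEnd G J y l * I y -
      J y * covEnd G I y l - chrM G l y * Q y + Q y * chrM G l y := by
    intro l
    rw [hQ, pdM_sub (sI.mul sJ) (sJ.mul sI) h.isOpen hy, pdM_mul sI sJ h.isOpen hy,
      pdM_mul sJ sI h.isOpen hy]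
    unfold covEnd
    noncomm_ring
  have hcol : ∀ l, (fun k => covVec G (leeField G I) y k l - covVec G (leeField G J) y k l) =
      (1 / 2 : ℝ) • ((covEnd G I y l * J y + I y * covEnd G J y l - covEnd G J y l * I y -
        J y * covEnd G I y l) *ᵥ ((G y)⁻¹ *ᵥ p y) +
          (Q y * (G y)⁻¹) *ᵥ covHess G (fun z => pairPhi (I z) (J z)) y l) := by
    intro l
    have e1 : (fun k => covVec G (leeField G I) y k l - covVec G (leeField G J) y k l) =
        pdV l (fun z k => leeField G I k z - leeField G J k z) y +
          chrM G l y *ᵥ fun k => leeField G I k y - leeField G J k y := by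
      funext k
      have s1 := h.left.contr_chrM_symm hy (fun a => leeField G I a y) (Pi.single l 1)
      have s2 := h.left.contr_chrM_symm hy (fun a => leeField G J a y) (Pi.single l 1)
      have t1 := congrFun s1 k
      have t2 := congrFun s2 k
      rw [contr_single, Matrix.mulVec_single_one] at t1 t2
      simp only [Matrix.col_apply] at t1 t2
      simp only [covVec, Matrix.add_apply, Matrix.of_apply, t1, t2, Pi.add_apply, pdV]
      rw [pd_sub (differentiableAt_of_smooth h.isOpen (smooth_leeField h.left k) hy)
        (differentiableAt_of_smooth h.isOpen (smooth_leeField h.right k) hy)]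
      have : (fun k => leeField G I k y - leeField G J k y) =
        (fun k => leeField G I k y) - fun k => leeField G J k y := rfl
      rw [this, Matrix.mulVec_sub, Pi.sub_apply]
      ring
    rw [e1, hdW, h.leeField_sub hy, hdQ, covHess_row, ← hp]
    simp only [Matrix.mulVec_add, Matrix.mulVec_sub, Matrix.add_mulVec, Matrix.sub_mulVec,
      Matrix.neg_mulVec, Matrix.mulVec_neg, Matrix.mulVec_smul, ← Matrix.mulVec_mulVec, hQ]
    module
  have htr : (M * covVec G (leeField G I) y).trace - (M * covVec G (leeField G J) y).trace =
      ∑ a, (M *ᵥ fun k => covVec G (leeField G I) y k a - covVec G (leeField G J) y k a) a := by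
    rw [← Matrix.trace_sub, ← mul_sub]
    rfl
  rw [htr]
  simp only [hcol, Matrix.mulVec_smul, Matrix.mulVec_add, Pi.smul_apply, Pi.add_apply,
    smul_eq_mul, Finset.sum_add_distrib, ← Finset.mul_sum, mul_add]
  congr 2
  · simp only [Matrix.mulVec_mulVec, mul_assoc]
  · conv_lhs => rw [← h.left.covHess_symm h.smooth_pairPhi hy]
    simp only [Matrix.mulVec_mulVec, ← mul_assoc]
    rfl

/-- Along the flow the Ricci potential satisfies the heat equation. -/
lemma heat_pairPhi (h : LocalGK V G I J) (hy : y ∈ V) :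
    -((I y * J y - J y * I y)⁻¹ * I y * Matrix.of fun k j =>
        lieEnd (leeField G I) I k j y).trace +
      ((I y * J y - J y * I y)⁻¹ * J y * Matrix.of fun k j =>
        lieEnd (leeField G J) J k j y).trace =
      lapl G (fun z => pairPhi (I z) (J z)) y := by
  have hS := h.inv_comm_mul hy
  have hI := h.left.sq y hy
  have hJ := h.right.sq y hy
  have hS' := mul_eq_one_comm.mp hS
  have k0 := trace_pairPhi hI hJ hS
    (L := Matrix.of fun k j => lieEnd (leeField G I) I k j y)
    (L' := Matrix.of fun k j => lieEnd (leeField G J) J k j y)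
    (by rw [lieEnd_eq, h.contr_covEnd_left hy]) (by rw [lieEnd_eq, h.contr_covEnd_right hy])
  rw [k0, h.trace_contr_inv hy, h.trace_contr_inv hy]
  have k1 := h.trace_mul_covVec hy (I y * J y - J y * I y)⁻¹
  have k2 := trace_mul_covariant_comm (h.torsionAlg hy) (inv_comm_anticomm_left hI hS)
    (inv_comm_anticomm_right hJ hS) (h.covEnd_left hy) (h.covEnd_right hy)
    ((G y)⁻¹ *ᵥ dcov (fun z => pairPhi (I z) (J z)) y)
  rw [k2, hS, one_mul, h.trace_contr_inv hy, h.trace_contr_anticomm_inv hy] at k1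
  have k3 := congrArg (fun v => v ⬝ᵥ dcov (fun z => pairPhi (I z) (J z)) y) (h.leeField_add hy)
  simp only [add_dotProduct, smul_dotProduct, smul_eq_mul] at k3
  have k4 : ((G y)⁻¹ *ᵥ dcov (fun z => pairVol (I z) (J z)) y) ⬝ᵥ
      dcov (fun z => pairPhi (I z) (J z)) y = ((G y)⁻¹ *ᵥ dcov (fun z => pairPhi (I z) (J z)) y) ⬝ᵥ
        dcov (fun z => pairVol (I z) (J z)) y := by
    rw [dotProduct_comm, dotProduct_mulVec_transpose, h.left.inv_symm hy, dotProduct_comm]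
  rw [k4] at k3
  unfold lapl
  linarith

/-- The lower-order term in the evolution of `log |det [I, J]|` at its critical points. There
`θ_I = ½ dΦ ∘ JI`, so that the covector `p = 2 θ_I ∘ IJ` is `dΦ`. Written with `θ_I` in place of
`dΦ`, the expression contains no inverse of `[I, J]` and is smooth even where `[I, J]`
degenerates. -/
def volError (G I J : Coord m → Matrix (Fin m) (Fin m) ℝ) (y : Coord m) : ℝ :=
  let p : Fin m → ℝ := (2 : ℝ) • ((I y * J y)ᵀ *ᵥ fun l => leeForm G I l y);
  -4 * ∑ k, ((G y)⁻¹ *ᵥ fun l => pd k (leeForm G I l) y) k +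
    2 * ∑ k, ((G y)⁻¹ *ᵥ
      (((pdM k (fun z => J z * I z) y)ᵀ + (J y * I y)ᵀ * (chrM G k y)ᵀ) *ᵥ p)) k -
    ((G y)⁻¹ *ᵥ p) ⬝ᵥ p -
    (1 / 2) * (contr (torsionEnd G I y) ((G y)⁻¹ *ᵥ p) * (I y * J y - J y * I y)).trace

/-- The Laplacian of `log |det [I, J]|` at a critical point. -/
lemma lapl_pairVol (h : LocalGK V G I J) (hy : y ∈ V)
    (hq : dcov (fun z => pairVol (I z) (J z)) y = 0) :
    lapl G (fun z => pairVol (I z) (J z)) y =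
      4 * ∑ k, ((G y)⁻¹ *ᵥ fun l => pd k (leeForm G I l) y) k -
      2 * ∑ k, ((G y)⁻¹ *ᵥ (((pdM k (fun z => J z * I z) y)ᵀ + (J y * I y)ᵀ * (chrM G k y)ᵀ) *ᵥ
        dcov (fun z => pairPhi (I z) (J z)) y)) k -
      ((I y * J y + J y * I y) * (G y)⁻¹ *
        covHess G (fun z => pairPhi (I z) (J z)) y).trace := by
  set p := dcov (fun z => pairPhi (I z) (J z)) with hp
  set B := covHess G (fun z => pairPhi (I z) (J z)) y with hB
  have hps : ∀ i, ContDiffOn ℝ ∞ (fun z => p z i) V := smooth_dcov h.isOpen h.smooth_pairPhi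
  have sJI : SmoothMat (fun z => J z * I z) V := h.right.smooth_end.mul h.left.smooth_end
  have hBs : Bᵀ = B := h.left.covHess_symm h.smooth_pairPhi hy
  have hrow : ∀ k, covHess G (fun z => pairVol (I z) (J z)) y k =
      (4 : ℝ) • (fun l => pd k (leeForm G I l) y) -
        (2 : ℝ) • (((pdM k (fun z => J z * I z) y)ᵀ + (J y * I y)ᵀ * (chrM G k y)ᵀ) *ᵥ p y) -
        (2 : ℝ) • ((J y * I y)ᵀ *ᵥ B k) := by
    intro k
    rw [covHess_row, hq, Matrix.mulVec_zero, sub_zero]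
    have e : pdV k (dcov fun z => pairVol (I z) (J z)) y =
        (4 : ℝ) • (fun l => pd k (leeForm G I l) y) -
          (2 : ℝ) • pdV k (fun z => (J z * I z)ᵀ *ᵥ p z) y := by
      funext l
      have e0 : ∀ z ∈ V, dcov (fun z => pairVol (I z) (J z)) z l =
          4 * leeForm G I l z - 2 * ((J z * I z)ᵀ *ᵥ p z) l := by
        intro z hz
        have := congrFun (h.leeForm_left hz) l
        simp only [Pi.add_apply, Pi.smul_apply, smul_eq_mul] at this
        rw [this]
        ring
      have d1 := differentiableAt_of_smooth h.isOpen (smooth_leeForm h.left l) hy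
      have d2 := differentiableAt_of_smooth h.isOpen (smooth_mulVec sJI.transpose hps l) hy
      simp only [pdV, Pi.sub_apply, Pi.smul_apply, smul_eq_mul]
      rw [pd_congr_on h.isOpen e0 hy, pd_sub (d1.const_mul 4) (d2.const_mul 2),
        pd_const_mul d1, pd_const_mul d2]
    have e1 : pdV k p y = B k + (chrM G k y)ᵀ *ᵥ p y := by
      rw [hB, covHess_row]; simp [hp]
    rw [e, pdV_mulVec sJI.transpose hps h.isOpen hy, pdM_transpose, e1]
    simp only [Matrix.mulVec_add, Matrix.add_mulVec, ← Matrix.mulVec_mulVec]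
    module
  have htr : ∀ C : Matrix (Fin m) (Fin m) ℝ, Cᵀ = C →
      ((G y)⁻¹ * C).trace = ∑ k, ((G y)⁻¹ *ᵥ C k) k := by
    intro C hC
    conv_lhs => rw [← hC]
    rfl
  have hlast : ∑ k, ((G y)⁻¹ *ᵥ ((J y * I y)ᵀ *ᵥ B k)) k =
      (1 / 2) * ((I y * J y + J y * I y) * (G y)⁻¹ * B).trace := by
    have k1 := h.left.end_mul_inv hy
    have k2 := h.right.end_mul_inv hy
    have c1 : (G y)⁻¹ * (J y * I y)ᵀ = I y * J y * (G y)⁻¹ := by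
      rw [Matrix.transpose_mul]
      linear_combination (norm := noncomm_ring) -I y * k2 + k1 * (J y)ᵀ
    have c2 : ∑ k, ((G y)⁻¹ *ᵥ ((J y * I y)ᵀ *ᵥ B k)) k = (I y * J y * (G y)⁻¹ * B).trace := by
      conv_rhs => rw [← hBs]
      simp only [Matrix.mulVec_mulVec, c1]
      rfl
    have c3 : (I y * J y * (G y)⁻¹ * B).trace = (J y * I y * (G y)⁻¹ * B).trace := by
      rw [← Matrix.trace_transpose, Matrix.transpose_mul, ← c1, Matrix.transpose_mul,
        h.left.inv_symm hy, hBs, Matrix.transpose_transpose, Matrix.trace_mul_comm]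
    rw [c2, add_mul, add_mul, Matrix.trace_add, ← c3]
    ring
  unfold lapl
  rw [htr _ (h.left.covHess_symm h.smooth_pairVol hy)]
  simp only [hrow, Matrix.mulVec_sub, Matrix.mulVec_smul, Pi.sub_apply, Pi.smul_apply,
    smul_eq_mul, Finset.sum_sub_distrib, ← Finset.mul_sum]
  rw [hlast]
  ring

/-- At a critical point of `log |det [I, J]|`, its evolution is the Laplacian up to a term that
stays bounded even if `[I, J]` degenerates. -/
lemma evolution_pairVol (h : LocalGK V G I J) (hy : y ∈ V)
    (hq : dcov (fun z => pairVol (I z) (J z)) y = 0) :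
    -2 * ((I y * J y - J y * I y)⁻¹ * J y * Matrix.of fun k j =>
        lieEnd (leeField G I) I k j y).trace +
      2 * ((I y * J y - J y * I y)⁻¹ * I y * Matrix.of fun k j =>
        lieEnd (leeField G J) J k j y).trace =
      lapl G (fun z => pairVol (I z) (J z)) y + volError G I J y := by
  have hS := h.inv_comm_mul hy
  have hI := h.left.sq y hy
  have hJ := h.right.sq y hy
  have hS' := mul_eq_one_comm.mp hS
  set p := dcov (fun z => pairPhi (I z) (J z)) y with hp
  have hpθ : (2 : ℝ) • ((I y * J y)ᵀ *ᵥ fun l => leeForm G I l y) = p := by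
    rw [h.leeForm_left hy, hq, smul_zero, add_zero, Matrix.mulVec_smul, smul_smul,
      Matrix.mulVec_mulVec, ← Matrix.transpose_mul,
      show J y * I y * (I y * J y) = J y * (I y * I y) * J y by noncomm_ring, hI, ← hp]
    simp [hJ]
  have k0 := trace_pairVol hI hJ hS
    (L := Matrix.of fun k j => lieEnd (leeField G I) I k j y)
    (L' := Matrix.of fun k j => lieEnd (leeField G J) J k j y)
    (by rw [lieEnd_eq, h.contr_covEnd_left hy]) (by rw [lieEnd_eq, h.contr_covEnd_right hy])
  rw [k0, h.trace_contr_anticomm_inv hy, h.trace_contr_anticomm_inv hy, hq]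
  set P := I y * J y + J y * I y with hP
  set S := (I y * J y - J y * I y)⁻¹ with hSd
  have a1 := inv_comm_anticomm_left hI hS
  have a2 := inv_comm_anticomm_right hJ hS
  have k1 := h.trace_mul_covVec hy (P * S)
  have m1 : P * S * I y = -(I y * (P * S)) := by
    rw [mul_assoc, a1, mul_neg, ← mul_assoc, hP, anticommutator_mul_left hI, mul_assoc]
  have m2 : P * S * J y = -(J y * (P * S)) := by
    rw [mul_assoc, a2, mul_neg, ← mul_assoc, hP, anticommutator_mul_right hJ, mul_assoc]
  have k2 := trace_mul_covariant_comm (h.torsionAlg hy) m1 m2 (h.covEnd_left hy)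
    (h.covEnd_right hy) ((G y)⁻¹ *ᵥ p)
  rw [← hP, h.trace_contr_anticomm_inv hy, hq, hP, anticommutator_sq_mul_inv_comm hI hJ hS,
    ← hP, mul_add, Matrix.trace_add, Matrix.mul_smul, Matrix.trace_smul,
    h.trace_contr_inv hy] at k2
  rw [← hp, k2, mul_assoc P S (I y * J y - J y * I y), hS, mul_one] at k1
  have k3 := h.lapl_pairVol hy hq
  rw [k3]
  simp only [volError, hpθ, dotProduct_zero] at k1 ⊢
  rw [smul_eq_mul] at k1
  linarith

end LocalGK
end Evolution

/-! ### The Bochner formula -/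

section Bochner

variable {m : ℕ} {V : Set (Coord m)} {G : Coord m → Matrix (Fin m) (Fin m) ℝ} {y : Coord m}

lemma pd_dotProduct {v w : Coord m → Fin m → ℝ} (hV : IsOpen V)
    (hv : ∀ i, ContDiffOn ℝ ∞ (fun z => v z i) V) (hw : ∀ i, ContDiffOn ℝ ∞ (fun z => w z i) V)
    (hy : y ∈ V) (l : Fin m) :
    pd l (fun z => v z ⬝ᵥ w z) y = pdV l v y ⬝ᵥ w y + v y ⬝ᵥ pdV l w y := by
  have dv := fun k => differentiableAt_of_smooth hV (hv k) hy
  have dw := fun k => differentiableAt_of_smooth hV (hw k) hy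
  simp only [dotProduct, pdV]
  rw [pd_sum fun k _ => (dv k).fun_mul (dw k), ← Finset.sum_add_distrib]
  exact Finset.sum_congr rfl fun k _ => pd_mul (dv k) (dw k) l

lemma smooth_dotProduct {E : Type*} [NormedAddCommGroup E] [NormedSpace ℝ E] {U : Set E}
    {v w : E → Fin m → ℝ}
    (hv : ∀ i, ContDiffOn ℝ ∞ (fun z => v z i) U) (hw : ∀ i, ContDiffOn ℝ ∞ (fun z => w z i) U) :
    ContDiffOn ℝ ∞ (fun z => v z ⬝ᵥ w z) U :=
  ContDiffOn.sum fun k _ => (hv k).mul (hw k)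

lemma LocalMetric.smooth_christoffel (h : LocalMetric V G) (k i j : Fin m) :
    ContDiffOn ℝ ∞ (christoffel G k i j) V :=
  contDiffOn_const.mul (ContDiffOn.sum fun l _ => (h.smooth_inv k l).mul
    (((pd_smooth h.isOpen (h.smooth j l) i).add (pd_smooth h.isOpen (h.smooth i l) j)).sub
      (pd_smooth h.isOpen (h.smooth i j) l)))

lemma LocalMetric.smooth_chrM (h : LocalMetric V G) (a : Fin m) : SmoothMat (chrM G a) V :=
  fun k j => h.smooth_christoffel k a j

lemma LocalMetric.smooth_covHess (h : LocalMetric V G) {f : Coord m → ℝ}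
    (hf : ContDiffOn ℝ ∞ f V) : SmoothMat (covHess G f) V := fun l k =>
  (pd_smooth h.isOpen (pd_smooth h.isOpen hf k) l).sub
    (ContDiffOn.sum fun c _ => (h.smooth_christoffel c l k).mul (pd_smooth h.isOpen hf c))

/-- The curvature endomorphisms `R(∂_l, ∂_j)`. -/
def curvM (G : Coord m → Matrix (Fin m) (Fin m) ℝ) (l j : Fin m) (y : Coord m) :
    Matrix (Fin m) (Fin m) ℝ :=
  pdM l (chrM G j) y - pdM j (chrM G l) y + chrM G l y * chrM G j y - chrM G j y * chrM G l y

lemma ricci_eq (G : Coord m → Matrix (Fin m) (Fin m) ℝ) (j k : Fin m) (y : Coord m) :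
    ricci G j k y = ∑ l, curvM G l j y l k := by
  refine Finset.sum_congr rfl fun l _ => ?_
  simp only [curvM, Matrix.sub_apply, Matrix.add_apply, Matrix.mul_apply, pdM, chrM,
    Matrix.of_apply, Finset.sum_sub_distrib]
  ring

/-- The curvature endomorphisms are skew, since second derivatives of the metric commute. -/
lemma LocalMetric.curvM_skew (h : LocalMetric V G) (hy : y ∈ V) (l j : Fin m) :
    (curvM G l j y)ᵀ * G y = -(G y * curvM G l j y) := by
  have e : ∀ l j, pdM l (pdM j G) y = (pdM l (chrM G j) y)ᵀ * G y +
      (chrM G j y)ᵀ * ((chrM G l y)ᵀ * G y + G y * chrM G l y) +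
      (((chrM G l y)ᵀ * G y + G y * chrM G l y) * chrM G j y + G y * pdM l (chrM G j) y) := by
    intro l j
    have sΓ := h.smooth_chrM j
    rw [pdM_congr_on h.isOpen (fun z hz => h.pdM_metric hz j) hy,
      pdM_add (sΓ.transpose.mul h.smooth) (h.smooth.mul sΓ) h.isOpen hy,
      pdM_mul sΓ.transpose h.smooth h.isOpen hy, pdM_mul h.smooth sΓ h.isOpen hy,
      pdM_transpose, h.pdM_metric hy]
  have sy : pdM l (pdM j G) y = pdM j (pdM l G) y := by
    ext a b
    exact pd_comm h.isOpen (h.smooth a b) hy l j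
  rw [e, e] at sy
  simp only [curvM, Matrix.transpose_sub, Matrix.transpose_add, Matrix.transpose_mul]
  linear_combination (norm := noncomm_ring) sy

/-- The squared norm of the gradient in coordinates. -/
def gradNormSq (G : Coord m → Matrix (Fin m) (Fin m) ℝ) (f : Coord m → ℝ) (y : Coord m) : ℝ :=
  ((G y)⁻¹ *ᵥ dcov f y) ⬝ᵥ dcov f y

/-- The third covariant derivative `∇_l ∇_k df`, as a covector. -/
def covThird (G : Coord m → Matrix (Fin m) (Fin m) ℝ) (f : Coord m → ℝ) (y : Coord m)
    (l k : Fin m) : Fin m → ℝ :=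
  pdV l (fun z => covHess G f z k) y - (chrM G l y)ᵀ *ᵥ covHess G f y k -
    ∑ c, christoffel G c l k y • covHess G f y c

namespace LocalMetric

variable {f : Coord m → ℝ}

lemma covThird_symm (h : LocalMetric V G) (hf : ContDiffOn ℝ ∞ f V) (hy : y ∈ V)
    (l k j : Fin m) : covThird G f y l k j = covThird G f y l j k := by
  have hs : ∀ z ∈ V, ∀ a b, covHess G f z a b = covHess G f z b a := fun z hz a b =>
    congrFun (congrFun (h.covHess_symm hf hz) b) a
  simp only [covThird, Pi.sub_apply, pdV, Finset.sum_apply, Pi.smul_apply, smul_eq_mul,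
    Matrix.mulVec, dotProduct, Matrix.transpose_apply, chrM, Matrix.of_apply]
  rw [pd_congr_on h.isOpen (fun z hz => hs z hz k j) hy]
  simp only [hs y hy k, hs y hy j]
  simp only [fun c => hs y hy c j, fun c => hs y hy c k]
  ring

/-- The Ricci identity for the differential of a function. -/
lemma covThird_comm (h : LocalMetric V G) (hf : ContDiffOn ℝ ∞ f V) (hy : y ∈ V) (l j : Fin m) :
    covThird G f y l j - covThird G f y j l = -((curvM G l j y)ᵀ *ᵥ dcov f y) := by
  have hp := smooth_dcov h.isOpen hf
  have e : ∀ l j, pdV l (fun z => covHess G f z j) y = pdV l (pdV j (dcov f)) y -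
      ((pdM l (chrM G j) y)ᵀ *ᵥ dcov f y + (chrM G j y)ᵀ *ᵥ pdV l (dcov f) y) := by
    intro l j
    have sΓ := (h.smooth_chrM j).transpose
    rw [← pdM_transpose, ← pdV_mulVec sΓ hp h.isOpen hy]
    funext i
    simp only [pdV, Pi.sub_apply]
    rw [← pd_sub (differentiableAt_of_smooth h.isOpen
      (pd_smooth h.isOpen (hp i) j) hy)
      (differentiableAt_of_smooth h.isOpen (smooth_mulVec sΓ hp i) hy)]
    simp only [covHess_row]
    rfl
  have sy : pdV l (pdV j (dcov f)) y = pdV j (pdV l (dcov f)) y := by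
    funext i
    exact pd_comm h.isOpen (hp i) hy l j
  have sΓ : ∑ c, christoffel G c l j y • covHess G f y c =
      ∑ c, christoffel G c j l y • covHess G f y c := by
    simp only [h.christoffel_symm hy _ l j]
  unfold covThird
  rw [e, e, sy, sΓ, covHess_row G f y j, covHess_row G f y l]
  simp only [curvM, Matrix.transpose_sub, Matrix.transpose_add, Matrix.transpose_mul,
    Matrix.add_mulVec, Matrix.sub_mulVec, Matrix.mulVec_sub, ← Matrix.mulVec_mulVec]
  abel

/-- The differential of `Δf` is the trace of `∇³f` in the last two indices, as the connection is
metric. -/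
lemma pd_lapl (h : LocalMetric V G) (hf : ContDiffOn ℝ ∞ f V) (hy : y ∈ V) (j : Fin m) :
    pd j (lapl G f) y = ∑ l, ∑ k, (G y)⁻¹ l k * covThird G f y j l k := by
  have sB := h.smooth_covHess hf
  have sN := h.smooth_inv
  have e1 : pd j (lapl G f) y = (pdM j (fun z => (G z)⁻¹ * covHess G f z) y).trace := by
    simp only [Matrix.trace, Matrix.diag_apply, pdM, Matrix.of_apply]
    rw [← pd_sum fun i _ => (sN.mul sB).diff h.isOpen hy i i]
    rfl
  have e2 : ∀ l, covThird G f y j l = (pdM j (covHess G f) y - covHess G f y * chrM G j y -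
      (chrM G j y)ᵀ * covHess G f y) l := by
    intro l
    funext k
    simp only [covThird, Pi.sub_apply, Matrix.sub_apply, Matrix.mul_apply, pdV, pdM,
      Matrix.of_apply, Matrix.mulVec, dotProduct, Matrix.transpose_apply, Finset.sum_apply,
      Pi.smul_apply, smul_eq_mul, chrM]
    congr 2
    exact Finset.sum_congr rfl fun c _ => mul_comm _ _
  rw [e1, pdM_mul sN sB h.isOpen hy, h.pdM_inv_metric hy]
  set N := (G y)⁻¹
  set B := covHess G f y
  set K := chrM G j y
  have e3 : (-(K * N + N * Kᵀ) * B + N * pdM j (covHess G f) y).trace =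
      (N * (pdM j (covHess G f) y - B * K - Kᵀ * B)).trace := by
    have : (K * N * B).trace = (N * (B * K)).trace := by
      rw [mul_assoc, Matrix.trace_mul_comm, mul_assoc]
    simp only [mul_sub, neg_mul, add_mul, Matrix.trace_add, Matrix.trace_sub, Matrix.trace_neg,
      this, ← mul_assoc]
    ring
  have hNs : ∀ a b, N a b = N b a := fun a b => congrFun (congrFun (h.inv_symm hy) b) a
  rw [e3, Matrix.trace, Finset.sum_comm]
  refine Finset.sum_congr rfl fun l _ => ?_
  rw [Matrix.diag_apply, Matrix.mul_apply]
  refine Finset.sum_congr rfl fun k _ => ?_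
  rw [e2, hNs]

/-- `∇_k |∇f|² = 2 ∇²f(∂_k, ∇f)`. -/
lemma pd_gradNormSq (h : LocalMetric V G) (hf : ContDiffOn ℝ ∞ f V) (hy : y ∈ V) (k : Fin m) :
    pd k (gradNormSq G f) y = 2 * (((G y)⁻¹ *ᵥ dcov f y) ⬝ᵥ covHess G f y k) := by
  have hp := smooth_dcov h.isOpen hf
  unfold gradNormSq
  rw [pd_dotProduct h.isOpen (smooth_mulVec h.smooth_inv hp) hp hy,
    pdV_mulVec h.smooth_inv hp h.isOpen hy, h.pdM_inv_metric hy, covHess_row]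
  have hN : ∀ v w : Fin m → ℝ, ((G y)⁻¹ *ᵥ v) ⬝ᵥ w = ((G y)⁻¹ *ᵥ w) ⬝ᵥ v := by
    intro v w
    rw [dotProduct_comm, dotProduct_mulVec_transpose, h.inv_symm hy, dotProduct_comm]
  have hK : ∀ v w : Fin m → ℝ, (chrM G k y *ᵥ v) ⬝ᵥ w = v ⬝ᵥ ((chrM G k y)ᵀ *ᵥ w) := by
    intro v w
    rw [dotProduct_comm, dotProduct_mulVec_transpose]
  simp only [Matrix.neg_mulVec, Matrix.add_mulVec, neg_dotProduct, add_dotProduct,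
    dotProduct_sub, ← Matrix.mulVec_mulVec, hK]
  rw [hN ((chrM G k y)ᵀ *ᵥ dcov f y), hN (pdV k (dcov f) y)]
  ring

/-- `∇_l ∇_k |∇f|² = 2 ⟨∇_l df, ∇_k df⟩ + 2 (∇_l ∇_k df)(∇f)`. -/
lemma covHess_gradNormSq (h : LocalMetric V G) (hf : ContDiffOn ℝ ∞ f V) (hy : y ∈ V)
    (l k : Fin m) : covHess G (gradNormSq G f) y l k =
      2 * (((G y)⁻¹ *ᵥ covHess G f y l) ⬝ᵥ covHess G f y k) +
      2 * (((G y)⁻¹ *ᵥ dcov f y) ⬝ᵥ covThird G f y l k) := by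
  have hp := smooth_dcov h.isOpen hf
  have sB := h.smooth_covHess hf
  have sZ := smooth_mulVec h.smooth_inv hp
  have e : pd l (pd k (gradNormSq G f)) y = 2 * (((G y)⁻¹ *ᵥ covHess G f y l -
      chrM G l y *ᵥ ((G y)⁻¹ *ᵥ dcov f y)) ⬝ᵥ covHess G f y k +
        ((G y)⁻¹ *ᵥ dcov f y) ⬝ᵥ pdV l (fun z => covHess G f z k) y) := by
    rw [pd_congr_on h.isOpen (fun z hz => h.pd_gradNormSq hf hz k) hy,
      pd_const_mul (differentiableAt_of_smooth h.isOpen (smooth_dotProduct sZ (sB k)) hy),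
      pd_dotProduct h.isOpen sZ (sB k) hy, pdV_mulVec h.smooth_inv hp h.isOpen hy,
      h.pdM_inv_metric hy, covHess_row G f y l]
    congr 3
    simp only [Matrix.neg_mulVec, Matrix.add_mulVec, Matrix.mulVec_sub, ← Matrix.mulVec_mulVec]
    abel
  have hK : ∀ v w : Fin m → ℝ, (chrM G l y *ᵥ v) ⬝ᵥ w = v ⬝ᵥ ((chrM G l y)ᵀ *ᵥ w) := by
    intro v w
    rw [dotProduct_comm, dotProduct_mulVec_transpose]
  rw [covHess, Matrix.of_apply, e]
  simp only [h.pd_gradNormSq hf hy, covThird, dotProduct_sub, sub_dotProduct, hK,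
    dotProduct_sum, dotProduct_smul, smul_eq_mul]
  have : ∑ c, christoffel G c l k y * (2 * ((G y)⁻¹ *ᵥ dcov f y ⬝ᵥ covHess G f y c)) =
      2 * ∑ c, christoffel G c l k y * ((G y)⁻¹ *ᵥ dcov f y ⬝ᵥ covHess G f y c) := by
    rw [Finset.mul_sum]
    exact Finset.sum_congr rfl fun c _ => by ring
  rw [this]
  ring

/-- Bochner's formula. -/
lemma bochner (h : LocalMetric V G) (hf : ContDiffOn ℝ ∞ f V) (hy : y ∈ V) :
    lapl G (gradNormSq G f) y =
      2 * ((G y)⁻¹ * covHess G f y * (G y)⁻¹ * (covHess G f y)ᵀ).trace +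
      2 * (((G y)⁻¹ *ᵥ dcov f y) ⬝ᵥ dcov (lapl G f) y) +
      2 * ∑ j, ∑ k, ricci G j k y * ((G y)⁻¹ *ᵥ dcov f y) j * ((G y)⁻¹ *ᵥ dcov f y) k := by
  set N := (G y)⁻¹ with hN
  set Z := N *ᵥ dcov f y with hZ
  have hNs : ∀ a b, N a b = N b a := fun a b => congrFun (congrFun (h.inv_symm hy) b) a
  have e1 : lapl G (gradNormSq G f) y =
      ∑ l, ∑ k, N l k * covHess G (gradNormSq G f) y l k := by
    rw [lapl, Matrix.trace, Finset.sum_comm]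
    refine Finset.sum_congr rfl fun l _ => ?_
    rw [Matrix.diag_apply, Matrix.mul_apply]
    exact Finset.sum_congr rfl fun k _ => by rw [← hN, hNs]
  have e2 : ∑ l, ∑ k, N l k * ((N *ᵥ covHess G f y l) ⬝ᵥ covHess G f y k) =
      (N * covHess G f y * N * (covHess G f y)ᵀ).trace := by
    have : ∀ l k, (N *ᵥ covHess G f y l) ⬝ᵥ covHess G f y k =
        (covHess G f y * N * (covHess G f y)ᵀ) k l := by
      intro l k
      rw [dotProduct_comm, mul_assoc]
      rfl
    simp only [this]
    rw [show N * covHess G f y * N * (covHess G f y)ᵀ =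
      N * (covHess G f y * N * (covHess G f y)ᵀ) by noncomm_ring]
    rfl
  have e3 : ∑ l, ∑ k, N l k * (Z ⬝ᵥ covThird G f y l k) =
      Z ⬝ᵥ dcov (lapl G f) y + ∑ j, ∑ k, ricci G j k y * Z j * Z k := by
    have c1 : ∀ l k j, covThird G f y l k j =
        covThird G f y j l k + (G y *ᵥ (curvM G l j y *ᵥ Z)) k := by
      intro l k j
      have t := congrFun (h.covThird_comm hf hy l j) k
      have hGZ : dcov f y = G y *ᵥ Z := by
        rw [hZ, Matrix.mulVec_mulVec, h.mul_inv hy, Matrix.one_mulVec]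
      rw [hGZ, Matrix.mulVec_mulVec, h.curvM_skew hy, Matrix.neg_mulVec, neg_neg,
        ← Matrix.mulVec_mulVec, Pi.sub_apply] at t
      rw [h.covThird_symm hf hy, ← t]
      ring
    have c2 : ∀ l j, ∑ k, N l k * (G y *ᵥ (curvM G l j y *ᵥ Z)) k = (curvM G l j y *ᵥ Z) l := by
      intro l j
      have : N *ᵥ (G y *ᵥ (curvM G l j y *ᵥ Z)) = curvM G l j y *ᵥ Z := by
        rw [Matrix.mulVec_mulVec, h.inv_mul hy, Matrix.one_mulVec]
      exact congrFun this l
    have c3 : ∑ l, ∑ k, N l k * (Z ⬝ᵥ covThird G f y l k) =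
        ∑ l, ∑ k, ∑ j, Z j * (N l k * covThird G f y l k j) := by
      refine Finset.sum_congr rfl fun l _ => Finset.sum_congr rfl fun k _ => ?_
      rw [dotProduct, Finset.mul_sum]
      exact Finset.sum_congr rfl fun j _ => by ring
    rw [c3, ← sum_rotate, dotProduct, ← Finset.sum_add_distrib]
    refine Finset.sum_congr rfl fun j _ => ?_
    rw [dcov, h.pd_lapl hf hy]
    have c4 : ∑ l, ∑ k, Z j * (N l k * covThird G f y l k j) =
        ∑ l, ∑ k, (Z j * (N l k * covThird G f y j l k) +
          Z j * (N l k * (G y *ᵥ (curvM G l j y *ᵥ Z)) k)) :=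
      Finset.sum_congr rfl fun l _ => Finset.sum_congr rfl fun k _ => by rw [c1]; ring
    rw [c4]
    simp only [Finset.sum_add_distrib, ← Finset.mul_sum, c2, ricci_eq]
    congr 1
    simp only [Matrix.mulVec, dotProduct, Finset.mul_sum, Finset.sum_mul]
    rw [Finset.sum_comm]
    exact Finset.sum_congr rfl fun k _ => Finset.sum_congr rfl fun l _ => by ring
  rw [e1]
  simp only [h.covHess_gradNormSq hf hy, mul_add, Finset.sum_add_distrib]
  rw [← hN, ← hZ, ← e2]
  have e4 : ∀ F : Fin m → Fin m → ℝ, ∑ l, ∑ k, N l k * (2 * F l k) =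
      2 * ∑ l, ∑ k, N l k * F l k := by
    intro F
    simp only [Finset.mul_sum]
    exact Finset.sum_congr rfl fun l _ => Finset.sum_congr rfl fun k _ => by ring
  rw [e4, e4, e3]
  ring

end LocalMetric

lemma posSemidef_eq_transpose_mul {N : Matrix (Fin m) (Fin m) ℝ} (hN : N.PosSemidef) :
    ∃ (r : ℕ) (C : Matrix (Fin r) (Fin m) ℝ), N = Cᵀ * C := by
  obtain ⟨r, w, hw⟩ := Matrix.posSemidef_iff_eq_sum_vecMulVec.mp hN
  refine ⟨r, Matrix.of fun i a => w i a, ?_⟩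
  rw [hw]
  ext a b
  simp [Matrix.sum_apply, Matrix.vecMulVec_apply, Matrix.mul_apply]

/-- `tr (N K N Kᵀ) ≥ 0` for positive semidefinite `N`. -/
lemma trace_conj_nonneg {N : Matrix (Fin m) (Fin m) ℝ} (hN : N.PosSemidef)
    (K : Matrix (Fin m) (Fin m) ℝ) : 0 ≤ (N * K * N * Kᵀ).trace := by
  obtain ⟨r, C, hC⟩ := posSemidef_eq_transpose_mul hN
  have e : (N * K * N * Kᵀ).trace = ((C * K * Cᵀ) * (C * K * Cᵀ)ᵀ).trace := by
    rw [hC, show Cᵀ * C * K * (Cᵀ * C) * Kᵀ = Cᵀ * (C * K * (Cᵀ * C) * Kᵀ) by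
      simp only [Matrix.mul_assoc], Matrix.trace_mul_comm]
    simp only [Matrix.transpose_mul, Matrix.transpose_transpose, Matrix.mul_assoc]
  rw [e]
  have := (Matrix.posSemidef_self_mul_conjTranspose (C * K * Cᵀ)).trace_nonneg
  rwa [Matrix.conjTranspose_eq_transpose_of_trivial] at this

/-- `𝓗(Z, Z) ≥ 0`. -/
lemma torsionSq_nonneg {H : FormField m 3} (hN : ((G y)⁻¹).PosSemidef) (Z : Fin m → ℝ) :
    0 ≤ ∑ i, ∑ j, torsionSq G H i j y * Z i * Z j := by
  set K : Matrix (Fin m) (Fin m) ℝ := Matrix.of fun a b => ∑ i, Z i * H y ![i, a, b] with hK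
  have hs : ∀ a b, (G y)⁻¹ a b = (G y)⁻¹ b a := fun a b => by
    simpa using (hN.isHermitian.apply a b).symm
  have e : ∑ i, ∑ j, torsionSq G H i j y * Z i * Z j =
      ((G y)⁻¹ * K * (G y)⁻¹ * Kᵀ).trace := by
    have e1 : ((G y)⁻¹ * K * (G y)⁻¹ * Kᵀ).trace =
        ∑ a, ∑ b, ∑ c, ∑ d, (G y)⁻¹ a c * (G y)⁻¹ b d * K a b * K c d := by
      rw [Matrix.trace]
      refine Finset.sum_congr rfl fun a _ => ?_
      rw [Matrix.diag_apply, Matrix.mul_apply]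
      refine Finset.sum_congr rfl fun b _ => ?_
      simp only [Matrix.mul_apply, Matrix.transpose_apply, Finset.sum_mul]
      rw [Finset.sum_comm]
      exact Finset.sum_congr rfl fun c _ => Finset.sum_congr rfl fun d _ => by
        rw [hs d b]; ring
    rw [e1]
    simp only [torsionSq, Finset.sum_mul]
    rw [← sum_rotate]
    refine Finset.sum_congr rfl fun a _ => ?_
    rw [← sum_rotate]
    refine Finset.sum_congr rfl fun b _ => ?_
    rw [← sum_rotate]
    refine Finset.sum_congr rfl fun c _ => ?_
    rw [← sum_rotate]
    refine Finset.sum_congr rfl fun d _ => ?_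
    rw [hK, Matrix.of_apply, Matrix.of_apply, mul_assoc _ (∑ i, _), Finset.sum_mul_sum,
      Finset.mul_sum]
    refine Finset.sum_congr rfl fun i _ => ?_
    rw [Finset.mul_sum]
    exact Finset.sum_congr rfl fun j _ => by ring
  rw [e]
  exact trace_conj_nonneg hN K

end Bochner

/-! ### The maximum principle at a point -/

section Spacetime

variable {m : ℕ} {V : Set (Coord m)} {G : Coord m → Matrix (Fin m) (Fin m) ℝ} {y : Coord m}

lemma fderiv_eq_sum_pd (f : Coord m → ℝ) (y v : Coord m) :
    fderiv ℝ f y v = ∑ k, v k * pd k f y := by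
  have hv : v = ∑ k, v k • EuclideanSpace.single k (1 : ℝ) := by
    ext i
    simp [Finset.sum_apply, Pi.single_apply]
  conv_lhs => rw [hv]
  simp [pd, map_sum]

lemma hasDerivAt_comp_line {f : Coord m → ℝ} {y v : Coord m} {s : ℝ}
    (hf : DifferentiableAt ℝ f (y + s • v)) :
    HasDerivAt (fun s : ℝ => f (y + s • v)) (∑ k, v k * pd k f (y + s • v)) s := by
  have hl : HasDerivAt (fun s : ℝ => y + s • v) v s := by
    simpa using ((hasDerivAt_id s).smul_const v).const_add y
  rw [← fderiv_eq_sum_pd]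
  exact hf.hasFDerivAt.comp_hasDerivAt s hl

/-- The second derivatives of a smooth function are nonpositive in all directions at a local
maximum. -/
lemma second_deriv_nonpos_of_isLocalMax {f : Coord m → ℝ} (hV : IsOpen V)
    (hf : ContDiffOn ℝ ∞ f V) (hy : y ∈ V) (hmax : IsLocalMax f y) (v : Coord m) :
    ∑ k, v k * ∑ l, v l * pd l (pd k f) y ≤ 0 := by
  by_contra! hpos
  set φ : ℝ → ℝ := fun s => f (y + s • v) with hφ
  have hc : Continuous fun s : ℝ => y + s • v := by fun_prop
  have hc0 : Filter.Tendsto (fun s : ℝ => y + s • v) (nhds 0) (nhds y) := by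
    have := hc.tendsto 0
    simpa using this
  have hV0 : ∀ᶠ s in nhds (0 : ℝ), y + s • v ∈ V := hc0.eventually (hV.mem_nhds hy)
  have d1 : ∀ᶠ s in nhds (0 : ℝ), deriv φ s = ∑ k, v k * pd k f (y + s • v) :=
    hV0.mono fun s hs => (hasDerivAt_comp_line (differentiableAt_of_smooth hV hf hs)).deriv
  have d2 : HasDerivAt (fun s : ℝ => ∑ k, v k * pd k f (y + s • v))
      (∑ k, v k * ∑ l, v l * pd l (pd k f) y) 0 := by
    refine HasDerivAt.fun_sum fun k _ => HasDerivAt.const_mul _ ?_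
    have := hasDerivAt_comp_line (f := pd k f) (y := y) (v := v) (s := 0)
      (differentiableAt_of_smooth hV (pd_smooth hV hf k) (by simpa using hy))
    simpa using this
  have d3 : deriv (deriv φ) 0 = ∑ k, v k * ∑ l, v l * pd l (pd k f) y := by
    rw [Filter.EventuallyEq.deriv_eq d1, d2.deriv]
  have hm : ∀ᶠ s in nhds (0 : ℝ), φ s ≤ φ 0 := by
    have : ∀ᶠ s in nhds (0 : ℝ), f (y + s • v) ≤ f y := hc0.eventually hmax
    exact this.mono fun s hs => by simpa [hφ] using hs
  have hc1 : ContinuousAt φ 0 := by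
    refine ContinuousAt.comp (f := fun s : ℝ => y + s • v) (g := f) ?_ hc.continuousAt
    simpa using (differentiableAt_of_smooth hV hf hy).continuousAt
  have hmin : IsLocalMin φ 0 := isLocalMin_of_deriv_deriv_pos (by rw [d3]; exact hpos)
    (IsLocalMax.deriv_eq_zero hm) hc1
  -- a strictly convex local maximum would be a local minimum as well, hence locally constant
  have hconst : φ =ᶠ[nhds 0] fun _ => φ 0 := by
    filter_upwards [hm, hmin] with s h1 h2 using le_antisymm h1 h2
  have h0 : deriv (deriv φ) 0 = 0 := by
    rw [hconst.deriv.deriv_eq]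
    simp
  linarith

/-- At a local maximum the differential vanishes and the Laplacian is nonpositive. -/
lemma LocalMetric.lapl_nonpos_of_isLocalMax (h : LocalMetric V G) (hN : ((G y)⁻¹).PosSemidef)
    {f : Coord m → ℝ} (hf : ContDiffOn ℝ ∞ f V) (hy : y ∈ V) (hmax : IsLocalMax f y) :
    dcov f y = 0 ∧ lapl G f y ≤ 0 := by
  have h0 : dcov f y = 0 := by
    funext a
    simp [dcov, pd, hmax.fderiv_eq_zero]
  refine ⟨h0, ?_⟩
  obtain ⟨r, C, hC⟩ := posSemidef_eq_transpose_mul hN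
  have e : lapl G f y = ∑ i, ∑ k, C i k * ∑ l, C i l * pd l (pd k f) y := by
    have hh : covHess G f y = Matrix.of fun l k => pd l (pd k f) y := by
      ext l k
      have : ∀ c, pd c f y = 0 := fun c => congrFun h0 c
      simp [covHess, this]
    rw [lapl, hC, hh, Matrix.mul_assoc, Matrix.trace_mul_comm]
    simp only [Matrix.trace, Matrix.diag_apply, Matrix.mul_apply, Matrix.of_apply,
      Matrix.transpose_apply]
    refine Finset.sum_congr rfl fun i _ => Finset.sum_congr rfl fun k _ => mul_comm _ _
  rw [e]
  exact Finset.sum_nonpos fun i _ =>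
    second_deriv_nonpos_of_isLocalMax h.isOpen hf hy hmax (WithLp.toLp 2 (C i))

lemma LocalMetric.lapl_add (h : LocalMetric V G) {f f' : Coord m → ℝ}
    (hf : ContDiffOn ℝ ∞ f V) (hf' : ContDiffOn ℝ ∞ f' V) (hy : y ∈ V) :
    lapl G (fun z => f z + f' z) y = lapl G f y + lapl G f' y := by
  have h1 : ∀ i, ∀ z ∈ V, pd i (fun z => f z + f' z) z = pd i f z + pd i f' z := fun i z hz =>
    pd_add (differentiableAt_of_smooth h.isOpen hf hz)
      (differentiableAt_of_smooth h.isOpen hf' hz) i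
  have e : covHess G (fun z => f z + f' z) y = covHess G f y + covHess G f' y := by
    ext l k
    simp only [covHess, Matrix.of_apply, Matrix.add_apply, h1 _ y hy]
    rw [pd_congr_on h.isOpen (h1 k) hy, pd_add
      (differentiableAt_of_smooth h.isOpen (pd_smooth h.isOpen hf k) hy)
      (differentiableAt_of_smooth h.isOpen (pd_smooth h.isOpen hf' k) hy)]
    simp only [mul_add, Finset.sum_add_distrib]
    ring
  rw [lapl, e, mul_add, Matrix.trace_add, lapl, lapl]

lemma LocalMetric.lapl_const_mul (h : LocalMetric V G) (c : ℝ) {f : Coord m → ℝ}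
    (hf : ContDiffOn ℝ ∞ f V) (hy : y ∈ V) :
    lapl G (fun z => c * f z) y = c * lapl G f y := by
  have h1 : ∀ i, ∀ z ∈ V, pd i (fun z => c * f z) z = c * pd i f z := fun i z hz =>
    pd_const_mul (differentiableAt_of_smooth h.isOpen hf hz) c i
  have e : covHess G (fun z => c * f z) y = c • covHess G f y := by
    ext l k
    simp only [covHess, Matrix.of_apply, Matrix.smul_apply, h1 _ y hy, smul_eq_mul]
    rw [pd_congr_on h.isOpen (h1 k) hy, pd_const_mul
      (differentiableAt_of_smooth h.isOpen (pd_smooth h.isOpen hf k) hy)]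
    rw [mul_sub, Finset.mul_sum]
    exact congrArg _ (Finset.sum_congr rfl fun c _ => by ring)
  rw [lapl, e, Matrix.mul_smul, Matrix.trace_smul, smul_eq_mul, lapl]

/-- `Δ f² = 2 f Δf + 2 |∇f|²`. -/
lemma LocalMetric.lapl_sq (h : LocalMetric V G) {f : Coord m → ℝ}
    (hf : ContDiffOn ℝ ∞ f V) (hy : y ∈ V) :
    lapl G (fun z => f z ^ 2) y = 2 * f y * lapl G f y + 2 * gradNormSq G f y := by
  have df := fun z hz => differentiableAt_of_smooth (y := z) h.isOpen hf hz
  have h1 : ∀ i, ∀ z ∈ V, pd i (fun z => f z ^ 2) z = 2 * (f z * pd i f z) := fun i z hz => by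
    rw [show (fun z => f z ^ 2) = fun z => f z * f z from funext fun z => sq _,
      pd_mul (df z hz) (df z hz)]
    ring
  have e : covHess G (fun z => f z ^ 2) y =
      (2 * f y) • covHess G f y + (2 : ℝ) • Matrix.vecMulVec (dcov f y) (dcov f y) := by
    ext l k
    have d2 := differentiableAt_of_smooth h.isOpen (pd_smooth h.isOpen hf k) hy
    simp only [covHess, Matrix.of_apply, Matrix.smul_apply, Matrix.add_apply, h1 _ y hy,
      smul_eq_mul, Matrix.vecMulVec_apply, dcov]
    rw [pd_congr_on h.isOpen (h1 k) hy, pd_const_mul ((df y hy).fun_mul d2),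
      pd_mul (df y hy) d2, mul_sub, Finset.mul_sum,
      Finset.sum_congr rfl fun c _ => show christoffel G c l k y * (2 * (f y * pd c f y)) =
        2 * f y * (christoffel G c l k y * pd c f y) by ring]
    ring
  rw [lapl, e, mul_add, Matrix.trace_add, Matrix.mul_smul, Matrix.trace_smul, Matrix.mul_smul,
    Matrix.trace_smul, Matrix.mul_vecMulVec, Matrix.trace_vecMulVec, lapl, gradNormSq, smul_eq_mul,
    smul_eq_mul]

/-! ### Families of functions depending on time -/

/-- Joint smoothness of a family of functions on a subset of space-time. -/
def SmoothFam (F : ℝ → Coord m → ℝ) (Ω : Set (ℝ × Coord m)) : Prop :=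
  ContDiffOn ℝ ∞ (fun p : ℝ × Coord m => F p.1 p.2) Ω

variable {Ω : Set (ℝ × Coord m)} {F F' : ℝ → Coord m → ℝ} {t : ℝ}

namespace SmoothFam

lemma differentiableAt (hF : SmoothFam F Ω) (hΩ : IsOpen Ω) (hp : (t, y) ∈ Ω) :
    DifferentiableAt ℝ (fun p : ℝ × Coord m => F p.1 p.2) (t, y) :=
  (hF.contDiffAt (hΩ.mem_nhds hp)).differentiableAt (by simp)

lemma slice (hF : SmoothFam F Ω) (hV : ∀ z ∈ V, (t, z) ∈ Ω) : ContDiffOn ℝ ∞ (F t) V :=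
  ContDiffOn.comp (g := fun p : ℝ × Coord m => F p.1 p.2) (f := fun z => (t, z)) hF
    (contDiff_prodMk_right t).contDiffOn hV

lemma pd_eq (hF : SmoothFam F Ω) (hΩ : IsOpen Ω) (hp : (t, y) ∈ Ω) (i : Fin m) :
    pd i (F t) y = fderiv ℝ (fun p : ℝ × Coord m => F p.1 p.2) (t, y)
      (0, EuclideanSpace.single i 1) := by
  have h1 : HasFDerivAt (fun z : Coord m => ((t, z) : ℝ × Coord m))
      (ContinuousLinearMap.inr ℝ ℝ (Coord m)) y := hasFDerivAt_prodMk_right t y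
  have := (HasFDerivAt.comp (g := fun p : ℝ × Coord m => F p.1 p.2) y
    (hF.differentiableAt hΩ hp).hasFDerivAt h1).fderiv
  rw [pd, show F t = (fun p : ℝ × Coord m => F p.1 p.2) ∘ fun z => (t, z) from rfl, this]
  simp

lemma hasDerivAt_time (hF : SmoothFam F Ω) (hΩ : IsOpen Ω) (hp : (t, y) ∈ Ω) :
    HasDerivAt (fun s => F s y)
      (fderiv ℝ (fun p : ℝ × Coord m => F p.1 p.2) (t, y) (1, 0)) t := by
  have h1 : HasDerivAt (fun s : ℝ => ((s, y) : ℝ × Coord m)) (1, 0) t :=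
    (hasDerivAt_id t).prodMk (hasDerivAt_const t y)
  exact HasFDerivAt.comp_hasDerivAt (l := fun p : ℝ × Coord m => F p.1 p.2) t
    (hF.differentiableAt hΩ hp).hasFDerivAt h1

lemma pd (hF : SmoothFam F Ω) (hΩ : IsOpen Ω) (i : Fin m) :
    SmoothFam (fun s z => pd i (F s) z) Ω :=
  ContDiffOn.congr ((hF.fderiv_of_isOpen hΩ (by simp)).clm_apply contDiffOn_const)
    fun p hp => hF.pd_eq hΩ (t := p.1) (y := p.2) hp i

/-- Time derivatives commute with partial derivatives. -/
lemma hasDerivAt_pd (hF : SmoothFam F Ω) (hΩ : IsOpen Ω)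
    (hF' : ∀ p ∈ Ω, HasDerivAt (fun s => F s p.2) (F' p.1 p.2) p.1) (hp : (t, y) ∈ Ω)
    (i : Fin m) : HasDerivAt (fun s => GenKahler.pd i (F s) y) (GenKahler.pd i (F' t) y) t := by
  set f := fun p : ℝ × Coord m => F p.1 p.2 with hf
  have hs := (hF.contDiffAt (hΩ.mem_nhds hp)).isSymmSndFDerivAt
    (by simp only [minSmoothness_of_isRCLikeNormedField]
        exact WithTop.coe_le_coe.2 (le_top : (2 : ℕ∞) ≤ ⊤))
  have hd : DifferentiableAt ℝ (fderiv ℝ f) (t, y) :=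
    ((hF.fderiv_of_isOpen hΩ (m := ∞) (by simp)).contDiffAt (hΩ.mem_nhds hp)).differentiableAt
      (by simp)
  have h1 := (hF.pd hΩ i).hasDerivAt_time hΩ hp
  have hF1 : SmoothFam F' Ω :=
    ContDiffOn.congr (f := fun p => fderiv ℝ f p (1, 0))
      ((hF.fderiv_of_isOpen hΩ (by simp)).clm_apply contDiffOn_const)
      fun p hp => (hF' p hp).unique (hF.hasDerivAt_time hΩ (t := p.1) (y := p.2) hp)
  refine h1.congr_deriv ?_
  rw [hF1.pd_eq hΩ hp]
  have e1 : (fun p : ℝ × Coord m => GenKahler.pd i (F p.1) p.2) =ᶠ[nhds (t, y)]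
      fun p => fderiv ℝ f p (0, EuclideanSpace.single i 1) :=
    Filter.eventuallyEq_of_mem (hΩ.mem_nhds hp) fun p hp => hF.pd_eq hΩ (t := p.1) (y := p.2) hp i
  have e2 : (fun p : ℝ × Coord m => F' p.1 p.2) =ᶠ[nhds (t, y)]
      fun p => fderiv ℝ f p (1, 0) :=
    Filter.eventuallyEq_of_mem (hΩ.mem_nhds hp) fun p hp =>
      (hF' p hp).unique (hF.hasDerivAt_time hΩ (t := p.1) (y := p.2) hp)
  rw [e1.fderiv_eq, e2.fderiv_eq, fderiv_clm_apply hd (differentiableAt_const _),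
    fderiv_clm_apply hd (differentiableAt_const _)]
  simpa using hs.eq _ _

end SmoothFam

/-- The derivative of the inverse of a matrix-valued function of one variable. -/
lemma hasDerivAt_matrix_inv {A : ℝ → Matrix (Fin m) (Fin m) ℝ} {A' : Matrix (Fin m) (Fin m) ℝ}
    (hA : ∀ i j, HasDerivAt (fun s => A s i j) (A' i j) t) {W : Set ℝ} (hW : IsOpen W)
    (ht : t ∈ W) (hs : SmoothMat A W) (hu : ∀ s ∈ W, IsUnit (A s).det) (i j : Fin m) :
    HasDerivAt (fun s => (A s)⁻¹ i j) ((-((A t)⁻¹ * A' * (A t)⁻¹)) i j) t := by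
  have hN : ∀ i j, DifferentiableAt ℝ (fun s => (A s)⁻¹ i j) t := fun i j =>
    ((hs.inv hu i j).contDiffAt (hW.mem_nhds ht)).differentiableAt (by simp)
  set N' : Matrix (Fin m) (Fin m) ℝ := Matrix.of fun i j => deriv (fun s => (A s)⁻¹ i j) t with hN'
  have hN1 : ∀ i j, HasDerivAt (fun s => (A s)⁻¹ i j) (N' i j) t := fun i j => (hN i j).hasDerivAt
  have e : N' * A t + (A t)⁻¹ * A' = 0 := by
    ext i j
    have h1 : HasDerivAt (fun s => ∑ k, (A s)⁻¹ i k * A s k j)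
        (∑ k, (N' i k * A t k j + (A t)⁻¹ i k * A' k j)) t :=
      HasDerivAt.fun_sum fun k _ => (hN1 i k).mul (hA k j)
    have h2 : (fun s => ∑ k, (A s)⁻¹ i k * A s k j) =ᶠ[nhds t]
        fun _ => (1 : Matrix (Fin m) (Fin m) ℝ) i j :=
      Filter.eventuallyEq_of_mem (hW.mem_nhds ht) fun s hs => by
        have := congrFun (congrFun (Matrix.nonsing_inv_mul _ (hu s hs)) i) j
        rwa [Matrix.mul_apply] at this
    have h3 := (h1.congr_of_eventuallyEq h2.symm).unique (hasDerivAt_const t _)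
    simpa [Matrix.add_apply, Matrix.mul_apply, Finset.sum_add_distrib] using h3
  have e2 : N' = -((A t)⁻¹ * A' * (A t)⁻¹) := by
    have h1 := Matrix.mul_nonsing_inv _ (hu t ht)
    linear_combination (norm := noncomm_ring) e * (A t)⁻¹ - N' * h1
  rw [← e2]
  exact hN1 i j

end Spacetime

/-! ### The flow in a chart -/

section LocalFlow

variable {m : ℕ}

/-- A nondegenerate solution of the flow in coordinates, on the open time set `W` and the open
set `V` of coordinates. -/
structure LocalFlow (W : Set ℝ) (V : Set (Coord m))
    (G I J : ℝ → Coord m → Matrix (Fin m) (Fin m) ℝ) : Prop where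
  isOpen_time : IsOpen W
  gk : ∀ t ∈ W, LocalGK V (G t) (I t) (J t)
  isOpen_space : IsOpen V
  inv_pos : ∀ t ∈ W, ∀ y ∈ V, ((G t y)⁻¹).PosSemidef
  smooth_g : SmoothMat (fun p : ℝ × Coord m => G p.1 p.2) (W ×ˢ V)
  smooth_I : SmoothMat (fun p : ℝ × Coord m => I p.1 p.2) (W ×ˢ V)
  smooth_J : SmoothMat (fun p : ℝ × Coord m => J p.1 p.2) (W ×ˢ V)
  evol_g : ∀ y ∈ V, ∀ t ∈ W, ∀ i j, HasDerivAt (fun s => G s y i j)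
    (-2 * ricci (G t) i j y + (1 / 2) * torsionSq (G t) (dcFundForm (G t) (I t)) i j y) t
  evol_I : ∀ y ∈ V, ∀ t ∈ W, ∀ k j, HasDerivAt (fun s => I s y k j)
    (lieEnd (leeField (G t) (I t)) (I t) k j y) t
  evol_J : ∀ y ∈ V, ∀ t ∈ W, ∀ k j, HasDerivAt (fun s => J s y k j)
    (lieEnd (leeField (G t) (J t)) (J t) k j y) t

/-- Bernstein's quantity `(t - c) |∇Φ|² + ½ Φ²`. -/
def bernstein (c : ℝ) (G I J : ℝ → Coord m → Matrix (Fin m) (Fin m) ℝ) (t : ℝ)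
    (y : Coord m) : ℝ :=
  (t - c) * gradNormSq (G t) (fun z => pairPhi (I t z) (J t z)) y +
    (1 / 2) * pairPhi (I t y) (J t y) ^ 2

variable {W : Set ℝ} {V : Set (Coord m)} {G I J : ℝ → Coord m → Matrix (Fin m) (Fin m) ℝ}
  {t : ℝ} {y : Coord m}

namespace LocalFlow

lemma isOpen (h : LocalFlow W V G I J) : IsOpen (W ×ˢ V) := h.isOpen_time.prod h.isOpen_space

lemma smooth_inv (h : LocalFlow W V G I J) :
    SmoothMat (fun p : ℝ × Coord m => (G p.1 p.2)⁻¹) (W ×ˢ V) :=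
  h.smooth_g.inv fun p hp => (h.gk p.1 hp.1).left.unit p.2 hp.2

lemma smooth_pairPhi (h : LocalFlow W V G I J) :
    SmoothFam (fun s z => pairPhi (I s z) (J s z)) (W ×ˢ V) := by
  have hI := h.smooth_I
  have hJ := h.smooth_J
  have hn : ∀ p ∈ W ×ˢ V, LocalGK V (G p.1) (I p.1) (J p.1) := fun p hp => h.gk p.1 hp.1
  exact (contDiffOn_const.mul ((hI.sub hJ).det.log fun p hp => det_sub_ne_zero
    ((hn p hp).left.sq p.2 hp.2) ((hn p hp).right.sq p.2 hp.2) ((hn p hp).nondeg p.2 hp.2))).sub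
    (contDiffOn_const.mul ((hI.add hJ).det.log fun p hp => det_add_ne_zero
    ((hn p hp).left.sq p.2 hp.2) ((hn p hp).right.sq p.2 hp.2) ((hn p hp).nondeg p.2 hp.2)))

/-- The Ricci potential solves the heat equation. -/
lemma hasDerivAt_pairPhi (h : LocalFlow W V G I J) (ht : t ∈ W) (hy : y ∈ V) :
    HasDerivAt (fun s => pairPhi (I s y) (J s y))
      (lapl (G t) (fun z => pairPhi (I t z) (J t z)) y) t := by
  have hg := h.gk t ht
  have k := hasDerivWithinAt_pairPhi (s := Set.univ) (I := fun s => I s y) (J := fun s => J s y)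
    (I' := Matrix.of fun k j => lieEnd (leeField (G t) (I t)) (I t) k j y)
    (J' := Matrix.of fun k j => lieEnd (leeField (G t) (J t)) (J t) k j y)
    (fun i j => (h.evol_I y hy t ht i j).hasDerivWithinAt)
    (fun i j => (h.evol_J y hy t ht i j).hasDerivWithinAt)
    (hg.left.sq y hy) (hg.right.sq y hy) (hg.nondeg y hy)
  rw [hasDerivWithinAt_univ, hg.heat_pairPhi hy] at k
  exact k

/-- The evolution of `log |det [I, J]|` at a critical point in space. -/
lemma hasDerivAt_pairVol (h : LocalFlow W V G I J) (ht : t ∈ W) (hy : y ∈ V)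
    (hq : dcov (fun z => pairVol (I t z) (J t z)) y = 0) :
    HasDerivAt (fun s => pairVol (I s y) (J s y))
      (lapl (G t) (fun z => pairVol (I t z) (J t z)) y +
        LocalGK.volError (G t) (I t) (J t) y) t := by
  have hg := h.gk t ht
  have k := hasDerivWithinAt_pairVol (s := Set.univ) (I := fun s => I s y) (J := fun s => J s y)
    (I' := Matrix.of fun k j => lieEnd (leeField (G t) (I t)) (I t) k j y)
    (J' := Matrix.of fun k j => lieEnd (leeField (G t) (J t)) (J t) k j y)
    (fun i j => (h.evol_I y hy t ht i j).hasDerivWithinAt)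
    (fun i j => (h.evol_J y hy t ht i j).hasDerivWithinAt)
    (hg.left.sq y hy) (hg.right.sq y hy) (hg.nondeg y hy)
  rw [hasDerivWithinAt_univ, hg.evolution_pairVol hy hq] at k
  exact k

/-- The evolution of `|∇Φ|²`: the terms `-2|∇²Φ|²` and `-½ 𝓗(∇Φ, ∇Φ)` have a sign. -/
lemma exists_hasDerivAt_gradNormSq (h : LocalFlow W V G I J) (ht : t ∈ W) (hy : y ∈ V) :
    ∃ D, HasDerivAt (fun s => gradNormSq (G s) (fun z => pairPhi (I s z) (J s z)) y) D t ∧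
      D ≤ lapl (G t) (gradNormSq (G t) fun z => pairPhi (I t z) (J t z)) y := by
  have hg := h.gk t ht
  have hty : (t, y) ∈ W ×ˢ V := ⟨ht, hy⟩
  set φ : ℝ → Coord m → ℝ := fun s z => pairPhi (I s z) (J s z) with hφ
  have hφs : SmoothFam φ (W ×ˢ V) := h.smooth_pairPhi
  set G' : Matrix (Fin m) (Fin m) ℝ := Matrix.of fun i j => -2 * ricci (G t) i j y +
    (1 / 2) * torsionSq (G t) (dcFundForm (G t) (I t)) i j y with hG'
  set N := (G t y)⁻¹ with hN
  set Z := N *ᵥ dcov (φ t) y with hZ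
  have d1 : ∀ i j, HasDerivAt (fun s => (G s y)⁻¹ i j) ((-(N * G' * N)) i j) t :=
    hasDerivAt_matrix_inv (fun i j => h.evol_g y hy t ht i j) h.isOpen_time ht
      (fun i j => ContDiffOn.comp (h.smooth_g i j) (contDiff_prodMk_left y).contDiffOn
        fun s hs => ⟨hs, hy⟩) fun s hs => (h.gk s hs).left.unit y hy
  have d2 : ∀ i, HasDerivAt (fun s => dcov (φ s) y i) (dcov (lapl (G t) (φ t)) y i) t := fun i =>
    hφs.hasDerivAt_pd (F' := fun s z => lapl (G s) (φ s) z) h.isOpen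
      (fun p hp => h.hasDerivAt_pairPhi hp.1 hp.2) hty i
  have d3 := HasDerivAt.fun_sum (u := Finset.univ) fun i (_ : i ∈ Finset.univ) =>
    (HasDerivAt.fun_sum (u := Finset.univ)
      fun j (_ : j ∈ Finset.univ) => (d1 i j).mul (d2 j)).mul (d2 i)
  refine ⟨_, d3, ?_⟩
  have hb := hg.left.bochner (hφs.slice (t := t) fun z hz => ⟨ht, hz⟩) hy
  have hNs : Nᵀ = N := hg.left.inv_symm hy
  have p1 := trace_conj_nonneg (h.inv_pos t ht y hy) (covHess (G t) (φ t) y)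
  have p2 := torsionSq_nonneg (H := dcFundForm (G t) (I t)) (h.inv_pos t ht y hy) Z
  rw [hb, ← hN, ← hZ]
  have e : ∑ i, (((∑ j, ((-(N * G' * N)) i j * dcov (φ t) y j +
        (G t y)⁻¹ i j * dcov (lapl (G t) (φ t)) y j)) * dcov (φ t) y i +
        (∑ j, (G t y)⁻¹ i j * dcov (φ t) y j) * dcov (lapl (G t) (φ t)) y i)) =
      ((-(N * G' * N)) *ᵥ dcov (φ t) y) ⬝ᵥ dcov (φ t) y +
        (N *ᵥ dcov (lapl (G t) (φ t)) y) ⬝ᵥ dcov (φ t) y +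
        Z ⬝ᵥ dcov (lapl (G t) (φ t)) y := by
    simp only [Finset.sum_add_distrib, add_mul]
    rfl
  have e1 : (N *ᵥ dcov (lapl (G t) (φ t)) y) ⬝ᵥ dcov (φ t) y =
      Z ⬝ᵥ dcov (lapl (G t) (φ t)) y := by
    rw [dotProduct_comm, dotProduct_mulVec_transpose, hNs, dotProduct_comm]
  have e2 : ((-(N * G' * N)) *ᵥ dcov (φ t) y) ⬝ᵥ dcov (φ t) y = -∑ i, ∑ j, G' i j * Z i * Z j := by
    rw [Matrix.neg_mulVec, neg_dotProduct, ← Matrix.mulVec_mulVec, ← Matrix.mulVec_mulVec, ← hZ,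
      dotProduct_comm, dotProduct_mulVec_transpose, hNs, ← hZ]
    simp only [dotProduct, Matrix.mulVec, Finset.sum_mul]
    exact congrArg _ (Finset.sum_congr rfl fun i _ => Finset.sum_congr rfl fun j _ => by ring)
  have e3 : ∑ i, ∑ j, G' i j * Z i * Z j = -2 * (∑ i, ∑ j, ricci (G t) i j y * Z i * Z j) +
      (1 / 2) * ∑ i, ∑ j, torsionSq (G t) (dcFundForm (G t) (I t)) i j y * Z i * Z j := by
    simp only [hG', Matrix.of_apply, Finset.mul_sum, ← Finset.sum_add_distrib]
    exact Finset.sum_congr rfl fun i _ => Finset.sum_congr rfl fun j _ => by ring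
  refine le_trans (le_of_eq (e.trans ?_)) (?_ :
    -(-2 * (∑ i, ∑ j, ricci (G t) i j y * Z i * Z j) +
      (1 / 2) * ∑ i, ∑ j, torsionSq (G t) (dcFundForm (G t) (I t)) i j y * Z i * Z j) +
      2 * (Z ⬝ᵥ dcov (lapl (G t) (φ t)) y) ≤ _)
  · rw [e1, e2, e3]; ring
  · linarith

lemma smooth_gradNormSq (h : LocalFlow W V G I J) :
    SmoothFam (fun s => gradNormSq (G s) fun z => pairPhi (I s z) (J s z)) (W ×ˢ V) :=
  smooth_dotProduct (v := fun p : ℝ × Coord m => (G p.1 p.2)⁻¹ *ᵥ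
      dcov (fun z => pairPhi (I p.1 z) (J p.1 z)) p.2)
    (smooth_mulVec h.smooth_inv (h.smooth_pairPhi.pd h.isOpen)) (h.smooth_pairPhi.pd h.isOpen)

lemma smooth_bernstein (h : LocalFlow W V G I J) (c : ℝ) :
    SmoothFam (bernstein c G I J) (W ×ˢ V) :=
  (((contDiffOn_fst).sub contDiffOn_const).mul h.smooth_gradNormSq).add
    (contDiffOn_const.mul (h.smooth_pairPhi.pow 2))

/-- Bernstein's quantity is a subsolution of the heat equation. -/
lemma exists_hasDerivAt_bernstein (h : LocalFlow W V G I J) {c : ℝ} (ht : t ∈ W) (hc : c ≤ t)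
    (hy : y ∈ V) : ∃ D, HasDerivAt (fun s => bernstein c G I J s y) D t ∧
      D ≤ lapl (G t) (bernstein c G I J t) y := by
  obtain ⟨D, hD, hDl⟩ := h.exists_hasDerivAt_gradNormSq ht hy
  have hp := h.hasDerivAt_pairPhi ht hy
  have hl := (h.gk t ht).left.toLocalMetric
  have s1 := h.smooth_pairPhi.slice (t := t) (V := V) fun z hz => ⟨ht, hz⟩
  have s2 := h.smooth_gradNormSq.slice (t := t) (V := V) fun z hz => ⟨ht, hz⟩
  refine ⟨_, (((hasDerivAt_id t).sub_const c).mul hD).add ((hp.pow 2).const_mul (1 / 2)), ?_⟩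
  have e : lapl (G t) (bernstein c G I J t) y =
      (t - c) * lapl (G t) (gradNormSq (G t) fun z => pairPhi (I t z) (J t z)) y +
        (pairPhi (I t y) (J t y) * lapl (G t) (fun z => pairPhi (I t z) (J t z)) y +
          gradNormSq (G t) (fun z => pairPhi (I t z) (J t z)) y) := by
    unfold bernstein
    rw [hl.lapl_add (contDiffOn_const.mul s2) (contDiffOn_const.mul (s1.pow 2)) hy,
      hl.lapl_const_mul _ s2 hy, hl.lapl_const_mul _ (s1.pow 2) hy, hl.lapl_sq s1 hy]
    ring
  rw [e]
  have := mul_le_mul_of_nonneg_left hDl (sub_nonneg.2 hc)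
  simp only [id]
  norm_num
  linarith

end LocalFlow

/-! ### Continuity of the error term -/

/-- The lower-order term in the evolution of `log |det [I, J]|` is continuous in space-time,
whether or not `[I, J]` is invertible. -/
lemma continuousOn_volError {Ω : Set (ℝ × Coord m)} (hΩ : IsOpen Ω)
    (hG : SmoothMat (fun p : ℝ × Coord m => G p.1 p.2) Ω)
    (hI : SmoothMat (fun p : ℝ × Coord m => I p.1 p.2) Ω)
    (hJ : SmoothMat (fun p : ℝ × Coord m => J p.1 p.2) Ω)
    (hu : ∀ p ∈ Ω, IsUnit (G p.1 p.2).det) :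
    ContinuousOn (fun p : ℝ × Coord m => LocalGK.volError (G p.1) (I p.1) (J p.1) p.2) Ω := by
  have hN := hG.inv hu
  have pdG : ∀ a i j, SmoothFam (fun s z => pd a (fun w => G s w i j) z) Ω := fun a i j =>
    SmoothFam.pd (F := fun s z => G s z i j) (hG i j) hΩ a
  have hΓ : ∀ k i j, SmoothFam (fun s => christoffel (G s) k i j) Ω := fun k i j =>
    contDiffOn_const.mul (ContDiffOn.sum fun l _ => (hN k l).mul
      (((pdG i j l).add (pdG j i l)).sub (pdG l i j)))
  have hω : ∀ s, SmoothFam (fun t z => fundForm (G t) (I t) z s) Ω := fun s =>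
    ContDiffOn.sum fun c _ => (hI _ _).mul (hG _ _)
  have hd : ∀ s, SmoothFam (fun t z => extD (fundForm (G t) (I t)) z s) Ω := fun s =>
    ContDiffOn.sum fun a _ => contDiffOn_const.mul (SmoothFam.pd (hω _) hΩ _)
  have hH : ∀ s, SmoothFam (fun t z => dcFundForm (G t) (I t) z s) Ω := fun s =>
    (ContDiffOn.sum fun a _ => ContDiffOn.sum fun b _ => ContDiffOn.sum fun c _ =>
      (((hI _ _).mul (hI _ _)).mul (hI _ _)).mul (hd _)).neg
  have hθ : ∀ l, SmoothFam (fun t z => leeForm (G t) (I t) l z) Ω := fun l =>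
    contDiffOn_const.mul (ContDiffOn.sum fun a _ => ContDiffOn.sum fun b _ =>
      ContDiffOn.sum fun c _ => ((hN a b).mul (hI c b)).mul (hd _))
  have hT : ∀ a, SmoothMat (fun p : ℝ × Coord m => torsionEnd (G p.1) (I p.1) p.2 a) Ω := fun a =>
    (hN.mul (F' := fun p : ℝ × Coord m => Matrix.of fun c b =>
      dcFundForm (G p.1) (I p.1) p.2 ![a, b, c]) fun c b => hH _).neg
  have hp : ∀ i, ContDiffOn ℝ ∞ (fun q : ℝ × Coord m => ((2 : ℝ) • ((I q.1 q.2 * J q.1 q.2)ᵀ *ᵥ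
      fun l => leeForm (G q.1) (I q.1) l q.2)) i) Ω := fun i =>
    contDiffOn_const.mul (smooth_mulVec (hI.mul hJ).transpose hθ i)
  have hchr : ∀ k, SmoothMat (fun q : ℝ × Coord m => chrM (G q.1) k q.2) Ω :=
    fun k i j => hΓ i k j
  have hJI : ∀ k, SmoothMat (fun q : ℝ × Coord m => pdM k (fun z => J q.1 z * I q.1 z) q.2) Ω :=
    fun k i j => SmoothFam.pd (F := fun s z => (J s z * I s z) i j) ((hJ.mul hI) i j) hΩ k
  refine ContDiffOn.continuousOn (𝕜 := ℝ) (n := ∞) ?_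
  refine (((contDiffOn_const.mul (ContDiffOn.sum fun k _ => smooth_mulVec hN
    (fun l => SmoothFam.pd (hθ l) hΩ k) k)).add (contDiffOn_const.mul (ContDiffOn.sum fun k _ =>
      smooth_mulVec hN (smooth_mulVec
        (((hJI k).transpose).add ((hJ.mul hI).transpose.mul (hchr k).transpose)) hp) k))).sub
    (smooth_dotProduct (smooth_mulVec hN hp) hp)).sub (contDiffOn_const.mul
      (SmoothMat.trace (SmoothMat.mul (fun i j => ?_) ((hI.mul hJ).sub (hJ.mul hI)))))
  simp only [contr, Matrix.sum_apply, Matrix.smul_apply, smul_eq_mul]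
  exact ContDiffOn.sum fun a _ => (smooth_mulVec hN hp a).mul (hT a i j)

end LocalFlow

/-! ### The Pfaffian -/

section Pfaffian

variable {n : ℕ}

/-- The `2i`-th and `(2i+1)`-st indices are grouped into the `i`-th pair. -/
def pairEquiv (n : ℕ) : Fin n × Fin 2 ≃ Fin (2 * n) where
  toFun p := ⟨2 * p.1 + p.2, by omega⟩
  invFun k := (⟨k / 2, by omega⟩, ⟨k % 2, by omega⟩)
  left_inv p := by
    ext <;> simp <;> omega
  right_inv k := by
    ext; simp; omega

/-- The Pfaffian of a square matrix of even size, up to a constant factor. -/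
def pfaffSum (A : Matrix (Fin (2 * n)) (Fin (2 * n)) ℝ) : ℝ :=
  ∑ τ : Equiv.Perm (Fin (2 * n)), ((Equiv.Perm.sign τ : ℤ) : ℝ) *
    ∏ i : Fin n, A (τ (pairEquiv n (i, 0))) (τ (pairEquiv n (i, 1)))

lemma wedgePow_eq {V : Type*} (F : V → V → ℝ) (v : Fin (2 * n) → V) :
    wedgePow n F v = (1 / 2) ^ n * pfaffSum (Matrix.of fun i j => F (v i) (v j)) := rfl

lemma prod_pairEquiv (f : Fin (2 * n) → ℝ) :
    ∏ k, f k = ∏ i : Fin n, f (pairEquiv n (i, 0)) * f (pairEquiv n (i, 1)) := by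
  rw [← (pairEquiv n).prod_comp, Fintype.prod_prod_type]
  simp [Fin.prod_univ_two]

lemma pfaffSum_congruence_aux (L A : Matrix (Fin (2 * n)) (Fin (2 * n)) ℝ) :
    pfaffSum (L * A * Lᵀ) = ∑ q : Fin n → Fin (2 * n) × Fin (2 * n), (∏ i, A (q i).1 (q i).2) *
      (L.submatrix id fun k => if ((pairEquiv n).symm k).2 = 0 then (q ((pairEquiv n).symm k).1).1
        else (q ((pairEquiv n).symm k).1).2).det := by
  have e : ∀ a b, (L * A * Lᵀ) a b = ∑ p : Fin (2 * n) × Fin (2 * n),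
      A p.1 p.2 * (L a p.1 * L b p.2) := by
    intro a b
    rw [Fintype.sum_prod_type, Finset.sum_comm]
    simp only [Matrix.mul_apply, Matrix.transpose_apply, Finset.sum_mul]
    exact Finset.sum_congr rfl fun _ _ => Finset.sum_congr rfl fun _ _ => by ring
  simp only [pfaffSum, e, Finset.prod_univ_sum, Fintype.piFinset_univ, Finset.mul_sum]
  rw [Finset.sum_comm]
  refine Finset.sum_congr rfl fun q _ => ?_
  rw [Matrix.det_apply, Finset.mul_sum]
  refine Finset.sum_congr rfl fun τ _ => ?_
  rw [Finset.prod_mul_distrib, prod_pairEquiv]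
  simp only [Matrix.submatrix_apply, id, Equiv.symm_apply_apply, if_true, one_ne_zero, if_false,
    Units.smul_def, zsmul_eq_mul]
  ring

/-- `Pf (L A Lᵀ) = det L · Pf A`. -/
lemma pfaffSum_congruence (L A : Matrix (Fin (2 * n)) (Fin (2 * n)) ℝ) :
    pfaffSum (L * A * Lᵀ) = L.det * pfaffSum A := by
  have e : ∀ h : Fin (2 * n) → Fin (2 * n), (L.submatrix id h).det =
      L.det * ((1 : Matrix (Fin (2 * n)) (Fin (2 * n)) ℝ).submatrix id h).det := by
    intro h
    rw [← Matrix.det_mul]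
    congr 1
    ext a b
    simp [Matrix.mul_apply, Matrix.one_apply]
  have k := pfaffSum_congruence_aux 1 A
  rw [one_mul, Matrix.transpose_one, mul_one] at k
  rw [pfaffSum_congruence_aux, k, Finset.mul_sum]
  refine Finset.sum_congr rfl fun q _ => ?_
  rw [e]
  ring

/-- The values of the standard symplectic form on a pair. -/
def sympSign (a b : Fin 2) : ℝ := (b : ℝ) - (a : ℝ)

/-- The standard symplectic form. -/
def stdSymp (n : ℕ) : Matrix (Fin (2 * n)) (Fin (2 * n)) ℝ := fun k l =>
  if ((pairEquiv n).symm k).1 = ((pairEquiv n).symm l).1 then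
    sympSign ((pairEquiv n).symm k).2 ((pairEquiv n).symm l).2 else 0

lemma sympSign_perm (s : Equiv.Perm (Fin 2)) :
    sympSign (s 0) (s 1) = ((Equiv.Perm.sign s : ℤ) : ℝ) := by
  have : s = 1 ∨ s = Equiv.swap 0 1 := by
    revert s; decide
  rcases this with rfl | rfl <;> simp [sympSign]

/-- Every term of the Pfaffian sum of the standard symplectic form is nonnegative: a nonvanishing
term comes from a permutation preserving the set of pairs, whose sign is the product of the values
of the form. -/
lemma stdSymp_term_nonneg (τ : Equiv.Perm (Fin (2 * n))) :
    0 ≤ ((Equiv.Perm.sign τ : ℤ) : ℝ) *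
      ∏ i : Fin n, stdSymp n (τ (pairEquiv n (i, 0))) (τ (pairEquiv n (i, 1))) := by
  by_cases h0 : ∃ i, stdSymp n (τ (pairEquiv n (i, 0))) (τ (pairEquiv n (i, 1))) = 0
  · obtain ⟨i, hi⟩ := h0
    rw [Finset.prod_eq_zero (Finset.mem_univ i) hi, mul_zero]
  push Not at h0
  set ρ : Equiv.Perm (Fin n × Fin 2) := ((pairEquiv n).trans τ).trans (pairEquiv n).symm with hρ
  have hs : Equiv.Perm.sign τ = Equiv.Perm.sign ρ := by
    rw [hρ, ← Equiv.Perm.sign_symm_trans_trans τ (pairEquiv n).symm, Equiv.symm_symm]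
  have hJ : ∀ i, stdSymp n (τ (pairEquiv n (i, 0))) (τ (pairEquiv n (i, 1))) =
      if (ρ (i, 0)).1 = (ρ (i, 1)).1 then sympSign (ρ (i, 0)).2 (ρ (i, 1)).2 else 0 := fun i => rfl
  have h1 : ∀ i, (ρ (i, 0)).1 = (ρ (i, 1)).1 := by
    intro i
    by_contra h
    exact h0 i (by rw [hJ, if_neg h])
  -- `ρ` permutes the pairs by `σ` and the elements of the `i`-th pair by `s i`
  have hinj : ∀ i, Function.Injective fun b => (ρ (i, b)).2 := by
    intro i b b' hb
    have h2 : ∀ b, (ρ (i, b)).1 = (ρ (i, 0)).1 := by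
      intro b
      fin_cases b
      · rfl
      · exact (h1 i).symm
    have : ρ (i, b) = ρ (i, b') := Prod.ext ((h2 b).trans (h2 b').symm) hb
    exact (Prod.ext_iff.1 (ρ.injective this)).2
  set s : Fin n → Equiv.Perm (Fin 2) := fun i =>
    Equiv.ofBijective _ (Finite.injective_iff_bijective.1 (hinj i)) with hsdef
  have hsa : ∀ i b, s i b = (ρ (i, b)).2 := fun i b => rfl
  have hσ : Function.Injective fun i => (ρ (i, 0)).1 := by
    intro i j hij
    obtain ⟨b, hb⟩ := (s j).surjective (s i 0)
    have h2 : ρ (i, 0) = ρ (j, b) := by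
      refine Prod.ext (hij.trans ?_) (by rw [← hsa, ← hsa, hb])
      fin_cases b
      · rfl
      · exact h1 j
    exact (Prod.ext_iff.1 (ρ.injective h2)).1
  set σ : Equiv.Perm (Fin n) := Equiv.ofBijective _ (Finite.injective_iff_bijective.1 hσ) with hσd
  have hfac : ρ = (Equiv.prodCongrLeft fun _ : Fin 2 => σ) * Equiv.prodCongrRight s := by
    ext1 ⟨i, b⟩
    refine Prod.ext ?_ rfl
    change (ρ (i, b)).1 = (ρ (i, 0)).1
    fin_cases b
    · rfl
    · exact (h1 i).symm
  have hsign : Equiv.Perm.sign τ = ∏ i, Equiv.Perm.sign (s i) := by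
    rw [hs, hfac, Equiv.Perm.sign_mul, Equiv.Perm.sign_prodCongrLeft,
      Equiv.Perm.sign_prodCongrRight]
    simp
  have hprod : ∏ i : Fin n, stdSymp n (τ (pairEquiv n (i, 0))) (τ (pairEquiv n (i, 1))) =
      ((Equiv.Perm.sign τ : ℤ) : ℝ) := by
    rw [hsign]
    push_cast
    refine Finset.prod_congr rfl fun i _ => ?_
    rw [hJ, if_pos (h1 i), ← hsa, ← hsa, sympSign_perm]
  rw [hprod]
  exact mul_self_nonneg _

lemma pfaffSum_stdSymp_ne_zero : pfaffSum (stdSymp n) ≠ 0 := by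
  refine (lt_of_lt_of_le one_pos ?_).ne'
  have h1 : (1 : ℝ) = ((Equiv.Perm.sign (1 : Equiv.Perm (Fin (2 * n))) : ℤ) : ℝ) *
      ∏ i : Fin n, stdSymp n ((1 : Equiv.Perm (Fin (2 * n))) (pairEquiv n (i, 0)))
        ((1 : Equiv.Perm (Fin (2 * n))) (pairEquiv n (i, 1))) := by
    simp [stdSymp, sympSign]
  rw [h1]
  exact Finset.single_le_sum (f := fun τ : Equiv.Perm (Fin (2 * n)) =>
    ((Equiv.Perm.sign τ : ℤ) : ℝ) *
      ∏ i : Fin n, stdSymp n (τ (pairEquiv n (i, 0))) (τ (pairEquiv n (i, 1))))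
    (fun τ _ => stdSymp_term_nonneg τ) (Finset.mem_univ _)

/-- Symplectic Gram-Schmidt: a family of `k ≤ n` mutually orthogonal hyperbolic pairs exists. -/
lemma exists_symplectic_family {A : Matrix (Fin (2 * n)) (Fin (2 * n)) ℝ} (hA : Aᵀ = -A)
    (hu : IsUnit A.det) : ∀ k ≤ n, ∃ e : Fin k × Fin 2 → Fin (2 * n) → ℝ, ∀ p q,
      e p ⬝ᵥ A *ᵥ e q = if p.1 = q.1 then sympSign p.2 q.2 else 0 := by
  have hskew : ∀ v w : Fin (2 * n) → ℝ, v ⬝ᵥ A *ᵥ w = -(w ⬝ᵥ A *ᵥ v) := by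
    intro v w
    rw [dotProduct_mulVec_transpose, hA, Matrix.neg_mulVec, dotProduct_neg]
  have hself : ∀ v : Fin (2 * n) → ℝ, v ⬝ᵥ A *ᵥ v = 0 := fun v => by linarith [hskew v v]
  intro k
  induction k with
  | zero => exact fun _ => ⟨fun p => p.1.elim0, fun p => p.1.elim0⟩
  | succ k ih =>
    intro hk
    obtain ⟨e, he⟩ := ih (by omega)
    -- a nonzero vector orthogonal to the family
    let φ : (Fin (2 * n) → ℝ) →ₗ[ℝ] (Fin k × Fin 2 → ℝ) :=
      LinearMap.pi fun p => (dotProductBilin ℝ ℝ (e p)) ∘ₗ A.mulVecLin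
    have hφ : ∀ v p, φ v p = e p ⬝ᵥ A *ᵥ v := fun v p => rfl
    have hker : LinearMap.ker φ ≠ ⊥ := LinearMap.ker_ne_bot_of_finrank_lt (by simp; omega)
    obtain ⟨v, hv, hv0⟩ := Submodule.exists_mem_ne_zero_of_ne_bot hker
    have hv1 : ∀ p, e p ⬝ᵥ A *ᵥ v = 0 := fun p => by
      rw [← hφ, LinearMap.mem_ker.1 hv]; rfl
    have hv2 : A *ᵥ v ≠ 0 := by
      intro h
      apply hv0
      have := congrArg (A⁻¹ *ᵥ ·) h
      simpa [Matrix.mulVec_mulVec, Matrix.nonsing_inv_mul _ hu] using this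
    obtain ⟨w, hw⟩ : ∃ w : Fin (2 * n) → ℝ, v ⬝ᵥ A *ᵥ w = 1 := by
      have h1 : (A *ᵥ v) ⬝ᵥ (A *ᵥ v) ≠ 0 := fun h => hv2 (dotProduct_self_eq_zero.1 h)
      refine ⟨-((A *ᵥ v) ⬝ᵥ (A *ᵥ v))⁻¹ • (A *ᵥ v), ?_⟩
      rw [hskew, smul_dotProduct, smul_eq_mul]
      field_simp
    set w' : Fin (2 * n) → ℝ := w + ∑ i : Fin k, ((e (i, 1) ⬝ᵥ A *ᵥ w) • e (i, 0) -
      (e (i, 0) ⬝ᵥ A *ᵥ w) • e (i, 1)) with hw'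
    have hvw : v ⬝ᵥ A *ᵥ w' = 1 := by
      have h1 : ∀ p, v ⬝ᵥ A *ᵥ e p = 0 := fun p => by rw [hskew, hv1, neg_zero]
      simp [hw', Matrix.mulVec_add, Matrix.mulVec_sum, dotProduct_sum, Matrix.mulVec_sub,
        Matrix.mulVec_smul, h1, hw]
    have hew : ∀ p, e p ⬝ᵥ A *ᵥ w' = 0 := by
      rintro ⟨j, b⟩
      have h1 : e (j, b) ⬝ᵥ A *ᵥ w' = e (j, b) ⬝ᵥ A *ᵥ w + ∑ i : Fin k,
          ((e (i, 1) ⬝ᵥ A *ᵥ w) * (if j = i then sympSign b 0 else 0) -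
          (e (i, 0) ⬝ᵥ A *ᵥ w) * (if j = i then sympSign b 1 else 0)) := by
        simp [hw', Matrix.mulVec_add, Matrix.mulVec_sum, dotProduct_sum, Matrix.mulVec_sub,
          Matrix.mulVec_smul, he]
      rw [h1, Finset.sum_sub_distrib]
      simp only [mul_ite, mul_zero, Finset.sum_ite_eq, Finset.mem_univ, if_true]
      fin_cases b <;> simp [sympSign]
    refine ⟨fun p => Fin.snoc (α := fun _ => Fin (2 * n) → ℝ) (fun i => e (i, p.2))
      (if p.2 = 0 then v else w') p.1, ?_⟩
    rintro ⟨i, a⟩ ⟨j, b⟩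
    have hne : ∀ i : Fin k, i.castSucc ≠ Fin.last k := fun i => (Fin.castSucc_lt_last i).ne
    induction i using Fin.lastCases with
    | last =>
      induction j using Fin.lastCases with
      | last =>
        fin_cases a <;> fin_cases b <;> simp [sympSign, hself, hvw, hskew w' v]
      | cast j =>
        fin_cases a <;> simp [(hne j).symm, hskew _ (e (j, b)), hv1, hew]
    | cast i =>
      induction j using Fin.lastCases with
      | last => fin_cases b <;> simp [hne i, hv1, hew]
      | cast j => simp [he]

/-- Every invertible skew matrix is congruent to the standard symplectic form. -/
lemma exists_congruence_stdSymp {A : Matrix (Fin (2 * n)) (Fin (2 * n)) ℝ} (hA : Aᵀ = -A)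
    (hu : IsUnit A.det) : ∃ L : Matrix (Fin (2 * n)) (Fin (2 * n)) ℝ, L * A * Lᵀ = stdSymp n := by
  obtain ⟨e, he⟩ := exists_symplectic_family hA hu n le_rfl
  refine ⟨Matrix.of fun k => e ((pairEquiv n).symm k), ?_⟩
  ext k l
  rw [Matrix.mul_assoc, Matrix.mul_apply]
  have := he ((pairEquiv n).symm k) ((pairEquiv n).symm l)
  simp only [dotProduct, Matrix.mulVec] at this
  simpa [Matrix.mul_apply, stdSymp] using this

lemma stdSymp_det_ne_zero : (stdSymp n).det ≠ 0 := by
  have h : stdSymp n * stdSymp n = -1 := by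
    ext k l
    rw [Matrix.mul_apply, ← (pairEquiv n).sum_comp, Fintype.sum_prod_type]
    obtain ⟨⟨i, a⟩, rfl⟩ := (pairEquiv n).surjective k
    obtain ⟨⟨j, b⟩, rfl⟩ := (pairEquiv n).surjective l
    simp only [stdSymp, Equiv.symm_apply_apply, Fin.sum_univ_two, Matrix.neg_apply,
      Matrix.one_apply, (pairEquiv n).injective.eq_iff, Prod.mk.injEq]
    by_cases hij : i = j
    · subst hij
      simp only [ite_mul, mul_ite, zero_mul, mul_zero, true_and]
      fin_cases a <;> fin_cases b <;> simp [sympSign]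
    · have : ∀ x, (i = x ∧ x = j) → False := fun x hx => hij (hx.1.trans hx.2)
      rw [if_neg (by tauto), neg_zero]
      refine Finset.sum_eq_zero fun x _ => ?_
      by_cases h1 : i = x
      · subst h1; simp [hij]
      · simp [h1]
  intro h0
  have := congrArg Matrix.det h
  simp [Matrix.det_mul, h0, Matrix.det_neg] at this

/-- The square of the Pfaffian is the determinant, up to a nonzero constant. -/
lemma pfaffSum_sq (n : ℕ) : ∃ c : ℝ, c ≠ 0 ∧ ∀ A : Matrix (Fin (2 * n)) (Fin (2 * n)) ℝ,
    Aᵀ = -A → A.det ≠ 0 → pfaffSum A ^ 2 = c * A.det := by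
  refine ⟨pfaffSum (stdSymp n) ^ 2 / (stdSymp n).det,
    div_ne_zero (pow_ne_zero 2 pfaffSum_stdSymp_ne_zero) stdSymp_det_ne_zero, fun A hA hu => ?_⟩
  obtain ⟨L, hL⟩ := exists_congruence_stdSymp hA (isUnit_iff_ne_zero.2 hu)
  have h1 := stdSymp_det_ne_zero (n := n)
  rw [← hL, pfaffSum_congruence, Matrix.det_mul, Matrix.det_mul, Matrix.det_transpose]
  rw [← hL, Matrix.det_mul, Matrix.det_mul, Matrix.det_transpose] at h1
  have h2 : L.det ≠ 0 := right_ne_zero_of_mul h1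
  field_simp

/-- The logarithm of the ratio of the top powers of two nondegenerate 2-forms. The constant
relating the squared Pfaffian to the determinant cancels. -/
lemma log_wedgePow_div {V : Type*} (F F' : V → V → ℝ) (v : Fin (2 * n) → V)
    {A A' : Matrix (Fin (2 * n)) (Fin (2 * n)) ℝ} (hF : ∀ i j, F (v i) (v j) = A i j)
    (hF' : ∀ i j, F' (v i) (v j) = A' i j) (hA : Aᵀ = -A) (hA' : A'ᵀ = -A')
    (hd : A.det ≠ 0) (hd' : A'.det ≠ 0) :
    Real.log (wedgePow n F v / wedgePow n F' v) =
      (1 / 2) * Real.log A.det - (1 / 2) * Real.log A'.det := by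
  obtain ⟨c, hc, hpf⟩ := pfaffSum_sq n
  have e1 : (Matrix.of fun i j => F (v i) (v j)) = A := by ext i j; exact hF i j
  have e2 : (Matrix.of fun i j => F' (v i) (v j)) = A' := by ext i j; exact hF' i j
  rw [wedgePow_eq, wedgePow_eq, e1, e2, mul_div_mul_left _ _ (by positivity)]
  have h1 := hpf A hA hd
  have h2 := hpf A' hA' hd'
  have k : ∀ x d : ℝ, d ≠ 0 → x ^ 2 = c * d →
      x ≠ 0 ∧ 2 * Real.log x = Real.log c + Real.log d := by
    intro x d hd hx
    have hx0 : x ≠ 0 := by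
      rintro rfl
      exact mul_ne_zero hc hd (by rw [← hx]; simp)
    refine ⟨hx0, ?_⟩
    rw [← Real.log_mul hc hd, ← hx, Real.log_pow]
    norm_num
  obtain ⟨p1, p2⟩ := k _ _ hd h1
  obtain ⟨p3, p4⟩ := k _ _ hd' h2
  rw [Real.log_div p1 p3]
  linarith

end Pfaffian

/-! ### Components of tensors in a frame -/

section Frame

set_option linter.unusedSectionVars false

variable {m : ℕ} {T : Type*} [AddCommGroup T] [Module ℝ T] [TopologicalSpace T]

/-- The matrix of an endomorphism in a frame. -/
def endMat (D : Coord m ≃L[ℝ] T) (A : T →L[ℝ] T) : Matrix (Fin m) (Fin m) ℝ :=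
  fun k j => D.symm (A (D (EuclideanSpace.single j 1))) k

variable (D : Coord m ≃L[ℝ] T)

lemma coord_eq_sum (v : Coord m) : v = ∑ k, v k • EuclideanSpace.single k (1 : ℝ) := by
  ext i
  simp [Finset.sum_apply, Pi.single_apply]

lemma endMat_mulVec (A : T →L[ℝ] T) (v : Coord m) (k : Fin m) :
    (endMat D A *ᵥ v) k = D.symm (A (D v)) k := by
  conv_rhs => rw [coord_eq_sum v]
  simp only [map_sum, map_smul, Matrix.mulVec, dotProduct, endMat]
  simp [mul_comm]

lemma endMat_mul (A B : T →L[ℝ] T) : endMat D (A ∘L B) = endMat D A * endMat D B := by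
  ext k j
  rw [Matrix.mul_apply]
  have := endMat_mulVec D A (D.symm (B (D (EuclideanSpace.single j 1)))) k
  simp only [Matrix.mulVec, dotProduct, ContinuousLinearEquiv.apply_symm_apply] at this
  exact this.symm

lemma det_endMat (A : T →L[ℝ] T) : (endMat D A).det = LinearMap.det (A : T →ₗ[ℝ] T) := by
  rw [← LinearMap.det_conj (A : T →ₗ[ℝ] T) D.symm.toLinearEquiv,
    ← LinearMap.det_toMatrix (EuclideanSpace.basisFun (Fin m) ℝ).toBasis]
  congr 1

lemma endMat_eq_neg_one {A : T →L[ℝ] T} (hA : ∀ v, A (A v) = -v) :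
    endMat D A * endMat D A = -1 := by
  rw [← endMat_mul]
  ext k j
  simp [endMat, hA, Matrix.one_apply]

variable [IsTopologicalAddGroup T] [ContinuousConstSMul ℝ T]

lemma endMat_add (A B : T →L[ℝ] T) : endMat D (A + B) = endMat D A + endMat D B := by
  ext k j
  simp [endMat]

lemma endMat_sub (A B : T →L[ℝ] T) : endMat D (A - B) = endMat D A - endMat D B := by
  ext k j
  simp [endMat]

/-- The inverse of an endomorphism in terms of the inverse of its matrix. -/
lemma inverse_frame {A : T →L[ℝ] T} (hA : (endMat D A).det ≠ 0) (v : Coord m) :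
    ContinuousLinearMap.inverse A (D v) = D (WithLp.toLp 2 ((endMat D A)⁻¹ *ᵥ v)) := by
  have hu := isUnit_iff_ne_zero.2 hA
  set B : T →L[ℝ] T := (D : Coord m →L[ℝ] T) ∘L
    (Matrix.toEuclideanCLM (𝕜 := ℝ) (endMat D A)⁻¹) ∘L (D.symm : T →L[ℝ] Coord m) with hB
  have hBD : ∀ v, B (D v) = D (WithLp.toLp 2 ((endMat D A)⁻¹ *ᵥ v)) := by
    intro v
    simp only [hB, ContinuousLinearMap.comp_apply, ContinuousLinearEquiv.coe_coe,
      D.symm_apply_apply]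
    rfl
  have hAB : ∀ v, A (B v) = v := by
    intro v
    obtain ⟨v, rfl⟩ := D.surjective v
    rw [← D.symm.injective.eq_iff, D.symm_apply_apply]
    ext k
    rw [hBD, ← endMat_mulVec]
    simp [Matrix.mulVec_mulVec, Matrix.mul_nonsing_inv _ hu]
  have hBA : ∀ v, B (A v) = v := by
    intro v
    obtain ⟨v, rfl⟩ := D.surjective v
    rw [← D.apply_symm_apply (A (D v)), hBD]
    congr 1
    ext k
    rw [show (D.symm (A (D v))).ofLp = endMat D A *ᵥ v from
      funext fun k => (endMat_mulVec D A v k).symm]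
    simp [Matrix.mulVec_mulVec, Matrix.nonsing_inv_mul _ hu]
  rw [ContinuousLinearMap.inverse_eq (ContinuousLinearMap.ext hAB) (ContinuousLinearMap.ext hBA),
    hBD]

/-- The components of a bilinear form in a frame. -/
def bilMat (b : T →L[ℝ] T →L[ℝ] ℝ) : Matrix (Fin m) (Fin m) ℝ :=
  fun i j => b (D (EuclideanSpace.single i 1)) (D (EuclideanSpace.single j 1))

lemma bilMat_dotProduct (b : T →L[ℝ] T →L[ℝ] ℝ) (v w : Coord m) :
    v ⬝ᵥ bilMat D b *ᵥ w = b (D v) (D w) := by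
  conv_rhs => rw [coord_eq_sum v, coord_eq_sum w]
  simp only [map_sum, map_smul, sum_apply, smul_apply, dotProduct, Matrix.mulVec, bilMat,
    smul_eq_mul, Finset.mul_sum]
  rw [Finset.sum_comm]
  exact Finset.sum_congr rfl fun i _ => Finset.sum_congr rfl fun j _ => by ring

variable {b : T →L[ℝ] T →L[ℝ] ℝ}

lemma bilMat_symm (hs : ∀ v w, b v w = b w v) : (bilMat D b)ᵀ = bilMat D b := by
  ext i j
  exact hs _ _

lemma bilMat_posDef (hs : ∀ v w, b v w = b w v) (hp : ∀ v, v ≠ 0 → 0 < b v v) :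
    (bilMat D b).PosDef := by
  refine Matrix.PosDef.of_dotProduct_mulVec_pos ?_ fun x hx => ?_
  · rw [Matrix.IsHermitian, Matrix.conjTranspose_eq_transpose_of_trivial, bilMat_symm D hs]
  · have := bilMat_dotProduct D b (WithLp.toLp 2 x) (WithLp.toLp 2 x)
    rw [star_trivial]
    refine lt_of_lt_of_eq (hp (D (WithLp.toLp 2 x)) ?_) this.symm
    simpa using hx

lemma bilMat_orth {A : T →L[ℝ] T} (hA : ∀ v w, b (A v) (A w) = b v w) :
    (endMat D A)ᵀ * bilMat D b * endMat D A = bilMat D b := by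
  have col : ∀ j, endMat D A *ᵥ (EuclideanSpace.single j (1 : ℝ) : Coord m) =
      D.symm (A (D (EuclideanSpace.single j 1))) := fun j => funext fun k => endMat_mulVec D A _ k
  ext i j
  have k := bilMat_dotProduct D b (D.symm (A (D (EuclideanSpace.single i 1))))
    (D.symm (A (D (EuclideanSpace.single j 1))))
  rw [D.apply_symm_apply, D.apply_symm_apply, hA] at k
  refine Eq.trans ?_ k
  rw [← col, ← col, Matrix.mul_assoc]
  simp [Matrix.mul_apply, Matrix.mulVec, dotProduct]

variable [ContinuousSMul ℝ T]

/-- The inverse of a metric, as a map from covectors to vectors, in a frame. -/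
lemma inverse_bilin (hu : IsUnit (bilMat D b).det) (α : T →L[ℝ] ℝ) :
    ContinuousLinearMap.inverse b α = D (WithLp.toLp 2 ((bilMat D b)ᵀ⁻¹ *ᵥ
      fun i => α (D (EuclideanSpace.single i 1)))) := by
  have hu' : IsUnit ((bilMat D b)ᵀ).det := by rwa [Matrix.det_transpose]
  set S : (T →L[ℝ] ℝ) →L[ℝ] T := (D : Coord m →L[ℝ] T) ∘L
    (Matrix.toEuclideanCLM (𝕜 := ℝ) (bilMat D b)ᵀ⁻¹) ∘L
      ((EuclideanSpace.equiv (Fin m) ℝ).symm : (Fin m → ℝ) →L[ℝ] Coord m) ∘L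
      (ContinuousLinearMap.pi fun i =>
        { toFun := fun α => α (D (EuclideanSpace.single i 1))
          map_add' := fun _ _ => rfl
          map_smul' := fun _ _ => rfl
          cont := continuous_eval_const _ }) with hS
  have hSα : ∀ α, S α = D (WithLp.toLp 2 ((bilMat D b)ᵀ⁻¹ *ᵥ
      fun i => α (D (EuclideanSpace.single i 1)))) := fun α => rfl
  have hrow : ∀ v : Coord m, (fun i => b (D v) (D (EuclideanSpace.single i 1))) =
      (bilMat D b)ᵀ *ᵥ v := by
    intro v
    funext i
    rw [← bilMat_dotProduct]
    simp [Matrix.mulVec, dotProduct, mul_comm]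
  have h1 : ∀ α, b (S α) = α := by
    intro α
    have h2 := hrow (WithLp.toLp 2 ((bilMat D b)ᵀ⁻¹ *ᵥ
      fun i => α (D (EuclideanSpace.single i 1))))
    rw [← hSα, Matrix.mulVec_mulVec, Matrix.mul_nonsing_inv _ hu', Matrix.one_mulVec] at h2
    ext v
    obtain ⟨v, rfl⟩ := D.surjective v
    rw [coord_eq_sum v]
    simp only [map_sum, map_smul]
    exact Finset.sum_congr rfl fun i _ => by rw [congrFun h2 i]
  have h3 : ∀ v, S (b v) = v := by
    intro v
    obtain ⟨v, rfl⟩ := D.surjective v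
    rw [hSα, hrow, Matrix.mulVec_mulVec, Matrix.nonsing_inv_mul _ hu', Matrix.one_mulVec]
  rw [ContinuousLinearMap.inverse_eq (ContinuousLinearMap.ext h1) (ContinuousLinearMap.ext h3),
    hSα]

end Frame

/-! ### Nondegeneracy of the Poisson tensor -/

section Pointwise

variable {m : ℕ} {M : Type*} [TopologicalSpace M] [ChartedSpace (Coord m) M]
  {g : BilinField m M} {I J : EndField m M}

/-- The tautological frame of the tangent space at `x`. -/
def idFrame (x : M) : Coord m ≃L[ℝ] TangentSpace (𝓡 m) x := ContinuousLinearEquiv.refl ℝ (Coord m)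

lemma sharp_frame {x : M} (D : Coord m ≃L[ℝ] TangentSpace (𝓡 m) x)
    (hs : ∀ v w, g x v w = g x w v) (hp : ∀ v, v ≠ 0 → 0 < g x v v)
    (α : TangentSpace (𝓡 m) x →L[ℝ] ℝ) :
    sharp g x α = D (WithLp.toLp 2 ((bilMat D (g x))⁻¹ *ᵥ
      fun i => α (D (EuclideanSpace.single i 1)))) := by
  rw [sharp, inverse_bilin D ((Matrix.isUnit_iff_isUnit_det _).1 (bilMat_posDef D hs hp).isUnit),
    bilMat_symm D hs]

/-- For a positive definite metric, `sharp` is a genuine inverse of `v ↦ g(v, ·)`. -/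
lemma apply_sharp {x : M} (hs : ∀ v w, g x v w = g x w v) (hp : ∀ v, v ≠ 0 → 0 < g x v v)
    (α : TangentSpace (𝓡 m) x →L[ℝ] ℝ) (w : TangentSpace (𝓡 m) x) :
    g x (sharp g x α) w = α w := by
  have hu := (Matrix.isUnit_iff_isUnit_det _).1 (bilMat_posDef (idFrame x) hs hp).isUnit
  obtain ⟨w, rfl⟩ := (idFrame x).surjective w
  rw [sharp_frame (idFrame x) hs hp, hs, ← bilMat_dotProduct]
  simp only [Matrix.mulVec_mulVec, Matrix.mul_nonsing_inv _ hu, Matrix.one_mulVec]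
  conv_rhs => rw [coord_eq_sum w]
  simp only [map_sum, map_smul]
  rfl

/-- The determinant of the commutator `[I, J]`. -/
def commDet (I J : EndField m M) (x : M) : ℝ :=
  LinearMap.det ((I x ∘L J x - J x ∘L I x : TangentSpace (𝓡 m) x →L[ℝ] TangentSpace (𝓡 m) x) :
    TangentSpace (𝓡 m) x →ₗ[ℝ] TangentSpace (𝓡 m) x)

lemma commDet_eq {x : M} (D : Coord m ≃L[ℝ] TangentSpace (𝓡 m) x) :
    commDet I J x = (endMat D (I x) * endMat D (J x) - endMat D (J x) * endMat D (I x)).det := by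
  rw [commDet, ← det_endMat D, endMat_sub, endMat_mul, endMat_mul]

/-- The Poisson tensor is nondegenerate if and only if `[I, J]` is invertible. -/
lemma isNondegenerate_iff (hs : ∀ x v w, g x v w = g x w v) (hp : ∀ x v, v ≠ 0 → 0 < g x v v) :
    IsNondegenerate g I J ↔ ∀ x, commDet I J x ≠ 0 := by
  refine forall_congr' fun x => ⟨fun h h0 => ?_, fun h α hα => ?_⟩
  · -- a vector in the kernel of `[I, J]` gives a covector in the kernel of the Poisson tensor
    rw [commDet_eq (idFrame x)] at h0
    obtain ⟨v, hv, hv0⟩ := Matrix.exists_mulVec_eq_zero_iff.2 h0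
    set w := idFrame x (WithLp.toLp 2 v) with hw
    have hw0 : w ≠ 0 := by simpa [hw] using hv
    have hsw : sharp g x (g x w) = w := by
      by_contra hne
      have h1 := hp x _ (sub_ne_zero.2 hne)
      rw [(g x).map_sub, sub_apply, apply_sharp (hs x) (hp x), sub_self] at h1
      exact lt_irrefl _ h1
    have hQ : I x (J x w) - J x (I x w) = 0 := by
      have h1 : (endMat (idFrame x) (I x ∘L J x - J x ∘L I x)) *ᵥ v = 0 := by
        rw [endMat_sub, endMat_mul, endMat_mul]; exact hv0
      apply (idFrame x).symm.injective
      rw [map_zero]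
      ext k
      have h2 := congrFun h1 k
      rwa [endMat_mulVec (idFrame x) _ (WithLp.toLp 2 v)] at h2
    have h1 := h (g x w) fun β => by rw [poisson, hsw, hQ, map_zero]
    have h2 := hp x w hw0
    rw [h1] at h2
    exact lt_irrefl _ h2
  · set w := sharp g x α with hw
    have hQ : I x (J x w) - J x (I x w) = 0 := by
      by_contra hne
      have h1 := hα (g x (I x (J x w) - J x (I x w)))
      exact (hp x _ hne).ne' h1
    have hw0 : w = 0 := by
      rw [commDet_eq (idFrame x), ← endMat_mul, ← endMat_mul, ← endMat_sub] at h
      by_contra hne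
      apply h
      refine Matrix.exists_mulVec_eq_zero_iff.1 ⟨(idFrame x).symm w, ?_, ?_⟩
      · simpa using hne
      · funext k
        rw [endMat_mulVec, (idFrame x).apply_symm_apply]
        simp [hQ]
    ext v
    rw [← apply_sharp (hs x) (hp x), ← hw, hw0]
    simp

end Pointwise

/-! ### The Ricci potential in a frame -/

section Potential

variable {n : ℕ} {M : Type*} [TopologicalSpace M] [ChartedSpace (Coord (2 * n)) M]
  {g : BilinField (2 * n) M} {I J : EndField (2 * n) M}

lemma det_twoForm_ne_zero {m : ℕ} {K G : Matrix (Fin m) (Fin m) ℝ} (hK : K.det ≠ 0)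
    (hG : G.det ≠ 0) : ((-2 : ℝ) • ((K⁻¹)ᵀ * G)).det ≠ 0 := by
  rw [Matrix.det_smul, Matrix.det_mul, Matrix.det_transpose]
  exact mul_ne_zero (by simp) (mul_ne_zero (Matrix.isUnit_nonsing_inv_det _
    (isUnit_iff_ne_zero.2 hK)).ne_zero hG)

lemma log_det_twoForm {m : ℕ} {K G : Matrix (Fin m) (Fin m) ℝ} (hK : K.det ≠ 0)
    (hG : G.det ≠ 0) : Real.log ((-2 : ℝ) • ((K⁻¹)ᵀ * G)).det =
      Real.log ((-2) ^ m) + Real.log G.det - Real.log K.det := by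
  have h1 : (K⁻¹).det = (K.det)⁻¹ := by rw [Matrix.det_nonsing_inv, Ring.inverse_eq_inv']
  rw [Matrix.det_smul, Matrix.det_mul, Matrix.det_transpose, h1, Fintype.card_fin,
    Real.log_mul (by simp) (mul_ne_zero (inv_ne_zero hK) hG), Real.log_mul (inv_ne_zero hK) hG,
    Real.log_inv]
  ring

/-- The bilinear form `-2 g K⁻¹` is skew when `K` is skew with respect to `g`. -/
lemma twoForm_skew {m : ℕ} {K G : Matrix (Fin m) (Fin m) ℝ} (hK : K.det ≠ 0) (hG : Gᵀ = G)
    (hKG : Kᵀ * G = -(G * K)) : ((-2 : ℝ) • ((K⁻¹)ᵀ * G))ᵀ = -((-2 : ℝ) • ((K⁻¹)ᵀ * G)) := by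
  have hu := isUnit_iff_ne_zero.2 hK
  have h1 : K * K⁻¹ = 1 := Matrix.mul_nonsing_inv _ hu
  have h2 : (K⁻¹)ᵀ * Kᵀ = 1 := by rw [← Matrix.transpose_mul, h1, Matrix.transpose_one]
  have h3 : G * K⁻¹ = -((K⁻¹)ᵀ * G) := by
    linear_combination (norm := noncomm_ring) (K⁻¹)ᵀ * hKG * K⁻¹ - h2 * G * K⁻¹ - (K⁻¹)ᵀ * G * h1
  rw [Matrix.transpose_smul, Matrix.transpose_mul, Matrix.transpose_transpose, hG, h3, smul_neg]

/-- The Ricci potential at a point where `[I, J]` is invertible, in an arbitrary frame. The top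
powers of `F_±` are Pfaffians, whose squares are proportional to `det g / det (I ± J)`. -/
lemma ricciPotential_eq (hg : IsGeneralizedKahler g I J) {x : M} (hx : commDet I J x ≠ 0)
    (D : Coord (2 * n) ≃L[ℝ] TangentSpace (𝓡 (2 * n)) x) :
    ricciPotential g I J x = pairPhi (endMat D (I x)) (endMat D (J x)) := by
  have key : ∀ D : Coord (2 * n) ≃L[ℝ] TangentSpace (𝓡 (2 * n)) x,
      pairPhi (endMat D (I x)) (endMat D (J x)) =
        (1 / 2) * Real.log (LinearMap.det ((I x - J x :
          TangentSpace (𝓡 (2 * n)) x →L[ℝ] TangentSpace (𝓡 (2 * n)) x) :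
          TangentSpace (𝓡 (2 * n)) x →ₗ[ℝ] TangentSpace (𝓡 (2 * n)) x)) -
        (1 / 2) * Real.log (LinearMap.det ((I x + J x :
          TangentSpace (𝓡 (2 * n)) x →L[ℝ] TangentSpace (𝓡 (2 * n)) x) :
          TangentSpace (𝓡 (2 * n)) x →ₗ[ℝ] TangentSpace (𝓡 (2 * n)) x)) := by
    intro D
    rw [pairPhi, ← endMat_sub, ← endMat_add, det_endMat, det_endMat]
  rw [key D, ← key (idFrame x)]
  set D0 := idFrame x (m := 2 * n)
  have hI := endMat_eq_neg_one D0 (hg.sq_I x)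
  have hJ := endMat_eq_neg_one D0 (hg.sq_J x)
  rw [commDet_eq D0] at hx
  have k1 := det_sub_ne_zero hI hJ hx
  have k2 := det_add_ne_zero hI hJ hx
  set G := bilMat D0 (g x) with hG
  have hGs : Gᵀ = G := bilMat_symm D0 (hg.symm x)
  have hGd : G.det ≠ 0 := ((Matrix.isUnit_iff_isUnit_det _).1
    (bilMat_posDef D0 (hg.symm x) (hg.posDef x)).isUnit).ne_zero
  have compat : ∀ A : TangentSpace (𝓡 (2 * n)) x →L[ℝ] TangentSpace (𝓡 (2 * n)) x,
      endMat D0 A * endMat D0 A = -1 → (∀ v w, g x (A v) (A w) = g x v w) →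
        (endMat D0 A)ᵀ * G = -(G * endMat D0 A) := by
    intro A h1 h2
    have h3 := bilMat_orth D0 h2
    rw [← hG] at h3
    linear_combination (norm := noncomm_ring) -h3 * endMat D0 A + (endMat D0 A)ᵀ * G * h1
  have cI := compat (I x) hI (hg.compat_I x)
  have cJ := compat (J x) hJ (hg.compat_J x)
  have entry : ∀ A : TangentSpace (𝓡 (2 * n)) x →L[ℝ] TangentSpace (𝓡 (2 * n)) x,
      (endMat D0 A).det ≠ 0 → ∀ i j,
      -2 * g x (ContinuousLinearMap.inverse A (D0 (EuclideanSpace.single i 1)))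
        (D0 (EuclideanSpace.single j 1)) = ((-2 : ℝ) • (((endMat D0 A)⁻¹)ᵀ * G)) i j := by
    intro A hA i j
    rw [inverse_frame D0 hA, ← bilMat_dotProduct]
    simp [Matrix.mul_apply, dotProduct, hG]
  rw [ricciPotential]
  refine (log_wedgePow_div _ _ _ (entry (I x + J x) (by rwa [endMat_add]))
    (entry (I x - J x) (by rwa [endMat_sub])) ?_ ?_ ?_ ?_).trans ?_
  · rw [endMat_add]
    refine twoForm_skew k2 hGs ?_
    rw [Matrix.transpose_add, add_mul, cI, cJ, mul_add, neg_add]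
  · rw [endMat_sub]
    refine twoForm_skew k1 hGs ?_
    rw [Matrix.transpose_sub, sub_mul, cI, cJ, mul_sub]
    abel
  · rw [endMat_add]; exact det_twoForm_ne_zero k2 hGd
  · rw [endMat_sub]; exact det_twoForm_ne_zero k1 hGd
  · rw [endMat_add, endMat_sub, log_det_twoForm k2 hGd, log_det_twoForm k1 hGd, pairPhi]
    ring

end Potential

/-! ### Charts -/

section Charts

variable {m : ℕ} {M : Type*} [TopologicalSpace M] [ChartedSpace (Coord m) M]
  {e : OpenPartialHomeomorph M (Coord m)} {y : Coord m}

lemma mdifferentiable_of_mem_maximalAtlas (he : e ∈ IsManifold.maximalAtlas (𝓡 m) ∞ M) :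
    e.MDifferentiable (𝓡 m) (𝓡 m) := by
  have he1 := IsManifold.maximalAtlas_subset_of_le (I := 𝓡 m) (M := M)
    (show (1 : WithTop ℕ∞) ≤ ∞ by simp) he
  exact ⟨fun _ hx => (mdifferentiableAt_of_mem_maximalAtlas he1 hx).mdifferentiableWithinAt,
    fun _ hx => (mdifferentiableAt_symm_of_mem_maximalAtlas he1 hx).mdifferentiableWithinAt⟩

/-- The coordinate frame of a chart. -/
def chartFrame (he : e ∈ IsManifold.maximalAtlas (𝓡 m) ∞ M) (hy : y ∈ e.target) :
    Coord m ≃L[ℝ] TangentSpace (𝓡 m) (e.symm y) :=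
  (mdifferentiable_of_mem_maximalAtlas he).symm.mfderiv hy

variable {g : BilinField m M} {I J : EndField m M}

lemma commDet_symm (he : e ∈ IsManifold.maximalAtlas (𝓡 m) ∞ M) (hy : y ∈ e.target) :
    commDet I J (e.symm y) =
      (endComp e I y * endComp e J y - endComp e J y * endComp e I y).det :=
  commDet_eq (chartFrame he hy)

namespace IsGeneralizedKahler

variable (h : IsGeneralizedKahler g I J) (he : e ∈ IsManifold.maximalAtlas (𝓡 m) ∞ M)
include h he

lemma posDef_bilinComp (hy : y ∈ e.target) : (bilinComp e g y).PosDef :=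
  bilMat_posDef (chartFrame he hy) (h.symm _) (h.posDef _)

lemma localMetric : LocalMetric e.target (bilinComp e g) where
  isOpen := e.open_target
  smooth := h.smooth_g e he
  symm _ hy := bilMat_symm (chartFrame he hy) (h.symm _)
  unit _ hy := (Matrix.isUnit_iff_isUnit_det _).1 (h.posDef_bilinComp he hy).isUnit

lemma localGK (hn : ∀ x, commDet I J x ≠ 0) :
    LocalGK e.target (bilinComp e g) (endComp e I) (endComp e J) where
  left :=
    { h.localMetric he with
      smooth_end := h.smooth_I e he
      sq := fun _ hy => endMat_eq_neg_one (chartFrame he hy) (h.sq_I _)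
      orth := fun _ hy => bilMat_orth (chartFrame he hy) (h.compat_I _)
      nij := h.integrable_I e he }
  right :=
    { h.localMetric he with
      smooth_end := h.smooth_J e he
      sq := fun _ hy => endMat_eq_neg_one (chartFrame he hy) (h.sq_J _)
      orth := fun _ hy => bilMat_orth (chartFrame he hy) (h.compat_J _)
      nij := h.integrable_J e he }
  torsion := h.torsion e he
  nondeg y hy := by rw [← commDet_symm he hy]; exact hn _

/-- The squared norm of the gradient in a chart. -/
lemma gradSq_symm (hy : y ∈ e.target) {f : M → ℝ}
    (hf : MDifferentiableAt (𝓡 m) 𝓘(ℝ, ℝ) f (e.symm y)) :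
    gradSq g f (e.symm y) = gradNormSq (bilinComp e g) (fun z => f (e.symm z)) y := by
  set D := chartFrame he hy with hD
  have hs : ∀ v w, g (e.symm y) v w = g (e.symm y) w v := h.symm _
  have hp : ∀ v, v ≠ 0 → 0 < g (e.symm y) v v := h.posDef _
  let df : TangentSpace (𝓡 m) (e.symm y) →L[ℝ] ℝ := mfderiv (𝓡 m) 𝓘(ℝ, ℝ) f (e.symm y)
  have hdf : (fun i => df (D (EuclideanSpace.single i 1))) =
      dcov (fun z => f (e.symm z)) y := by
    funext i
    have h1 := mfderiv_comp y hf
      ((mdifferentiable_of_mem_maximalAtlas he).mdifferentiableAt_symm hy)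
    have h2 : dcov (fun z => f (e.symm z)) y i =
        mfderiv (𝓡 m) 𝓘(ℝ, ℝ) (f ∘ e.symm) y (EuclideanSpace.single i (1 : ℝ)) := by
      rw [mfderiv_eq_fderiv]; rfl
    rw [h2, h1]
    rfl
  have h3 : gradSq g f (e.symm y) = df (sharp g (e.symm y) df) := apply_sharp hs hp df _
  rw [h3, sharp_frame D hs hp, hdf, coord_eq_sum (WithLp.toLp 2 _)]
  simp only [map_sum, map_smul]
  rw [gradNormSq, dotProduct]
  exact Finset.sum_congr rfl fun i _ => by rw [← hdf]; rfl

end IsGeneralizedKahler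

end Charts

/-! ### The maximum principle on a compact manifold -/

section Global

/-- A family of functions on a compact space whose time derivative at spatial maxima is at most `C`
grows at most at rate `C`. -/
lemma le_add_mul_of_deriv_at_max_le {M : Type*} [TopologicalSpace M] [CompactSpace M]
    {F : ℝ → M → ℝ} {a b B C : ℝ}
    (hc : ContinuousOn (fun p : ℝ × M => F p.1 p.2) (Set.Icc a b ×ˢ Set.univ))
    (hd : ∀ t ∈ Set.Ioc a b, ∀ x, (∀ x', F t x' ≤ F t x) →
      ∃ D, HasDerivAt (fun s => F s x) D t ∧ D ≤ C)
    (hB : ∀ x, F a x ≤ B) {t : ℝ} (ht : t ∈ Set.Icc a b) (x : M) :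
    F t x ≤ B + C * (t - a) := by
  by_contra! hlt
  have hat : a < t := by
    refine lt_of_le_of_ne ht.1 ?_
    rintro rfl
    have := hB x
    simp at hlt
    linarith
  -- half of the excess at `(t, x)` is spent on the slope, so that the derivative at a space-time
  -- maximum of `F - (C + δ)(t - a)` is strictly negative
  set δ : ℝ := (F t x - (B + C * (t - a))) / (2 * (t - a)) with hδ
  have hta : 0 < t - a := sub_pos.2 hat
  have hδ0 : 0 < δ := div_pos (sub_pos.2 hlt) (by positivity)
  have hδ1 : δ * (t - a) = (F t x - (B + C * (t - a))) / 2 := by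
    rw [hδ]; field_simp
  set ψ : ℝ × M → ℝ := fun p => F p.1 p.2 - (C + δ) * (p.1 - a) with hψ
  have hcψ : ContinuousOn ψ (Set.Icc a t ×ˢ Set.univ) :=
    (hc.mono (Set.prod_mono (Set.Icc_subset_Icc_right ht.2) le_rfl)).sub
      (Continuous.continuousOn (by fun_prop))
  obtain ⟨⟨s, z⟩, hsz, hmax⟩ := (isCompact_Icc.prod isCompact_univ).exists_isMaxOn
    ⟨(t, x), ⟨⟨ht.1, le_rfl⟩, Set.mem_univ _⟩⟩ hcψ
  have hs : s ∈ Set.Icc a t := hsz.1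
  have hmax' : ∀ r ∈ Set.Icc a t, ∀ w, ψ (r, w) ≤ ψ (s, z) := fun r hr w =>
    hmax (show (r, w) ∈ Set.Icc a t ×ˢ Set.univ from ⟨hr, Set.mem_univ _⟩)
  have h1 : B < ψ (s, z) := by
    refine lt_of_lt_of_le ?_ (hmax' t ⟨ht.1, le_rfl⟩ x)
    simp only [hψ]
    linarith
  have has : a < s := by
    refine lt_of_le_of_ne hs.1 ?_
    rintro rfl
    have := hB z
    simp only [hψ, sub_self, mul_zero, sub_zero] at h1
    linarith
  obtain ⟨D, hD, hDC⟩ := hd s ⟨has, hs.2.trans ht.2⟩ z fun w => by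
    have := hmax' s hs w
    simp only [hψ] at this
    linarith
  have hψd : HasDerivAt (fun r => ψ (r, z)) (D - (C + δ)) s := by
    have := hD.sub (((hasDerivAt_id s).sub_const a).const_mul (C + δ))
    simpa [hψ] using! this
  have hloc : IsLocalMaxOn (fun r => ψ (r, z)) (Set.Icc a s) s :=
    Filter.eventually_of_mem self_mem_nhdsWithin fun r hr => hmax' r ⟨hr.1, hr.2.trans hs.2⟩ z
  have hcone : a - s ∈ posTangentConeAt (Set.Icc a s) s :=
    sub_mem_posTangentConeAt_of_segment_subset (by rw [segment_symm, segment_eq_Icc has.le])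
  have h2 := hloc.hasFDerivWithinAt_nonpos hψd.hasDerivWithinAt.hasFDerivWithinAt hcone
  simp only [ContinuousLinearMap.toSpanSingleton_apply, smul_eq_mul] at h2
  nlinarith

/-- At a global maximum the Laplacian, computed in any chart, is nonpositive. -/
lemma lapl_nonpos_of_max {m : ℕ} {M : Type*} [TopologicalSpace M]
    {e : OpenPartialHomeomorph M (Coord m)} {x : M} (hx : x ∈ e.source)
    {G : Coord m → Matrix (Fin m) (Fin m) ℝ} (hG : LocalMetric e.target G)
    (hN : ((G (e x))⁻¹).PosSemidef) {F : M → ℝ} {f : Coord m → ℝ}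
    (hf : ContDiffOn ℝ ∞ f e.target) (hFf : ∀ z ∈ e.target, F (e.symm z) = f z)
    (hmax : ∀ x', F x' ≤ F x) : dcov f (e x) = 0 ∧ lapl G f (e x) ≤ 0 := by
  have hy := e.map_source hx
  refine hG.lapl_nonpos_of_isLocalMax hN hf hy
    (Filter.eventually_of_mem (e.open_target.mem_nhds hy) fun z hz => ?_)
  rw [← hFf z hz, ← hFf _ hy, e.left_inv hx]
  exact hmax _

variable {m : ℕ} {M : Type*} [TopologicalSpace M] [ChartedSpace (Coord m) M]

/-- Joint continuity in space-time is checked in charts. -/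
lemma continuousOn_of_charts [IsManifold (𝓡 m) ∞ M] {S : Set ℝ} {F : ℝ → M → ℝ}
    (h : ∀ e ∈ IsManifold.maximalAtlas (𝓡 m) ∞ M,
      ContinuousOn (fun p : ℝ × Coord m => F p.1 (e.symm p.2)) (S ×ˢ e.target)) :
    ContinuousOn (fun p : ℝ × M => F p.1 p.2) (S ×ˢ Set.univ) := by
  rintro ⟨t, x⟩ ⟨ht, -⟩
  set e := chartAt (Coord m) x with he
  have hx : x ∈ e.source := mem_chart_source _ x
  have h1 : ContinuousOn (fun p : ℝ × M => F p.1 (e.symm (e p.2))) (S ×ˢ e.source) :=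
    (h e (IsManifold.chart_mem_maximalAtlas x)).comp (f := fun p : ℝ × M => (p.1, e p.2))
      (continuousOn_fst.prodMk (e.continuousOn.comp continuousOn_snd fun p hp => hp.2))
      fun p hp => ⟨hp.1, e.map_source hp.2⟩
  have h2 : ContinuousOn (fun p : ℝ × M => F p.1 p.2) (S ×ˢ e.source) :=
    h1.congr fun p hp => by simp only [e.left_inv hp.2]
  refine (h2 (t, x) ⟨ht, hx⟩).mono_of_mem_nhdsWithin ?_
  rw [nhdsWithin_prod_eq]
  exact Filter.prod_mem_prod self_mem_nhdsWithin
    (mem_nhdsWithin_of_mem_nhds (e.open_source.mem_nhds hx))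

lemma timeSet_mem_nhds {T : EReal} {t : ℝ} (ht : 0 < t) (htT : (t : EReal) < T) :
    timeSet T ∈ nhds t := by
  refine Filter.inter_mem (Ici_mem_nhds ht) ?_
  exact (isOpen_Iio.preimage continuous_coe_real_ereal).mem_nhds htT

namespace IsGKRFSolution

variable {T : EReal} {g : ℝ → BilinField m M} {I J : ℝ → EndField m M}
  (h : IsGKRFSolution T g I J) {e : OpenPartialHomeomorph M (Coord m)}
include h

/-- A nondegenerate solution of the flow in a chart. -/
lemma localFlow (he : e ∈ IsManifold.maximalAtlas (𝓡 m) ∞ M) {τ : ℝ}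
    (hτ : ∀ t < τ, (t : EReal) < T)
    (hn : ∀ t ∈ Set.Ioo 0 τ, ∀ x, commDet (I t) (J t) x ≠ 0) :
    LocalFlow (Set.Ioo 0 τ) e.target (fun s => bilinComp e (g s)) (fun s => endComp e (I s))
      (fun s => endComp e (J s)) := by
  have hsub : Set.Ioo 0 τ ⊆ timeSet T := fun t ht => ⟨ht.1.le, hτ t ht.2⟩
  have hnhds : ∀ t ∈ Set.Ioo 0 τ, timeSet T ∈ nhds t := fun t ht =>
    timeSet_mem_nhds ht.1 (hτ t ht.2)
  have hsub2 : Set.Ioo 0 τ ×ˢ e.target ⊆ timeSet T ×ˢ e.target := Set.prod_mono hsub le_rfl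
  exact
    { isOpen_time := isOpen_Ioo
      gk := fun t ht => (h.isGK t (hsub ht)).localGK he (hn t ht)
      isOpen_space := e.open_target
      inv_pos := fun t ht y hy => ((h.isGK t (hsub ht)).posDef_bilinComp he hy).inv.posSemidef
      smooth_g := fun i j => (h.smooth_g e he i j).mono hsub2
      smooth_I := fun i j => (h.smooth_I e he i j).mono hsub2
      smooth_J := fun i j => (h.smooth_J e he i j).mono hsub2
      evol_g := fun y hy t ht i j =>
        (h.evol_g e he y hy t (hsub ht) i j).hasDerivAt (hnhds t ht)
      evol_I := fun y hy t ht i j =>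
        (h.evol_I e he y hy t (hsub ht) i j).hasDerivAt (hnhds t ht)
      evol_J := fun y hy t ht i j =>
        (h.evol_J e he y hy t (hsub ht) i j).hasDerivAt (hnhds t ht) }

lemma smooth_comm (he : e ∈ IsManifold.maximalAtlas (𝓡 m) ∞ M) :
    SmoothMat (fun p : ℝ × Coord m => endComp e (I p.1) p.2 * endComp e (J p.1) p.2 -
      endComp e (J p.1) p.2 * endComp e (I p.1) p.2) (timeSet T ×ˢ e.target) := by
  have hI : SmoothMat (fun p : ℝ × Coord m => endComp e (I p.1) p.2) (timeSet T ×ˢ e.target) :=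
    h.smooth_I e he
  have hJ : SmoothMat (fun p : ℝ × Coord m => endComp e (J p.1) p.2) (timeSet T ×ˢ e.target) :=
    h.smooth_J e he
  exact (hI.mul hJ).sub (hJ.mul hI)

lemma continuousOn_commDet [IsManifold (𝓡 m) ∞ M] :
    ContinuousOn (fun p : ℝ × M => commDet (I p.1) (J p.1) p.2) (timeSet T ×ˢ Set.univ) := by
  refine continuousOn_of_charts (m := m) (F := fun t x => commDet (I t) (J t) x) fun e he => ?_
  exact (h.smooth_comm he).det.continuousOn.congr fun p hp => commDet_symm he hp.2

/-- The error term in the evolution of `log |det [I, J]|` is bounded on compact time intervals, in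
suitable charts. -/
lemma exists_volError_bound [CompactSpace M] [IsManifold (𝓡 m) ∞ M] {a b : ℝ} (ha : 0 < a)
    (hb : (b : EReal) < T) : ∃ C, ∀ t ∈ Set.Icc a b, ∀ x : M,
      ∃ e ∈ IsManifold.maximalAtlas (𝓡 m) ∞ M, x ∈ e.source ∧
        -C ≤ LocalGK.volError (bilinComp e (g t)) (endComp e (I t)) (endComp e (J t)) (e x) := by
  let P : ℝ → ℝ × M → Prop := fun C p =>
    ∃ e ∈ IsManifold.maximalAtlas (𝓡 m) ∞ M, p.2 ∈ e.source ∧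
    -C ≤ LocalGK.volError (bilinComp e (g p.1)) (endComp e (I p.1)) (endComp e (J p.1)) (e p.2)
  have hP : ∀ C C' p, C ≤ C' → P C p → P C' p := by
    rintro C C' p hC ⟨e, he, hx, h2⟩
    exact ⟨e, he, hx, (neg_le_neg hC).trans h2⟩
  have key : ∃ C, ∀ p ∈ Set.Icc a b ×ˢ (Set.univ : Set M), P C p := by
    refine (isCompact_Icc.prod isCompact_univ).induction_on
      (p := fun s => ∃ C, ∀ p ∈ s, P C p) ⟨0, by simp⟩ ?_ ?_ ?_
    · rintro s s' hs ⟨C, hC⟩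
      exact ⟨C, fun p hp => hC p (hs hp)⟩
    · rintro s s' ⟨C, hC⟩ ⟨C', hC'⟩
      refine ⟨max C C', ?_⟩
      rintro p (hp | hp)
      · exact hP _ _ _ (le_max_left _ _) (hC p hp)
      · exact hP _ _ _ (le_max_right _ _) (hC' p hp)
    · rintro ⟨t, x⟩ ⟨ht, -⟩
      set e := chartAt (Coord m) x
      have he : e ∈ IsManifold.maximalAtlas (𝓡 m) ∞ M := IsManifold.chart_mem_maximalAtlas x
      have hx : x ∈ e.source := mem_chart_source _ x
      have htT : (t : EReal) < T := lt_of_le_of_lt (EReal.coe_le_coe_iff.2 ht.2) hb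
      have ht0 : 0 < t := ha.trans_le ht.1
      set Ω : Set (ℝ × Coord m) := interior (timeSet T) ×ˢ e.target with hΩ
      have hsub : Ω ⊆ timeSet T ×ˢ e.target := Set.prod_mono interior_subset le_rfl
      have hc := continuousOn_volError (G := fun s => bilinComp e (g s))
        (I := fun s => endComp e (I s)) (J := fun s => endComp e (J s))
        (isOpen_interior.prod e.open_target : IsOpen Ω)
        (fun i j => (h.smooth_g e he i j).mono hsub) (fun i j => (h.smooth_I e he i j).mono hsub)
        (fun i j => (h.smooth_J e he i j).mono hsub)
        fun p hp => ((h.isGK p.1 (hsub hp).1).localMetric he).unit p.2 hp.2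
      have hti : t ∈ interior (timeSet T) := mem_interior_iff_mem_nhds.2 (timeSet_mem_nhds ht0 htT)
      have hmem : (t, e x) ∈ Ω := ⟨hti, e.map_source hx⟩
      have hca := hc.continuousAt ((isOpen_interior.prod e.open_target).mem_nhds hmem)
      have hcb : ContinuousAt (fun p : ℝ × M => LocalGK.volError (bilinComp e (g p.1))
          (endComp e (I p.1)) (endComp e (J p.1)) (e p.2)) (t, x) :=
        ContinuousAt.comp (f := fun p : ℝ × M => (p.1, e p.2)) (x := (t, x)) hca
          (continuousAt_fst.prodMk ((e.continuousAt hx).comp continuousAt_snd))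
      set v := LocalGK.volError (bilinComp e (g t)) (endComp e (I t)) (endComp e (J t)) (e x)
      have h1 : ∀ᶠ p in nhds (t, x), LocalGK.volError (bilinComp e (g p.1))
          (endComp e (I p.1)) (endComp e (J p.1)) (e p.2) ∈ Set.Ioi (v - 1) :=
        hcb (Ioi_mem_nhds (by simp [v]))
      have h2 : ∀ᶠ p : ℝ × M in nhds (t, x), p.2 ∈ e.source :=
        continuousAt_snd.eventually (e.open_source.mem_nhds hx)
      refine ⟨_, mem_nhdsWithin_of_mem_nhds (h1.and h2), |v| + 1, fun p hp => ?_⟩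
      have hp1 : _ ∈ Set.Ioi (v - 1) := hp.1
      exact ⟨e, he, hp.2, le_trans (by linarith [neg_abs_le v]) hp1.le⟩
  obtain ⟨C, hC⟩ := key
  exact ⟨C, fun t ht x => hC (t, x) ⟨ht, Set.mem_univ _⟩⟩

/-- Nondegeneracy is preserved. Before the first time `τ` at which `[I, J]` degenerates,
`-log |det [I, J]|` obeys the maximum principle with the error term `volError`, which is bounded
up to and including `τ`; so it stays bounded and `det [I, J]` does not reach zero. -/
lemma commDet_ne_zero [CompactSpace M] [IsManifold (𝓡 m) ∞ M]
    (h0 : ∀ x, commDet (I 0) (J 0) x ≠ 0) {t : ℝ} (ht : t ∈ timeSet T) (x : M) :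
    commDet (I t) (J t) x ≠ 0 := by
  intro hx
  have hIcc : Set.Icc 0 t ⊆ timeSet T := fun s hs =>
    ⟨hs.1, lt_of_le_of_lt (EReal.coe_le_coe_iff.2 hs.2) ht.2⟩
  have hcont := h.continuousOn_commDet
  -- the compact set of degenerate times, and its smallest element `τ`
  set Z : Set (ℝ × M) := {p ∈ Set.Icc 0 t ×ˢ (Set.univ : Set M) |
    commDet (I p.1) (J p.1) p.2 = 0} with hZ
  have hZc : IsCompact Z := by
    have hK : IsCompact (Set.Icc 0 t ×ˢ (Set.univ : Set M)) := isCompact_Icc.prod isCompact_univ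
    exact hK.of_isClosed_subset
      ((hcont.mono (Set.prod_mono hIcc le_rfl)).preimage_isClosed_of_isClosed
        (isClosed_Icc.prod isClosed_univ) isClosed_singleton) fun p hp => hp.1
  obtain ⟨⟨τ, z⟩, hτz, hmin⟩ := hZc.exists_isMinOn
    ⟨(t, x), ⟨⟨⟨ht.1, le_rfl⟩, Set.mem_univ _⟩, hx⟩⟩ continuousOn_fst
  have hτ : τ ∈ Set.Icc 0 t := hτz.1.1
  have hτ0 : commDet (I τ) (J τ) z = 0 := hτz.2
  have hn : ∀ s, 0 ≤ s → s < τ → ∀ w, commDet (I s) (J s) w ≠ 0 := by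
    intro s hs hsτ w hw
    exact absurd (hmin (show (s, w) ∈ Z from ⟨⟨⟨hs, hsτ.le.trans hτ.2⟩, Set.mem_univ _⟩, hw⟩))
      (not_le.2 hsτ)
  have hτpos : 0 < τ := by
    refine lt_of_le_of_ne hτ.1 ?_
    rintro rfl
    exact h0 z hτ0
  have hτT : (τ : EReal) < T := (hIcc hτ).2
  have hflow := fun e he => h.localFlow (e := e) he (τ := τ)
    (fun s hs => lt_trans (EReal.coe_lt_coe_iff.2 hs) hτT) fun s hs => hn s hs.1.le hs.2
  obtain ⟨C, hC⟩ := h.exists_volError_bound (half_pos hτpos) hτT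
  set L : ℝ → M → ℝ := fun s w => -Real.log (commDet (I s) (J s) w) with hL
  have hLc : ContinuousOn (fun p : ℝ × M => L p.1 p.2) (Set.Ico 0 τ ×ˢ Set.univ) :=
    ((hcont.mono (Set.prod_mono (fun s hs => hIcc ⟨hs.1, hs.2.le.trans hτ.2⟩) le_rfl)).log
      fun p hp => hn p.1 hp.1.1 hp.1.2 p.2).neg
  obtain ⟨B, hB⟩ : ∃ B, ∀ w, L (τ / 2) w ≤ B := by
    have h1 : ContinuousOn (fun w : M => L (τ / 2) w) Set.univ :=
      hLc.comp (f := fun w : M => (τ / 2, w)) (by fun_prop)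
        fun w _ => ⟨⟨by linarith, by linarith⟩, Set.mem_univ _⟩
    obtain ⟨B, hB⟩ := isCompact_univ.bddAbove_image h1
    exact ⟨B, fun w => hB ⟨w, Set.mem_univ _, rfl⟩⟩
  have hbound : ∀ s ∈ Set.Ico (τ / 2) τ, ∀ w, L s w ≤ B + C * (s - τ / 2) := by
    intro s hs w
    refine le_add_mul_of_deriv_at_max_le (a := τ / 2) (b := s) (hLc.mono (Set.prod_mono
      (fun r hr => ⟨by linarith [hr.1], lt_of_le_of_lt hr.2 hs.2⟩) le_rfl)) ?_ hB ⟨hs.1, le_rfl⟩ w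
    intro r hr w' hmax
    have hr0 : r ∈ Set.Ioo 0 τ := ⟨by linarith [hr.1], lt_of_le_of_lt hr.2 hs.2⟩
    obtain ⟨e, he, hwe, hCl⟩ := hC r ⟨hr.1.le, hr0.2.le⟩ w'
    have hF := hflow e he
    have hg := hF.gk r hr0
    have hy := e.map_source hwe
    have eqn : ∀ r ∈ Set.Ioo 0 τ, ∀ y ∈ e.target,
        L r (e.symm y) = -1 * pairVol (endComp e (I r) y) (endComp e (J r) y) := by
      intro r hr y hy
      have hg := hF.gk r hr
      rw [pairVol_eq (hg.left.sq y hy) (hg.right.sq y hy) (hg.nondeg y hy), neg_one_mul]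
      simp only [hL, commDet_symm he hy]
    obtain ⟨hd0, hl⟩ := lapl_nonpos_of_max hwe hg.left.toLocalMetric (hF.inv_pos r hr0 _ hy)
      (F := L r) (contDiffOn_const.mul hg.smooth_pairVol) (eqn r hr0) hmax
    have hq : dcov (fun z => pairVol (endComp e (I r) z) (endComp e (J r) z)) (e w') = 0 := by
      funext i
      have h1 := congrFun hd0 i
      rw [dcov, pd_const_mul (differentiableAt_of_smooth e.open_target hg.smooth_pairVol hy)] at h1
      simpa [dcov] using h1
    rw [hg.left.toLocalMetric.lapl_const_mul _ hg.smooth_pairVol hy] at hl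
    have hder := (hF.hasDerivAt_pairVol hr0 hy hq).const_mul (-1)
    refine ⟨_, hder.congr_of_eventuallyEq ?_, by linarith⟩
    filter_upwards [isOpen_Ioo.mem_nhds hr0] with r' hr'
    rw [← eqn r' hr' _ hy, e.left_inv hwe]
  -- hence `|det [I, J]|` stays away from zero as time tends to `τ`
  have hlow : ∀ s ∈ Set.Ico (τ / 2) τ,
      Real.exp (-(B + |C| * τ)) ≤ |commDet (I s) (J s) z| := by
    intro s hs
    have hne := hn s (by linarith [hs.1]) hs.2 z
    rw [← Real.le_log_iff_exp_le (abs_pos.2 hne), Real.log_abs]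
    have h1 := hbound s hs z
    have h2 : C * (s - τ / 2) ≤ |C| * τ := by
      have h3 : 0 ≤ s - τ / 2 := by linarith [hs.1]
      calc C * (s - τ / 2) ≤ |C| * (s - τ / 2) := mul_le_mul_of_nonneg_right (le_abs_self C) h3
        _ ≤ |C| * τ := mul_le_mul_of_nonneg_left (by linarith [hs.2]) (abs_nonneg C)
    simp only [hL] at h1
    linarith
  have hlim : ContinuousWithinAt (fun s => |commDet (I s) (J s) z|) (Set.Ico (τ / 2) τ) τ := by
    have h1 : ContinuousWithinAt (fun s => commDet (I s) (J s) z) (timeSet T) τ :=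
      ContinuousWithinAt.comp (f := fun s : ℝ => (s, z)) (t := timeSet T ×ˢ Set.univ)
        (hcont (τ, z) ⟨hIcc hτ, Set.mem_univ _⟩) (by fun_prop) fun s hs => ⟨hs, Set.mem_univ _⟩
    exact (h1.mono fun s hs => hIcc ⟨by linarith [hs.1], hs.2.le.trans hτ.2⟩).abs
  have hne : (nhdsWithin τ (Set.Ico (τ / 2) τ)).NeBot := by
    rw [← mem_closure_iff_nhdsWithin_neBot, closure_Ico (by linarith)]
    exact ⟨by linarith, le_rfl⟩
  have := ge_of_tendsto hlim (Filter.eventually_of_mem self_mem_nhdsWithin hlow)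
  simp only [hτ0, abs_zero] at this
  exact absurd this (not_le.2 (Real.exp_pos _))

end IsGKRFSolution

end Global

/-! ### The Ricci potential along the flow -/

section Estimate

variable {n : ℕ} {M : Type*} [TopologicalSpace M] [ChartedSpace (Coord (2 * n)) M]

/-- The Ricci potential in a chart. -/
lemma IsGeneralizedKahler.ricciPotential_symm {g : BilinField (2 * n) M} {I J : EndField (2 * n) M}
    (h : IsGeneralizedKahler g I J) (hn : ∀ x, commDet I J x ≠ 0)
    {e : OpenPartialHomeomorph M (Coord (2 * n))}
    (he : e ∈ IsManifold.maximalAtlas (𝓡 (2 * n)) ∞ M) {y : Coord (2 * n)} (hy : y ∈ e.target) :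
    ricciPotential g I J (e.symm y) = pairPhi (endComp e I y) (endComp e J y) :=
  ricciPotential_eq h (hn _) (chartFrame he hy)

/-- The Ricci potential of a nondegenerate structure is differentiable. -/
lemma IsGeneralizedKahler.mdifferentiable_ricciPotential [IsManifold (𝓡 (2 * n)) ∞ M]
    {g : BilinField (2 * n) M} {I J : EndField (2 * n) M}
    (h : IsGeneralizedKahler g I J) (hn : ∀ x, commDet I J x ≠ 0) :
    MDifferentiable (𝓡 (2 * n)) 𝓘(ℝ, ℝ) (ricciPotential g I J) := by
  intro x
  set e := chartAt (Coord (2 * n)) x with he'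
  have he : e ∈ IsManifold.maximalAtlas (𝓡 (2 * n)) ∞ M := IsManifold.chart_mem_maximalAtlas x
  have hx : x ∈ e.source := mem_chart_source _ x
  have hs := (h.localGK he hn).smooth_pairPhi
  have h1 : MDifferentiableAt (𝓡 (2 * n)) 𝓘(ℝ, ℝ)
      (fun z => pairPhi (endComp e I z) (endComp e J z)) (e x) :=
    mdifferentiableAt_iff_differentiableAt.2
      (differentiableAt_of_smooth e.open_target hs (e.map_source hx))
  have h2 := h1.comp x ((mdifferentiable_of_mem_maximalAtlas he).mdifferentiableAt hx)
  refine h2.congr_of_eventuallyEq ?_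
  filter_upwards [e.open_source.mem_nhds hx] with w hw
  rw [Function.comp_apply, ← h.ricciPotential_symm hn he (e.map_source hw), e.left_inv hw]

variable {T : EReal} {g : ℝ → BilinField (2 * n) M} {I J : ℝ → EndField (2 * n) M}

namespace IsGKRFSolution

variable (h : IsGKRFSolution T g I J)
include h

/-- The Ricci potential is continuous in space-time, up to the initial time. -/
lemma continuousOn_ricciPotential [IsManifold (𝓡 (2 * n)) ∞ M]
    (hn : ∀ t ∈ timeSet T, ∀ x, commDet (I t) (J t) x ≠ 0) :
    ContinuousOn (fun p : ℝ × M => ricciPotential (g p.1) (I p.1) (J p.1) p.2)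
      (timeSet T ×ˢ Set.univ) := by
  refine continuousOn_of_charts (m := 2 * n) (F := fun t x => ricciPotential (g t) (I t) (J t) x)
    fun e he => ?_
  have hI : SmoothMat (fun p : ℝ × Coord (2 * n) => endComp e (I p.1) p.2)
    (timeSet T ×ˢ e.target) := h.smooth_I e he
  have hJ : SmoothMat (fun p : ℝ × Coord (2 * n) => endComp e (J p.1) p.2)
    (timeSet T ×ˢ e.target) := h.smooth_J e he
  have hg := fun p (hp : p ∈ timeSet T ×ˢ e.target) => (h.isGK p.1 hp.1).localGK he (hn p.1 hp.1)
  have hc : ContinuousOn (fun p : ℝ × Coord (2 * n) =>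
      pairPhi (endComp e (I p.1) p.2) (endComp e (J p.1) p.2)) (timeSet T ×ˢ e.target) :=
    (continuousOn_const.mul ((hI.sub hJ).det.continuousOn.log fun p hp => det_sub_ne_zero
      ((hg p hp).left.sq _ hp.2) ((hg p hp).right.sq _ hp.2) ((hg p hp).nondeg _ hp.2))).sub
    (continuousOn_const.mul ((hI.add hJ).det.continuousOn.log fun p hp => det_add_ne_zero
      ((hg p hp).left.sq _ hp.2) ((hg p hp).right.sq _ hp.2) ((hg p hp).nondeg _ hp.2)))
  exact hc.congr fun p hp => (h.isGK p.1 hp.1).ricciPotential_symm (hn p.1 hp.1) he hp.2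

/-- The maximum principle for the Ricci potential. -/
lemma abs_ricciPotential_le [CompactSpace M] [IsManifold (𝓡 (2 * n)) ∞ M]
    (hn : ∀ t ∈ timeSet T, ∀ x, commDet (I t) (J t) x ≠ 0) {B : ℝ}
    (hB : ∀ x, |ricciPotential (g 0) (I 0) (J 0) x| ≤ B) {t : ℝ} (ht : t ∈ timeSet T) (x : M) :
    |ricciPotential (g t) (I t) (J t) x| ≤ B := by
  have key : ∀ c : ℝ, (∀ x, c * ricciPotential (g 0) (I 0) (J 0) x ≤ B) →
      c * ricciPotential (g t) (I t) (J t) x ≤ B := by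
    intro c hB
    have hIcc : Set.Icc 0 t ⊆ timeSet T := fun s hs =>
      ⟨hs.1, lt_of_le_of_lt (EReal.coe_le_coe_iff.2 hs.2) ht.2⟩
    have := le_add_mul_of_deriv_at_max_le (a := 0) (b := t) (C := 0) (B := B)
      (F := fun s x => c * ricciPotential (g s) (I s) (J s) x)
      (continuousOn_const.mul ((h.continuousOn_ricciPotential hn).mono
        (Set.prod_mono hIcc le_rfl))) ?_ hB ⟨ht.1, le_rfl⟩ x
    · simpa using this
    intro s hs w hmax
    obtain ⟨b, hsb, hbT⟩ := EReal.lt_iff_exists_real_btwn.1 (hIcc ⟨hs.1.le, hs.2⟩).2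
    have hb : ∀ r < b, (r : EReal) < T := fun r hr => (EReal.coe_lt_coe_iff.2 hr).trans hbT
    have hsb' : s ∈ Set.Ioo 0 b := ⟨hs.1, EReal.coe_lt_coe_iff.1 hsb⟩
    set e := chartAt (Coord (2 * n)) w
    have he : e ∈ IsManifold.maximalAtlas (𝓡 (2 * n)) ∞ M := IsManifold.chart_mem_maximalAtlas w
    have hw : w ∈ e.source := mem_chart_source _ w
    have hy := e.map_source hw
    have hF := h.localFlow he hb fun r hr => hn r ⟨hr.1.le, hb r hr.2⟩
    have hg := hF.gk s hsb'
    have eqn : ∀ r ∈ Set.Ioo 0 b, ∀ y ∈ e.target, c * ricciPotential (g r) (I r) (J r) (e.symm y) =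
        c * pairPhi (endComp e (I r) y) (endComp e (J r) y) := fun r hr y hy => by
      have hr' : r ∈ timeSet T := ⟨hr.1.le, hb r hr.2⟩
      rw [(h.isGK r hr').ricciPotential_symm (hn r hr') he hy]
    obtain ⟨-, hl⟩ := lapl_nonpos_of_max hw hg.left.toLocalMetric (hF.inv_pos s hsb' _ hy)
      (F := fun x => c * ricciPotential (g s) (I s) (J s) x)
      (contDiffOn_const.mul hg.smooth_pairPhi) (eqn s hsb') hmax
    rw [hg.left.toLocalMetric.lapl_const_mul _ hg.smooth_pairPhi hy] at hl
    refine ⟨_, ((hF.hasDerivAt_pairPhi hsb' hy).const_mul c).congr_of_eventuallyEq ?_, hl⟩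
    filter_upwards [isOpen_Ioo.mem_nhds hsb'] with r hr
    rw [← eqn r hr _ hy, e.left_inv hw]
  rw [abs_le]
  have h1 := key 1 fun x => by rw [one_mul]; exact (le_abs_self _).trans (hB x)
  have h2 := key (-1) fun x => by rw [neg_one_mul]; exact (neg_le_abs _).trans (hB x)
  constructor <;> linarith

/-- Bernstein's estimate, started at a positive time `c`: Bernstein's quantity is controlled only at
interior times, while the bound on `|Φ|` is available up to time zero. -/
lemma sub_mul_gradSq_le [CompactSpace M] [IsManifold (𝓡 (2 * n)) ∞ M]
    (hn : ∀ t ∈ timeSet T, ∀ x, commDet (I t) (J t) x ≠ 0) {B : ℝ}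
    (hB : ∀ x, |ricciPotential (g 0) (I 0) (J 0) x| ≤ B) {c t : ℝ} (hc : 0 < c) (hct : c ≤ t)
    (ht : (t : EReal) < T) (x : M) :
    (t - c) * gradSq (g t) (ricciPotential (g t) (I t) (J t)) x ≤ (1 / 2) * B ^ 2 := by
  obtain ⟨b, htb, hbT⟩ := EReal.lt_iff_exists_real_btwn.1 ht
  have hb : ∀ r < b, (r : EReal) < T := fun r hr => (EReal.coe_lt_coe_iff.2 hr).trans hbT
  have htb' : t < b := EReal.coe_lt_coe_iff.1 htb
  have hsub : Set.Icc c t ⊆ Set.Ioo 0 b := fun s hs => ⟨hc.trans_le hs.1, hs.2.trans_lt htb'⟩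
  have hts : ∀ r ∈ Set.Ioo 0 b, r ∈ timeSet T := fun r hr => ⟨hr.1.le, hb r hr.2⟩
  have hflow := fun e he => h.localFlow (e := e) he hb fun r hr => hn r (hts r hr)
  set F : ℝ → M → ℝ := fun s x => (s - c) * gradSq (g s) (ricciPotential (g s) (I s) (J s)) x +
    (1 / 2) * ricciPotential (g s) (I s) (J s) x ^ 2 with hFdef
  have eqn : ∀ e ∈ IsManifold.maximalAtlas (𝓡 (2 * n)) ∞ M, ∀ r ∈ Set.Ioo 0 b, ∀ y ∈ e.target,
      F r (e.symm y) = bernstein c (fun s => bilinComp e (g s)) (fun s => endComp e (I s))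
        (fun s => endComp e (J s)) r y := by
    intro e he r hr y hy
    have hK := h.isGK r (hts r hr)
    have hnr := hn r (hts r hr)
    have e1 : dcov (fun z => ricciPotential (g r) (I r) (J r) (e.symm z)) y =
        dcov (fun z => pairPhi (endComp e (I r) z) (endComp e (J r) z)) y :=
      funext fun i => pd_congr_on e.open_target (fun z hz => hK.ricciPotential_symm hnr he hz) hy i
    simp only [hFdef, bernstein]
    rw [hK.ricciPotential_symm hnr he hy, hK.gradSq_symm he hy
      (hK.mdifferentiable_ricciPotential hnr _), gradNormSq, gradNormSq, e1]
  have hFc : ContinuousOn (fun p : ℝ × M => F p.1 p.2) (Set.Icc c t ×ˢ Set.univ) :=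
    (continuousOn_of_charts (m := 2 * n) (S := Set.Ioo 0 b) fun e he =>
      ((hflow e he).smooth_bernstein c).continuousOn.congr fun p hp =>
        eqn e he p.1 hp.1 p.2 hp.2).mono (Set.prod_mono hsub le_rfl)
  have hF0 : ∀ x, F c x ≤ (1 / 2) * B ^ 2 := by
    intro x
    have h1 := h.abs_ricciPotential_le hn hB (hts c (hsub ⟨le_rfl, hct⟩)) x
    have h2 := sq_le_sq' (abs_le.1 h1).1 (abs_le.1 h1).2
    simp only [hFdef, sub_self, zero_mul, zero_add]
    linarith
  have hmain := le_add_mul_of_deriv_at_max_le (C := 0) hFc ?_ hF0 ⟨hct, le_rfl⟩ x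
  · have h1 : 0 ≤ ricciPotential (g t) (I t) (J t) x ^ 2 := sq_nonneg _
    simp only [hFdef] at hmain
    linarith
  intro s hs w hmax
  have hsb : s ∈ Set.Ioo 0 b := hsub ⟨hs.1.le, hs.2⟩
  set e := chartAt (Coord (2 * n)) w
  have he : e ∈ IsManifold.maximalAtlas (𝓡 (2 * n)) ∞ M := IsManifold.chart_mem_maximalAtlas w
  have hw : w ∈ e.source := mem_chart_source _ w
  have hy := e.map_source hw
  have hfl := hflow e he
  obtain ⟨-, hl⟩ := lapl_nonpos_of_max hw (hfl.gk s hsb).left.toLocalMetric (hfl.inv_pos s hsb _ hy)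
    ((hfl.smooth_bernstein c).slice fun z hz => ⟨hsb, hz⟩) (eqn e he s hsb) hmax
  obtain ⟨D, hD, hDl⟩ := hfl.exists_hasDerivAt_bernstein hsb hs.1.le hy
  refine ⟨D, hD.congr_of_eventuallyEq ?_, hDl.trans hl⟩
  filter_upwards [isOpen_Ioo.mem_nhds hsb] with r hr
  rw [← eqn e he r hr _ hy, e.left_inv hw]

end IsGKRFSolution

end Estimate

end

end GenKahler

theorem mainTheorem11 {n : ℕ} {M : Type*} [TopologicalSpace M] [T2Space M] [CompactSpace M]
    [ChartedSpace (GenKahler.Coord (2 * n)) M] [IsManifold (𝓡 (2 * n)) ∞ M]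
    (T : EReal) (g : ℝ → GenKahler.BilinField (2 * n) M)
    (I J : ℝ → GenKahler.EndField (2 * n) M)
    (hflow : GenKahler.IsGKRFSolution T g I J)
    (hnondeg : GenKahler.IsNondegenerate (g 0) (I 0) (J 0))
    (t : ℝ) (ht : 0 < t) (htT : (t : EReal) < T) :
    GenKahler.IsNondegenerate (g t) (I t) (J t) ∧
    MDifferentiable (𝓡 (2 * n)) 𝓘(ℝ, ℝ) (GenKahler.ricciPotential (g t) (I t) (J t)) ∧
    BddAbove (Set.range fun x : M =>
      GenKahler.gradSq (g t) (GenKahler.ricciPotential (g t) (I t) (J t)) x) ∧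
    BddAbove (Set.range fun x : M => |GenKahler.ricciPotential (g 0) (I 0) (J 0) x| ^ 2) ∧
    (⨆ x : M, GenKahler.gradSq (g t) (GenKahler.ricciPotential (g t) (I t) (J t)) x) ≤
      t⁻¹ * ⨆ x : M, |GenKahler.ricciPotential (g 0) (I 0) (J 0) x| ^ 2 := by
  have h0 : (0 : ℝ) ∈ GenKahler.timeSet T :=
    ⟨le_rfl, (EReal.coe_lt_coe_iff.2 ht).trans htT⟩
  have htm : t ∈ GenKahler.timeSet T := ⟨ht.le, htT⟩
  have hK0 := hflow.isGK 0 h0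
  have hK := hflow.isGK t htm
  have hn : ∀ s ∈ GenKahler.timeSet T, ∀ x, GenKahler.commDet (I s) (J s) x ≠ 0 :=
    fun s hs x => hflow.commDet_ne_zero
      ((GenKahler.isNondegenerate_iff hK0.symm hK0.posDef).1 hnondeg) hs x
  have hd0 := (hK0.mdifferentiable_ricciPotential (hn 0 h0)).continuous
  have hbdd : BddAbove (Set.range fun x : M =>
      |GenKahler.ricciPotential (g 0) (I 0) (J 0) x| ^ 2) :=
    isCompact_range (hd0.abs.pow 2) |>.bddAbove
  set S : ℝ := ⨆ x : M, |GenKahler.ricciPotential (g 0) (I 0) (J 0) x| ^ 2 with hS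
  have hS0 : 0 ≤ S := Real.iSup_nonneg fun x => by positivity
  have hB : ∀ x, |GenKahler.ricciPotential (g 0) (I 0) (J 0) x| ≤ Real.sqrt S := fun x =>
    Real.le_sqrt_of_sq_le (le_ciSup hbdd x)
  have hle : ∀ x, GenKahler.gradSq (g t) (GenKahler.ricciPotential (g t) (I t) (J t)) x ≤
      t⁻¹ * S := by
    intro x
    set u := GenKahler.gradSq (g t) (GenKahler.ricciPotential (g t) (I t) (J t)) x
    -- Bernstein's estimate on `[t / 2, t]` costs exactly the factor two in `½ Φ²`
    have h1 := hflow.sub_mul_gradSq_le hn hB (half_pos ht) (half_le_self ht.le) htT x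
    rw [Real.sq_sqrt hS0] at h1
    rw [inv_mul_eq_div, le_div_iff₀ ht]
    linarith
  exact ⟨(GenKahler.isNondegenerate_iff hK.symm hK.posDef).2 (hn t htm),
    hK.mdifferentiable_ricciPotential (hn t htm),
    ⟨t⁻¹ * S, by rintro _ ⟨x, rfl⟩; exact hle x⟩, hbdd,
    Real.iSup_le hle (mul_nonneg (inv_nonneg.2 ht.le) hS0)⟩
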